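/- Notation. Let $n\ge 1$, $\operatorname{Im}\tau>0$, $p=e^{\pi i\tau}$, $z_1,\dots,z_{2n}\in\mathbb C$, $x_j=e^{\pi i z_j}$, $X=x_1\cdots x_{2n}$. Write $(a;q)_\infty=\prod_{j\ge 0}(1-aq^j)$, $(a,b;q)_\infty=(a;q)_\infty(b;q)_\infty$, $\theta(x;q)=(x;q)_\infty(q/x;q)_\infty$, $\theta(a,b,c;q)=\theta(a;q)\theta(b;q)\theta(c;q)$, $\Delta(y)=\prod_{i<j}(y_i-y_j)$, and let $\left(\frac{\cdot}{3}\right)$ be the Legendre symbol. For a skew-symmetric $2r\times 2r$ matrix, $\operatorname{pf}(a_{ij})=\frac1{2^r r!}\sum_{\sigma\in S_{2r}}\operatorname{sgn}(\sigma)\prod_{j=1}^r a_{\sigma(2j-1)\sigma(2j)}$. Put $$P_n^{(1)}=\prod_{1\le i<j\le 2n}\frac{x_j^3}{x_i^3}\,\theta(-x_i^6/x_j^6;p^6)\ \operatorname{pf}_{1\le i,j\le 2n}\left(\frac{x_i\,\theta(x_i^2/x_j^2,-x_i^2/x_j^2,px_i^2/x_j^2;p^2)}{x_j\,\theta(-x_i^6/x_j^6;p^6)}\right),$$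 extended by continuity in $(z_1,\dots,z_{2n})$ to the points where some denominator $\theta(-x_i^6/x_j^6;p^6)$ vanishes (these denominators are nonzero on a dense set). Put $$C_1=\frac{(p;p)_\infty}{(p^2;p^2)_\infty^2\,(p^3;p^3)_\infty}.$$ For $N+l$ even and $\lambda\in\mathbb Z^l$ define the rational function $$T_\lambda(y_1,\dots,y_N)=\prod_{1\le i<j\le N}\frac{y_j^3+y_i^3}{y_j^2-y_i^2}\ \operatorname{pf}\begin{pmatrix}A&B\\-B^T&0\end{pmatrix},\qquad A_{ij}=\frac{y_j^2-y_i^2}{y_j^3+y_i^3},\quad B_{ij}=y_i^{\lambda_j},$$ where $A$ is $N\times N$ and $B$ is $N\times l$. Proposition. Assume $|p|<|x_i/x_j|<|p|^{-1}$ for $1\le i,j\le 2n$. Then the $T_\lambda$ below are Laurent polynomials, and (with their values taken as such) $$\begin{aligned}P_n^{(1)}={}&(-1)^nC_1^nX^{4-6n}\Delta(x_1^4,\dots,x_{2n}^4)\prod_{1\le i<j\le 2n}(-p^6x_i^6/x_j^6,\,-p^6x_j^6/x_i^6;p^6)_\infty\\&\times\sum_{m=0}^n\ \sum_{1\le k_1<\dots<k_m}\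 \prod_{i=1}^m\left(\frac{k_i+1}{3}\right)\frac{(-1)^{k_i-1}p^{2k_i-1}}{1-p^{2k_i-1}}\ T_{k_m-1,\dots,k_1-1,-k_1,\dots,-k_m}(x_1^2,\dots,x_{2n}^2),\end{aligned}$$ where the sums over $k_1<\dots<k_m$ converge absolutely. -/

import Mathlib

open Filter Topology

noncomputable section

namespace EllipticPfaffian

/-- The infinite product `(a; q)_∞ = ∏_{j ≥ 0} (1 - a q^j)`. -/
def qPoch (a q : ℂ) : ℂ := ∏' j : ℕ, (1 - a * q ^ j)

/-- The theta function `θ(x; q) = (x; q)_∞ (q / x; q)_∞`. -/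
def theta (x q : ℂ) : ℂ := qPoch x q * qPoch (q / x) q

/-- The product over all pairs `i < j` of indices. -/
def prodPairs {R : Type*} [CommMonoid R] {N : ℕ} (f : Fin N → Fin N → R) : R :=
  ∏ i : Fin N, ∏ j ∈ Finset.Ioi i, f i j

/-- The Vandermonde product `Δ(x) = ∏_{i < j} (x_i - x_j)`. -/
def vandermonde {N : ℕ} (x : Fin N → ℂ) : ℂ := prodPairs fun i j => x i - x j

/-- The pfaffian of a skew-symmetric matrix of even size `s = 2r`:
`1 / (2^r r!) ∑_σ sgn(σ) ∏_{j=1}^r a_{σ(2j-1) σ(2j)}` (indices here start from `0`). -/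
def pfaffian {K : Type*} [Field K] {s : ℕ} (A : Matrix (Fin s) (Fin s) K) : K :=
  1 / ((2 : K) ^ (s / 2) * ((s / 2).factorial : K)) *
    ∑ σ : Equiv.Perm (Fin s), ((Equiv.Perm.sign σ : ℤ) : K) *
      ∏ j : Fin (s / 2),
        A (σ ⟨2 * (j : ℕ), by omega⟩) (σ ⟨2 * (j : ℕ) + 1, by omega⟩)

/-- The nome `p = e^{π i τ}`. -/
def nome (τ : UpperHalfPlane) : ℂ := Complex.exp (Real.pi * Complex.I * (τ : ℂ))

/-- The multiplicative variables `x_j = e^{π i z_j}`. -/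
def expVar {N : ℕ} (z : Fin N → ℂ) (j : Fin N) : ℂ := Complex.exp (Real.pi * Complex.I * z j)

/-- `z` is a point where no denominator `θ(-x_i^6/x_j^6; p^6)` of the pfaffian vanishes. -/
def NoPole (n : ℕ) (τ : UpperHalfPlane) (z : Fin (2 * n) → ℂ) : Prop :=
  ∀ i j, theta (-(expVar z i ^ 6 / expVar z j ^ 6)) (nome τ ^ 6) ≠ 0

/-- The elliptic pfaffian `P_n^{(1)}(z_1, …, z_{2n}; τ)`, as given by its defining formula
(meaningful at the points satisfying `NoPole`). -/
def P1 (n : ℕ) (τ : UpperHalfPlane) (z : Fin (2 * n) → ℂ) : ℂ :=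
  (prodPairs fun i j =>
      expVar z j ^ 3 / expVar z i ^ 3 *
        theta (-(expVar z i ^ 6 / expVar z j ^ 6)) (nome τ ^ 6)) *
    pfaffian (Matrix.of fun i j =>
      expVar z i *
          (theta (expVar z i ^ 2 / expVar z j ^ 2) (nome τ ^ 2) *
            theta (-(expVar z i ^ 2 / expVar z j ^ 2)) (nome τ ^ 2) *
            theta (nome τ * (expVar z i ^ 2 / expVar z j ^ 2)) (nome τ ^ 2)) /
        (expVar z j * theta (-(expVar z i ^ 6 / expVar z j ^ 6)) (nome τ ^ 6)))

/-- The constant `C_1 = (p; p)_∞ / ((p²; p²)_∞² (p³; p³)_∞)`. -/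
def C1 (p : ℂ) : ℂ := qPoch p p / (qPoch (p ^ 2) (p ^ 2) ^ 2 * qPoch (p ^ 3) (p ^ 3))

/-- The field `ℂ(X_1, …, X_N)` of rational functions. -/
abbrev RatFun (N : ℕ) : Type := FractionRing (MvPolynomial (Fin N) ℂ)

/-- The variable `X_i` as a rational function. -/
def ratX {N : ℕ} (i : Fin N) : RatFun N :=
  algebraMap (MvPolynomial (Fin N) ℂ) (RatFun N) (MvPolynomial.X i)

/-- A rational function is a Laurent polynomial if multiplying it by a power of `X_1 ⋯ X_N`
gives a polynomial. -/
def IsLaurentPolynomial {N : ℕ} (f : RatFun N) : Prop :=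
  ∃ (r : ℕ) (g : MvPolynomial (Fin N) ℂ),
    f * (∏ i, ratX i) ^ r = algebraMap (MvPolynomial (Fin N) ℂ) (RatFun N) g

/-- The value of a rational function at a point, computed from its expression in lowest terms.
For a Laurent polynomial the reduced denominator is a monomial up to a constant, so this is
the usual value at every point with nonzero coordinates. -/
def ratEval {N : ℕ} (f : RatFun N) (y : Fin N → ℂ) : ℂ :=
  MvPolynomial.eval y (IsFractionRing.num (MvPolynomial (Fin N) ℂ) f) /
    MvPolynomial.eval y
      (IsFractionRing.den (MvPolynomial (Fin N) ℂ) f : MvPolynomial (Fin N) ℂ)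

/-- For `l + N` even and `μ ∈ ℤ^l`, the function
`T_μ = ∏_{i<j} (X_j³ + X_i³)/(X_j² - X_i²) · pf [[A, B], [-Bᵀ, 0]]`, where
`A_{ij} = (X_j² - X_i²)/(X_j³ + X_i³)` and `B_{ij} = X_i^{μ_j}`. -/
def T (N : ℕ) {l : ℕ} (μ : Fin l → ℤ) : RatFun N :=
  (prodPairs fun i j : Fin N =>
      (ratX j ^ 3 + ratX i ^ 3) / (ratX j ^ 2 - ratX i ^ 2)) *
    pfaffian (Matrix.reindex finSumFinEquiv finSumFinEquiv
      (Matrix.fromBlocks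
        (Matrix.of fun i j : Fin N =>
          (ratX j ^ 2 - ratX i ^ 2) / (ratX j ^ 3 + ratX i ^ 3))
        (Matrix.of fun (i : Fin N) (j : Fin l) => ratX i ^ μ j)
        (-(Matrix.of fun (i : Fin N) (j : Fin l) => ratX i ^ μ j).transpose)
        0))

/-- The index set of integer tuples `1 ≤ k_1 < ⋯ < k_m`. -/
abbrev Indices (m : ℕ) : Type := {k : Fin m → ℕ // (∀ i, 1 ≤ k i) ∧ StrictMono k}

/-- The tuple `(k_m - 1, …, k_1 - 1, -k_1, …, -k_m)`. -/
def tuple {m : ℕ} (k : Indices m) : Fin (m + m) → ℤ :=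
  Fin.append (fun i => (k.1 (Fin.rev i) : ℤ) - 1) (fun i => -(k.1 i : ℤ))

/-- The coefficient `∏_{i=1}^m ((k_i+1)/3) (-1)^{k_i-1} p^{2k_i-1} / (1 - p^{2k_i-1})`,
where `(·/3)` is the Legendre symbol. As all `k_i ≥ 1`, the subtractions do not truncate. -/
def coeff (p : ℂ) {m : ℕ} (k : Indices m) : ℂ :=
  ∏ i, (legendreSym 3 ((k.1 i : ℤ) + 1) : ℂ) *
    ((-1) ^ (k.1 i - 1) * p ^ (2 * k.1 i - 1) / (1 - p ^ (2 * k.1 i - 1)))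

/-- The term of the expansion indexed by `k_1 < ⋯ < k_m`:
the coefficient times `T_{k_m-1,…,k_1-1,-k_1,…,-k_m}(x_1²,…,x_N²)`. -/
def term (p : ℂ) {N : ℕ} (x : Fin N → ℂ) {m : ℕ} (k : Indices m) : ℂ :=
  coeff p k * ratEval (T N (tuple k)) (fun i => x i ^ 2)

/-- The right-hand side of the expansion of `P_n^{(1)}`, in terms of `p` and `x_1, …, x_{2n}`. -/
def expansion (n : ℕ) (p : ℂ) (x : Fin (2 * n) → ℂ) : ℂ :=
  (-1) ^ n * C1 p ^ n * (∏ i, x i) ^ (4 - 6 * (n : ℤ)) * vandermonde (fun i => x i ^ 4) *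
      (prodPairs fun i j =>
        qPoch (-(p ^ 6 * x i ^ 6 / x j ^ 6)) (p ^ 6) *
          qPoch (-(p ^ 6 * x j ^ 6 / x i ^ 6)) (p ^ 6)) *
    ∑ m ∈ Finset.range (n + 1), ∑' k : Indices m, term p x k

end EllipticPfaffian

end

noncomputable section

namespace EllipticPfaffian

/-! Write u = x_i/x_j, R(u) = u(1-u^4)/(1+u^6), and let L be the Lambert series with coefficients
((k+1)/3)(-1)^(k-1) p^(2k-1)/(1-p^(2k-1)) at u^(2k-1). Everything rests on the scalar identity that
the (i,j) entry of the pfaffian equals C_1 (R(u) - L(u) + L(1/u)) for |p| < |u| < 1/|p|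
(`thetaQuot_expansion`). Its proof is of Liouville type. In this annulus the theta quotient has
poles only where u^2 is a primitive sixth root of unity, and there its regular factor takes the
value C_1 (`thetaFactor_eq_C1`), so the difference D of the two sides extends holomorphically. Both
sides are invariant under u → pu, hence D is constant by the maximum principle
(`eq_of_mul_periodic`); it is odd, hence zero.

Multiplying by x_i x_j on the other side turns u^(2k-1) - u^(1-2k) into a matrix of rank two. So the
matrix of entries is C_1 times a diagonal congruence of A - ∑_k a_k ∧ b_k, where A is the upper left
block in the definition of T at the points x_i². A rank two change of a pfaffian adds one bordered
pfaffian (`pfSum_sub_wedge`, a Schur complement), and iteration gives a sum over finite sets of k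
(`pfNorm_sub_sum_wedge`). A set with more than n elements contributes zero, and the nested order of
the exponents in T differs from the paired order by an even permutation (`sign_nested`). This gives
the formula where no denominator vanishes (`P1_eq_expansion`).

The other points need the values of T where its defining formula is 0/0. T is a Laurent polynomial:
the denominators in each term of the pfaffian belong to disjoint pairs of variables, and the
pfaffian vanishes when two variables coincide (`isLaurent_T`). Bounds for its values come from small
circles on which the formula makes sense, by the maximum principle (`exists_local_bound`). They give
absolute convergence and continuity of the right-hand side, and hence the extension by continuity.
-/

/-! ### Infinite products and theta functions. -/

lemma summable_norm_mul_pow (a : ℂ) {q : ℂ} (hq : ‖q‖ < 1) :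
    Summable fun j : ℕ => ‖-(a * q ^ j)‖ := by
  simpa using (summable_geometric_of_lt_one (norm_nonneg _) hq).mul_left ‖a‖

lemma multipliable_qPoch (a : ℂ) {q : ℂ} (hq : ‖q‖ < 1) :
    Multipliable fun j : ℕ => (1 - a * q ^ j) := by
  simpa [sub_eq_add_neg] using multipliable_one_add_of_summable (summable_norm_mul_pow a hq)

lemma qPoch_ne_zero {a q : ℂ} (hq : ‖q‖ < 1) (h : ∀ j : ℕ, 1 - a * q ^ j ≠ 0) :
    qPoch a q ≠ 0 := by
  have := tprod_one_add_ne_zero_of_summable (f := fun j : ℕ => -(a * q ^ j))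
    (by simpa [sub_eq_add_neg] using h) (summable_norm_mul_pow a hq)
  simpa [qPoch, sub_eq_add_neg] using this

lemma qPoch_ne_zero_of_norm_lt {a q : ℂ} (hq : ‖q‖ < 1) (ha : ‖a‖ < 1) : qPoch a q ≠ 0 := by
  refine qPoch_ne_zero hq fun j h => ?_
  have h1 : ‖a * q ^ j‖ < 1 := by
    rw [norm_mul, norm_pow]
    exact mul_lt_one_of_nonneg_of_lt_one_left (norm_nonneg _) ha
      (pow_le_one₀ (norm_nonneg _) hq.le)
  rw [← sub_eq_zero.mp h] at h1
  simp at h1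

lemma qPoch_eq_mul (a : ℂ) {q : ℂ} (hq : ‖q‖ < 1) :
    qPoch a q = (1 - a) * qPoch (a * q) q := by
  have h := (multipliable_qPoch (a * q) hq)
  have h' : Multipliable fun j : ℕ => (1 - a * q ^ (j + 1)) := by
    simpa [pow_succ', mul_assoc] using h
  have h2 := tprod_eq_zero_mul' (f := fun j : ℕ => (1 - a * q ^ j)) h'
  rw [qPoch, h2, qPoch, pow_zero, mul_one]
  congr 2
  ext j
  ring

lemma qPoch_mul_qPoch (a b : ℂ) {q : ℂ} (hq : ‖q‖ < 1) :
    qPoch a q * qPoch b q = ∏' j : ℕ, (1 - a * q ^ j) * (1 - b * q ^ j) :=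
  ((multipliable_qPoch a hq).tprod_mul (multipliable_qPoch b hq)).symm

lemma norm_pow_lt_one {q : ℂ} (hq : ‖q‖ < 1) {n : ℕ} (hn : n ≠ 0) : ‖q ^ n‖ < 1 := by
  rw [norm_pow]; exact pow_lt_one₀ (norm_nonneg _) hq hn

lemma qPoch_split (a : ℂ) {q : ℂ} (hq : ‖q‖ < 1) :
    qPoch a q = qPoch a (q ^ 2) * qPoch (a * q) (q ^ 2) := by
  have h2 := norm_pow_lt_one hq two_ne_zero
  have := tprod_even_mul_odd (f := fun j : ℕ => (1 - a * q ^ j))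
    (by simpa [pow_mul] using multipliable_qPoch a h2)
    ((multipliable_qPoch (a * q) h2).congr fun j => by ring)
  simp only [qPoch]
  rw [← this]
  congr 1
  · simp [pow_mul]
  · congr 1; ext j; ring

lemma qPoch_mul_neg (a : ℂ) {q : ℂ} (hq : ‖q‖ < 1) :
    qPoch a q * qPoch (-a) q = qPoch (a ^ 2) (q ^ 2) := by
  rw [qPoch_mul_qPoch _ _ hq, qPoch]
  congr 1; ext j; ring

/-- If `w` is a primitive sixth root of unity, `(xw, x/w, -x; q)_∞ = (-x³; q³)_∞`. -/
lemma qPoch_cubic {w : ℂ} (hw : w ^ 2 - w + 1 = 0) (x : ℂ) {q : ℂ} (hq : ‖q‖ < 1) :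
    qPoch (x * w) q * qPoch (x / w) q * qPoch (-x) q = qPoch (-x ^ 3) (q ^ 3) := by
  have hw0 : w ≠ 0 := by rintro rfl; simp at hw
  have hinv : w⁻¹ = 1 - w := by
    field_simp; linear_combination hw
  rw [qPoch_mul_qPoch _ _ hq]
  simp only [qPoch]
  rw [← Multipliable.tprod_mul (((multipliable_qPoch _ hq).mul (multipliable_qPoch _ hq)))
    (multipliable_qPoch _ hq)]
  congr 1; ext j
  rw [div_eq_mul_inv, hinv]
  -- Factor by factor this is (1 - tw)(1 - t/w)(1 + t) = 1 + t^3 with t = x q^j, as w + 1/w = 1.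
  linear_combination (-x^2*(q^j)^2 - x^3 * (q^j)^3) * hw

lemma differentiable_qPoch {q : ℂ} (hq : ‖q‖ < 1) : Differentiable ℂ fun a => qPoch a q := by
  intro a
  have hD : DifferentiableOn ℂ (fun a => ∏' j : ℕ, (1 + -(a * q ^ j)))
      (Metric.ball (0 : ℂ) (‖a‖ + 1)) := by
    refine (Summable.hasProdLocallyUniformlyOn_nat_one_add (f := fun (j : ℕ) a => -(a * q ^ j))
      Metric.isOpen_ball
      (u := fun j => (‖a‖ + 1) * ‖q‖ ^ j)
      ((summable_geometric_of_lt_one (norm_nonneg _) hq).mul_left _)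
      (.of_forall fun j x hx => ?_) (fun j => by fun_prop)).differentiableOn
      (.of_forall fun s => ?_) Metric.isOpen_ball
    · rw [norm_neg, norm_mul, norm_pow]
      have : ‖x‖ < ‖a‖ + 1 := by simpa using hx
      gcongr
    · simpa [Finset.prod_fn] using
        DifferentiableOn.finsetProd (fun _ _ ↦ by fun_prop)
  simpa [qPoch, sub_eq_add_neg] using hD.differentiableAt (Metric.isOpen_ball.mem_nhds (by simp))

lemma theta_mul_self {x q : ℂ} (hq : ‖q‖ < 1) (hq0 : q ≠ 0) (hx : x ≠ 0) :
    theta (q * x) q = -x⁻¹ * theta x q := by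
  simp only [theta]
  rw [qPoch_eq_mul x hq, qPoch_eq_mul (q / (q * x)) hq, mul_comm x q,
    show q / (q * x) * q = q / x by field_simp, show q / (q * x) = x⁻¹ by field_simp]
  field_simp
  ring

/-- Isolates the only factor of the theta function that can vanish for |q| < |x| < 1/|q|. -/
lemma theta_eq_one_sub_mul {x q : ℂ} (hq : ‖q‖ < 1) :
    theta x q = (1 - x) * (qPoch (q * x) q * qPoch (q / x) q) := by
  rw [theta, qPoch_eq_mul x hq, mul_comm x q, mul_assoc]

/-! ### The Lambert series and its functional equation. -/

/-- The sign `((k + 1) / 3) (-1)^(k - 1)` at `k = j + 1`. -/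
def lambertSign (j : ℕ) : ℂ := (legendreSym 3 ((j + 1 : ℕ) + 1 : ℤ) : ℂ) * (-1) ^ j

/-- The coefficient of the Lambert series at `k = j + 1`. -/
def lambertCoeff (p : ℂ) (j : ℕ) : ℂ :=
  lambertSign j * (p ^ (2 * j + 1) / (1 - p ^ (2 * j + 1)))

lemma legendreSym_three_add (a : ℤ) : legendreSym 3 (a + 3) = legendreSym 3 a := by
  simp only [legendreSym]
  congr 1
  push_cast
  rw [show (3 : ZMod 3) = 0 from rfl, add_zero]

lemma lambertSign_add_three (j : ℕ) : lambertSign (j + 3) = -lambertSign j := by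
  have := legendreSym_three_add (((j + 1 : ℕ) : ℤ) + 1)
  rw [lambertSign, lambertSign, ← this]
  push_cast
  rw [show (j : ℤ) + 1 + 1 + 3 = j + 3 + 1 + 1 by ring]
  ring

lemma lambertSign_zero : lambertSign 0 = -1 := by
  have : legendreSym 3 2 = -1 := by decide
  simp [lambertSign, this]

lemma lambertSign_one : lambertSign 1 = 0 := by
  have : legendreSym 3 3 = 0 := by decide
  simp [lambertSign, this]

lemma lambertSign_two : lambertSign 2 = 1 := by
  have : legendreSym 3 4 = 1 := by decide
  simp [lambertSign, this]

lemma norm_lambertSign_le (j : ℕ) : ‖lambertSign j‖ ≤ 1 := by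
  induction j using Nat.strong_induction_on with
  | _ j ih =>
    match j with
    | 0 => simp [lambertSign_zero]
    | 1 => simp [lambertSign_one]
    | 2 => simp [lambertSign_two]
    | j + 3 => rw [lambertSign_add_three, norm_neg]; exact ih j (by omega)

lemma one_sub_pow_ne_zero {p : ℂ} (hp : ‖p‖ < 1) (j : ℕ) : 1 - p ^ (2 * j + 1) ≠ 0 := by
  intro h
  have := norm_pow_lt_one hp (n := 2 * j + 1) (by omega)
  rw [← sub_eq_zero.mp h] at this
  simp at this

lemma norm_lambertCoeff_le {p : ℂ} (hp : ‖p‖ < 1) (j : ℕ) :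
    ‖lambertCoeff p j‖ ≤ (1 - ‖p‖)⁻¹ * ‖p‖ ^ (2 * j + 1) := by
  have h1 : 1 - ‖p‖ ≤ ‖1 - p ^ (2 * j + 1)‖ := by
    have h2 : ‖p ^ (2 * j + 1)‖ ≤ ‖p‖ := by
      rw [norm_pow]
      exact pow_le_of_le_one (norm_nonneg _) hp.le (by omega)
    have h3 := norm_sub_norm_le (1 : ℂ) (p ^ (2 * j + 1))
    rw [norm_one] at h3
    linarith
  have h0 : 0 < 1 - ‖p‖ := by linarith
  rw [lambertCoeff, norm_mul, norm_div, norm_pow, div_eq_inv_mul]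
  refine (mul_le_of_le_one_left (by positivity) (norm_lambertSign_le j)).trans ?_
  gcongr

lemma summable_pow_odd {r : ℝ} (h0 : 0 ≤ r) (h1 : r < 1) :
    Summable fun j : ℕ => r ^ (2 * j + 1) := by
  have := (summable_geometric_of_lt_one (sq_nonneg r) (by nlinarith)).mul_right r
  exact this.congr fun j => by ring

lemma summable_sign_pow {v : ℂ} (hv : ‖v‖ < 1) :
    Summable fun j : ℕ => lambertSign j * v ^ (2 * j + 1) := by
  refine .of_norm_bounded (summable_pow_odd (norm_nonneg v) hv) fun j => ?_
  rw [norm_mul, norm_pow]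
  exact mul_le_of_le_one_left (by positivity) (norm_lambertSign_le j)

/-- The series `∑ ((k + 1) / 3) (-1)^(k - 1) v^(2 k - 1)`. -/
def signSeries (v : ℂ) : ℂ := ∑' j : ℕ, lambertSign j * v ^ (2 * j + 1)

/-- The Lambert series `∑ c_k v^(2 k - 1)`. -/
def lambertSeries (p v : ℂ) : ℂ := ∑' j : ℕ, lambertCoeff p j * v ^ (2 * j + 1)

/-- The signs are antiperiodic with period 3 and begin -1, 0, 1, so the series is geometric with
ratio -v^6 and leading block -v + v^5. -/
lemma signSeries_eq {v : ℂ} (hv : ‖v‖ < 1) : signSeries v * (1 + v ^ 6) = -(v * (1 - v ^ 4)) := by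
  have h := (summable_sign_pow hv).sum_add_tsum_nat_add 3
  have h2 : ∑' j : ℕ, lambertSign (j + 3) * v ^ (2 * (j + 3) + 1) = -v ^ 6 * signSeries v := by
    rw [signSeries, ← tsum_mul_left]
    congr 1; ext j
    rw [lambertSign_add_three]; ring
  rw [h2] at h
  simp only [Finset.sum_range_succ, Finset.sum_range_zero, lambertSign_zero, lambertSign_one,
    lambertSign_two] at h
  change _ = signSeries v at h
  linear_combination -h

lemma norm_lambert_term_le {p : ℂ} (hp : ‖p‖ < 1) (v : ℂ) (j : ℕ) :
    ‖lambertCoeff p j * v ^ (2 * j + 1)‖ ≤ (1 - ‖p‖)⁻¹ * (‖p‖ * ‖v‖) ^ (2 * j + 1) := by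
  rw [norm_mul, norm_pow, mul_pow, ← mul_assoc]
  gcongr
  exact norm_lambertCoeff_le hp j

lemma summable_lambert {p v : ℂ} (hp : ‖p‖ < 1) (hv : ‖p‖ * ‖v‖ < 1) :
    Summable fun j : ℕ => lambertCoeff p j * v ^ (2 * j + 1) :=
  .of_norm_bounded ((summable_pow_odd (by positivity) hv).mul_left _)
    (norm_lambert_term_le hp v)

/-- Termwise this is q + q·q/(1-q) = q/(1-q) with q = p^(2j+1). -/
lemma lambertSeries_shift {p u : ℂ} (hp : ‖p‖ < 1) (hu : ‖p‖ * ‖u‖ < 1) :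
    signSeries (p * u) + lambertSeries p (p * u) = lambertSeries p u := by
  have hpu : ‖p * u‖ < 1 := by rwa [norm_mul]
  rw [signSeries, lambertSeries, lambertSeries, ← Summable.tsum_add (summable_sign_pow hpu)
    (summable_lambert hp (by
      calc ‖p‖ * ‖p * u‖ ≤ 1 * ‖p * u‖ := by gcongr
        _ < 1 := by rwa [one_mul]))]
  congr 1; ext j
  have := one_sub_pow_ne_zero hp j
  rw [lambertCoeff, mul_pow]
  field_simp
  ring

lemma lambertSeries_neg (p v : ℂ) : lambertSeries p (-v) = -lambertSeries p v := by
  rw [lambertSeries, lambertSeries, ← tsum_neg]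
  congr 1; ext j
  rw [Odd.neg_pow ⟨j, rfl⟩]; ring

lemma differentiableAt_lambertSeries {p v : ℂ} (hp : ‖p‖ < 1) (hv : ‖p‖ * ‖v‖ < 1) :
    DifferentiableAt ℂ (lambertSeries p) v := by
  -- A slightly larger disc on which the series still has a geometric majorant.
  obtain ⟨r, hvr, hr⟩ : ∃ r, ‖v‖ < r ∧ ‖p‖ * r < 1 := by
    have hc : ContinuousAt (fun r => ‖p‖ * r) ‖v‖ := by fun_prop
    have h1 := hc.eventually_lt continuousAt_const hv
    obtain ⟨r, h, h'⟩ := ((h1.filter_mono nhdsWithin_le_nhds).and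
      (self_mem_nhdsWithin (a := ‖v‖) (s := Set.Ioi ‖v‖))).exists
    exact ⟨r, h', h⟩
  have hr0 : 0 ≤ r := (norm_nonneg v).trans hvr.le
  have := Complex.differentiableOn_tsum_of_summable_norm
    (F := fun (j : ℕ) v => lambertCoeff p j * v ^ (2 * j + 1)) (U := Metric.ball (0 : ℂ) r)
    ((summable_pow_odd (mul_nonneg (norm_nonneg p) hr0) hr).mul_left (1 - ‖p‖)⁻¹)
    (fun j => by fun_prop) Metric.isOpen_ball (fun j w hw => ?_)
  · exact this.differentiableAt (Metric.isOpen_ball.mem_nhds (by simpa using hvr))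
  · refine (norm_lambert_term_le hp w j).trans ?_
    have h0 : 0 < 1 - ‖p‖ := by linarith
    have : ‖w‖ < r := by simpa using hw
    gcongr

/-! ### The quotient of theta functions. -/

/-- The regular factor of the quotient of theta functions in the entries of the pfaffian. -/
def thetaFactor (p w : ℂ) : ℂ :=
  qPoch (p ^ 2 * w) (p ^ 2) * qPoch (p ^ 2 / w) (p ^ 2) *
      (qPoch (p ^ 2 * -w) (p ^ 2) * qPoch (p ^ 2 / -w) (p ^ 2)) *
      (qPoch (p * w) (p ^ 2) * qPoch (p / w) (p ^ 2)) /
    (qPoch (p ^ 6 * -w ^ 3) (p ^ 6) * qPoch (p ^ 6 / -w ^ 3) (p ^ 6))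

/-- The quotient of theta functions in the entries of the pfaffian. -/
def thetaQuot (p w : ℂ) : ℂ :=
  theta w (p ^ 2) * theta (-w) (p ^ 2) * theta (p * w) (p ^ 2) / theta (-w ^ 3) (p ^ 6)

/-- Confines the poles in |p|^2 < |w| < |p|^(-2) to the rational factor. Since 1 - w^2 cancels the
zero of 1 + w^3 at -1, only primitive sixth roots of unity remain. -/
lemma thetaQuot_eq {p w : ℂ} (hp0 : p ≠ 0) (hp : ‖p‖ < 1) :
    thetaQuot p w = (1 - w ^ 2) / (1 + w ^ 3) * thetaFactor p w := by
  have h2 := norm_pow_lt_one hp two_ne_zero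
  have h6 := norm_pow_lt_one hp (n := 6) (by norm_num)
  rw [thetaQuot, theta_eq_one_sub_mul h2, theta_eq_one_sub_mul (x := -w) h2,
    theta_eq_one_sub_mul (x := -w ^ 3) h6, theta, thetaFactor, div_mul_div_comm,
    show p ^ 2 / (p * w) = p / w by rw [sq, mul_div_mul_left _ _ hp0]]
  congr 1 <;> ring

/-- The three numerator theta functions together acquire 1/(p w^3) and the denominator acquires
1/w^3. -/
lemma thetaQuot_shift {p w : ℂ} (hp0 : p ≠ 0) (hp : ‖p‖ < 1) (hw : w ≠ 0) :
    p * thetaQuot p (p ^ 2 * w) = thetaQuot p w := by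
  have h2 := norm_pow_lt_one hp two_ne_zero
  have h6 := norm_pow_lt_one hp (n := 6) (by norm_num)
  have e1 := theta_mul_self h2 (pow_ne_zero 2 hp0) hw
  have e2 := theta_mul_self h2 (pow_ne_zero 2 hp0) (neg_ne_zero.mpr hw)
  have e3 := theta_mul_self h2 (pow_ne_zero 2 hp0) (mul_ne_zero hp0 hw)
  have e4 := theta_mul_self h6 (pow_ne_zero 6 hp0) (neg_ne_zero.mpr (pow_ne_zero 3 hw))
  rw [thetaQuot, thetaQuot, e1, show -(p ^ 2 * w) = p ^ 2 * -w by ring, e2,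
    show p * (p ^ 2 * w) = p ^ 2 * (p * w) by ring, e3,
    show -(p ^ 2 * w) ^ 3 = p ^ 6 * -w ^ 3 by ring, e4]
  -- At a zero of the denominator both sides are 0 by the convention for division.
  by_cases h : theta (-w ^ 3) (p ^ 6) = 0
  · simp [h]
  · field_simp

/-- Each pair of factors with w and 1/w is completed to a triple product by `qPoch_cubic`, with x =
p^2, p, -p^2. What is left reduces to C_1 through (-p;p)_∞ (p;p)_∞ = (p^2;p^2)_∞ and the same
relation for p^3. -/
lemma thetaFactor_eq_C1 {p w : ℂ} (hp : ‖p‖ < 1) (hw : w ^ 2 - w + 1 = 0) :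
    thetaFactor p w = C1 p := by
  have h2 := norm_pow_lt_one hp two_ne_zero
  have h3 := norm_pow_lt_one hp three_ne_zero
  have h6 := norm_pow_lt_one hp (n := 6) (by norm_num)
  have hw3 : w ^ 3 = -1 := by linear_combination (w + 1) * hw
  have a1 := qPoch_cubic hw (p ^ 2) h2
  have a2 := qPoch_cubic hw p h2
  have a3 := qPoch_cubic hw (-p ^ 2) h2
  have b1 := qPoch_split p hp
  have b2 := qPoch_split (-p) hp
  have b3 := qPoch_split (-p ^ 3) h3
  have c1 := qPoch_mul_neg p hp
  have c3 := qPoch_mul_neg (p ^ 3) h3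
  have np : ‖-p‖ < 1 := by rwa [norm_neg]
  have np2 : ‖-p ^ 2‖ < 1 := by rwa [norm_neg]
  have np3 : ‖-p ^ 3‖ < 1 := by rwa [norm_neg]
  have n1 := qPoch_ne_zero_of_norm_lt hp hp
  have n2 := qPoch_ne_zero_of_norm_lt h2 h2
  have n3 := qPoch_ne_zero_of_norm_lt h3 h3
  have n4 := qPoch_ne_zero_of_norm_lt h6 h6
  have n5 := qPoch_ne_zero_of_norm_lt h2 np
  have n6 := qPoch_ne_zero_of_norm_lt h2 np2
  rw [show (p ^ 2) ^ 3 = p ^ 6 by ring] at a1 a2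
  rw [show -(-p ^ 2) ^ 3 = p ^ 6 by ring, show (p ^ 2) ^ 3 = p ^ 6 by ring,
    show -(-p ^ 2) = p ^ 2 by ring] at a3
  rw [show p * p = p ^ 2 by ring] at b1
  rw [show -p * p = -p ^ 2 by ring] at b2
  rw [show -p ^ 3 * p ^ 3 = -p ^ 6 by ring, show (p ^ 3) ^ 2 = p ^ 6 by ring] at b3
  rw [show (p ^ 3) ^ 2 = p ^ 6 by ring] at c3
  rw [thetaFactor, C1, hw3, neg_neg, mul_one, div_one,
    show p ^ 2 * -w = -p ^ 2 * w by ring, show p ^ 2 / -w = -p ^ 2 / w by ring,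
    div_eq_div_iff (by positivity) (by positivity)]
  rw [b3] at c3
  rw [b2] at c1
  generalize qPoch (p ^ 2 * w) (p ^ 2) * qPoch (p ^ 2 / w) (p ^ 2) = A1 at *
  generalize qPoch (p * w) (p ^ 2) * qPoch (p / w) (p ^ 2) = A2 at *
  generalize qPoch (-p ^ 2 * w) (p ^ 2) * qPoch (-p ^ 2 / w) (p ^ 2) = A3 at *
  rw [← a1, ← a2] at c3
  have hne : qPoch (-p ^ 2) (p ^ 2) * qPoch (-p) (p ^ 2) ≠ 0 := mul_ne_zero n6 n5
  apply mul_right_cancel₀ hne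
  linear_combination (A3 * qPoch (p ^ 2) (p ^ 2) ^ 2) * c3 +
    (qPoch (p ^ 6) (p ^ 6) * qPoch (p ^ 2) (p ^ 2)) * a3 - qPoch (p ^ 6) (p ^ 6) ^ 2 * c1

/-! ### The Liouville argument on an annulus. -/

/-- The annulus `r < |u| < r⁻¹`. -/
def annulus (r : ℝ) : Set ℂ := {u | r < ‖u‖ ∧ ‖u‖ < r⁻¹}

lemma isOpen_annulus (r : ℝ) : IsOpen (annulus r) :=
  (isOpen_lt continuous_const continuous_norm).inter (isOpen_lt continuous_norm continuous_const)

lemma ne_zero_of_mem_annulus {r : ℝ} (hr : 0 ≤ r) {u : ℂ} (hu : u ∈ annulus r) : u ≠ 0 :=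
  norm_pos_iff.mp (hr.trans_lt hu.1)

lemma pow_mem_annulus {r : ℝ} (hr : 0 ≤ r) {u : ℂ} (hu : u ∈ annulus r) {n : ℕ} (hn : n ≠ 0) :
    u ^ n ∈ annulus (r ^ n) := by
  refine ⟨?_, ?_⟩
  · rw [norm_pow]; exact pow_lt_pow_left₀ hu.1 hr hn
  · rw [norm_pow, ← inv_pow]; exact pow_lt_pow_left₀ hu.2 (norm_nonneg _) hn

lemma inv_mem_annulus {r : ℝ} (hr : 0 < r) {u : ℂ} (hu : u ∈ annulus r) : u⁻¹ ∈ annulus r := by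
  have h0 : 0 < ‖u‖ := hr.trans hu.1
  refine ⟨?_, ?_⟩
  · rw [norm_inv]; exact (lt_inv_comm₀ hr h0).mpr hu.2
  · rw [norm_inv]; exact (inv_lt_inv₀ h0 hr).mpr hu.1

lemma mul_norm_lt_one {r : ℝ} (hr : 0 < r) {u : ℂ} (hu : u ∈ annulus r) : r * ‖u‖ < 1 := by
  have := mul_lt_mul_of_pos_left hu.2 hr
  rwa [mul_inv_cancel₀ hr.ne'] at this

lemma differentiableOn_thetaFactor {p : ℂ} (hp0 : p ≠ 0) (hp : ‖p‖ < 1) :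
    DifferentiableOn ℂ (thetaFactor p) (annulus (‖p‖ ^ 2)) := by
  have h2 := norm_pow_lt_one hp two_ne_zero
  have h6 := norm_pow_lt_one hp (n := 6) (by norm_num)
  have hpos : 0 < ‖p‖ := norm_pos_iff.mpr hp0
  intro w hw
  have hw0 := ne_zero_of_mem_annulus (by positivity) hw
  have hw3 := pow_mem_annulus (by positivity) hw three_ne_zero
  have hi3 := inv_mem_annulus (by positivity) hw3
  rw [← pow_mul] at hw3 hi3
  have e1 := mul_norm_lt_one (by positivity) hw3
  have e2 := mul_norm_lt_one (by positivity) hi3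
  have n1 : qPoch (p ^ 6 * -w ^ 3) (p ^ 6) ≠ 0 := by
    refine qPoch_ne_zero_of_norm_lt h6 ?_
    simpa using e1
  have n2 : qPoch (p ^ 6 / -w ^ 3) (p ^ 6) ≠ 0 := by
    refine qPoch_ne_zero_of_norm_lt h6 ?_
    simpa [div_eq_mul_inv] using e2
  have D2 := differentiable_qPoch h2
  have D6 := differentiable_qPoch h6
  have c1 : ∀ c : ℂ, DifferentiableAt ℂ (fun w : ℂ => c / w) w := fun c => by
    fun_prop (disch := assumption)
  have c2 : DifferentiableAt ℂ (fun w : ℂ => p ^ 2 / -w) w :=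
    (differentiableAt_const _).div differentiableAt_id.neg (neg_ne_zero.mpr hw0)
  have c3 : DifferentiableAt ℂ (fun w : ℂ => p ^ 6 / -w ^ 3) w :=
    (differentiableAt_const _).div (by fun_prop) (neg_ne_zero.mpr (pow_ne_zero 3 hw0))
  have comp2 : ∀ g : ℂ → ℂ, DifferentiableAt ℂ g w →
      DifferentiableAt ℂ (fun w => qPoch (g w) (p ^ 2)) w := fun g hg => (D2 _).comp w hg
  have comp6 : ∀ g : ℂ → ℂ, DifferentiableAt ℂ g w →
      DifferentiableAt ℂ (fun w => qPoch (g w) (p ^ 6)) w := fun g hg => (D6 _).comp w hg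
  refine DifferentiableAt.differentiableWithinAt ?_
  unfold thetaFactor
  refine DifferentiableAt.div ?_ ?_ (mul_ne_zero n1 n2)
  · exact (((comp2 _ (by fun_prop)).mul (comp2 _ (c1 _))).mul
      ((comp2 _ (by fun_prop)).mul (comp2 _ c2))).mul
      ((comp2 _ (by fun_prop)).mul (comp2 _ (c1 _)))
  · exact (comp6 _ (by fun_prop)).mul (comp6 _ c3)

/-- Division of `R - c` by a quadratic polynomial at whose roots `R = c`. -/
lemma exists_differentiableOn_quotient {R : ℂ → ℂ} {s : Set ℂ} (hs : IsOpen s)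
    (hR : DifferentiableOn ℂ R s) {a b c : ℂ} (ha : a ∈ s) (hb : b ∈ s) (hab : a ≠ b)
    (hRa : R a = c) (hRb : R b = c) :
    ∃ H : ℂ → ℂ, DifferentiableOn ℂ H s ∧ ∀ w, (w - a) * (w - b) * H w = R w - c := by
  -- `dslope R a` is (R - c)/(w - a) with the singularity removed. It vanishes at b, because R b = c
  -- and a ≠ b, so the construction can be repeated there.
  refine ⟨dslope (dslope R a) b, ?_, fun w => ?_⟩
  · exact (Complex.differentiableOn_dslope (hs.mem_nhds hb)).mpr
      ((Complex.differentiableOn_dslope (hs.mem_nhds ha)).mpr hR)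
  · have h1 := sub_smul_dslope R a w
    have h2 := sub_smul_dslope (dslope R a) b w
    have h3 := sub_smul_dslope R a b
    rw [hRa, hRb, sub_self, smul_eq_mul, mul_eq_zero, sub_eq_zero] at h3
    rw [h3.resolve_left hab.symm, sub_zero, smul_eq_mul] at h2
    rw [hRa, smul_eq_mul] at h1
    rw [mul_assoc, h2, h1]

/-- A function on the annulus `r < |u| < 1/r` with multiplicative period `p`, where `|p| = r`,
is constant. -/
lemma eq_of_mul_periodic {p : ℂ} (hp0 : p ≠ 0) (hp : ‖p‖ < 1) {D : ℂ → ℂ}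
    (hD : DifferentiableOn ℂ D (annulus ‖p‖))
    (hper : ∀ u, 1 < ‖u‖ → ‖u‖ < ‖p‖⁻¹ → D (p * u) = D u) {u v : ℂ}
    (hu : u ∈ annulus ‖p‖) (hv : v ∈ annulus ‖p‖) : D u = D v := by
  have hpos : 0 < ‖p‖ := norm_pos_iff.mpr hp0
  -- The closed annulus r ≤ |u| ≤ 1/r has ratio of radii 1/|p|, so multiplication by p or 1/p brings
  -- every point of the open annulus into it. Its compactness then provides a global maximum of |D|.
  set r := √‖p‖ with hr
  have hr0 : 0 < r := Real.sqrt_pos.mpr hpos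
  have hrr : r * r = ‖p‖ := Real.mul_self_sqrt hpos.le
  have hr1 : r < 1 := by nlinarith
  have hri : 1 < r⁻¹ := (one_lt_inv₀ hr0).mpr hr1
  have hpr : ‖p‖ < r := by nlinarith
  set K : Set ℂ := {u | r ≤ ‖u‖ ∧ ‖u‖ ≤ r⁻¹}
  have hKsub : K ⊆ annulus ‖p‖ := fun u hu =>
    ⟨hpr.trans_le hu.1, hu.2.trans_lt ((inv_lt_inv₀ hr0 hpos).mpr hpr)⟩
  have hK : IsCompact K := by
    refine Metric.isCompact_of_isClosed_isBounded ?_ ?_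
    · exact (isClosed_le continuous_const continuous_norm).inter
        (isClosed_le continuous_norm continuous_const)
    · refine (Metric.isBounded_closedBall (x := (0 : ℂ)) (r := r⁻¹)).subset fun u hu => ?_
      simpa using hu.2
  obtain ⟨c, hcK, hc⟩ := hK.exists_isMaxOn ⟨1, by simp [K, hr1.le, hri.le]⟩
    ((hD.continuousOn.mono hKsub).norm)
  have hmax : ∀ u ∈ annulus ‖p‖, ‖D u‖ ≤ ‖D c‖ := by
    intro u hu
    by_cases h1 : ‖u‖ < r
    · have hu0 := ne_zero_of_mem_annulus hpos.le hu
      have hn : ‖p⁻¹ * u‖ = ‖u‖ / ‖p‖ := by rw [norm_mul, norm_inv]; field_simp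
      have e1 : 1 < ‖p⁻¹ * u‖ := by rw [hn, one_lt_div hpos]; exact hu.1
      have e2 : ‖p⁻¹ * u‖ ≤ r⁻¹ := by
        rw [hn, ← hrr, div_le_iff₀ (by positivity)]
        field_simp; exact h1.le
      have e3 : ‖p⁻¹ * u‖ < ‖p‖⁻¹ := e2.trans_lt ((inv_lt_inv₀ hr0 hpos).mpr hpr)
      have := hper _ e1 e3
      rw [mul_inv_cancel_left₀ hp0] at this
      rw [this]
      exact hc ⟨hr1.le.trans e1.le, e2⟩
    by_cases h2 : r⁻¹ < ‖u‖
    · have hu1 : 1 < ‖u‖ := hri.trans h2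
      rw [← hper u hu1 hu.2]
      refine hc ⟨?_, ?_⟩
      · rw [norm_mul, ← hrr]
        have : 1 < r * ‖u‖ := by
          have := mul_lt_mul_of_pos_left h2 hr0
          rwa [mul_inv_cancel₀ hr0.ne'] at this
        nlinarith
      · rw [norm_mul]
        exact (mul_norm_lt_one hpos hu).le.trans hri.le
    · exact hc ⟨not_lt.mp h1, not_lt.mp h2⟩
  -- The exponential pulls the annulus back to a vertical strip, whose convexity gives the
  -- connectedness needed for the maximum principle.
  set U : Set ℂ := {s | Real.log ‖p‖ < s.re ∧ s.re < -Real.log ‖p‖}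
  have hUo : IsOpen U := (isOpen_lt continuous_const Complex.continuous_re).inter
    (isOpen_lt Complex.continuous_re continuous_const)
  have hUc : IsPreconnected U :=
    ((convex_halfSpace_re_gt _).inter (convex_halfSpace_re_lt _)).isPreconnected
  have hexp : ∀ s, s ∈ U ↔ Complex.exp s ∈ annulus ‖p‖ := by
    intro s
    simp only [U, annulus, Set.mem_ofPred_eq, Complex.norm_exp]
    rw [← Real.log_inv, Real.log_lt_iff_lt_exp hpos, Real.lt_log_iff_exp_lt (by positivity)]
  have hdiff : DifferentiableOn ℂ (fun s => D (Complex.exp s)) U :=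
    hD.comp (Complex.differentiable_exp.differentiableOn) fun s hs => (hexp s).mp hs
  have hc' := hKsub hcK
  have hcU : Complex.log c ∈ U := by
    rw [hexp, Complex.exp_log (ne_zero_of_mem_annulus hpos.le hc')]; exact hc'
  have key := Complex.eqOn_of_isPreconnected_of_isMaxOn_norm hUc hUo hdiff hcU (by
    intro s hs
    simp only [Function.comp, Set.mem_ofPred_eq]
    rw [Complex.exp_log (ne_zero_of_mem_annulus hpos.le hc')]
    exact hmax _ ((hexp s).mp hs))
  have hall : ∀ u ∈ annulus ‖p‖, D u = D (Complex.exp (Complex.log c)) := by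
    intro u hu
    have h0 := ne_zero_of_mem_annulus hpos.le hu
    have := key (x := Complex.log u) (by rw [hexp, Complex.exp_log h0]; exact hu)
    simpa [Complex.exp_log h0] using this
  rw [hall u hu, hall v hv]

/-- The Lambert series expansion of the entries of the pfaffian. -/
theorem thetaQuot_expansion {p u : ℂ} (hp0 : p ≠ 0) (hp : ‖p‖ < 1) (hu : u ∈ annulus ‖p‖)
    (hpole : 1 + u ^ 6 ≠ 0) :
    u * thetaQuot p (u ^ 2) = C1 p * (u * (1 - u ^ 4) / (1 + u ^ 6) -
      (lambertSeries p u - lambertSeries p u⁻¹)) := by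
  have hpos : 0 < ‖p‖ := norm_pos_iff.mpr hp0
  -- A square root of -3; the primitive sixth roots of unity are (1 ± s)/2.
  obtain ⟨s, hs⟩ := IsAlgClosed.exists_pow_nat_eq (-3 : ℂ) two_pos
  obtain ⟨a, b, hab, hsum, hprod⟩ : ∃ a b : ℂ, a ≠ b ∧ a + b = 1 ∧ a * b = 1 := by
    refine ⟨(1 + s) / 2, (1 - s) / 2, fun h => ?_, by ring, by linear_combination -hs / 4⟩
    have : s = 0 := by linear_combination h
    rw [this] at hs; norm_num at hs
  have hroot : ∀ a b : ℂ, a + b = 1 → a * b = 1 → a ^ 2 - a + 1 = 0 := fun a b h h' => by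
    linear_combination a * h - h'
  have hmem : ∀ a : ℂ, a ^ 2 - a + 1 = 0 → a ∈ annulus (‖p‖ ^ 2) := by
    intro a ha
    have h3 : ‖a‖ ^ 3 = 1 := by
      rw [← norm_pow, show a ^ 3 = -1 by linear_combination (a + 1) * ha]; simp
    have h1 : ‖a‖ = 1 := (pow_eq_one_iff_of_nonneg (norm_nonneg _) three_ne_zero).mp h3
    refine ⟨?_, ?_⟩ <;> rw [h1]
    · nlinarith
    · rw [one_lt_inv₀ (by positivity)]; nlinarith
  have ha := hroot a b hsum hprod
  have hb := hroot b a (by rw [add_comm]; exact hsum) (by rw [mul_comm]; exact hprod)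
  obtain ⟨H, hH, hHeq⟩ := exists_differentiableOn_quotient (isOpen_annulus _)
    (differentiableOn_thetaFactor hp0 hp) (hmem a ha) (hmem b hb) hab
    (thetaFactor_eq_C1 hp ha) (thetaFactor_eq_C1 hp hb)
  -- The difference of the two sides with the poles already divided out, so that it is defined on
  -- the whole annulus.
  set D : ℂ → ℂ := fun u => u * (1 - u ^ 2) * H (u ^ 2) +
    C1 p * (lambertSeries p u - lambertSeries p u⁻¹) with hDdef
  have hDeq : ∀ u : ℂ, 1 + u ^ 6 ≠ 0 → D u = u * thetaQuot p (u ^ 2) -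
      C1 p * (u * (1 - u ^ 4) / (1 + u ^ 6) - (lambertSeries p u - lambertSeries p u⁻¹)) := by
    intro u hu
    have h1 := hHeq (u ^ 2)
    rw [show (u ^ 2 - a) * (u ^ 2 - b) = u ^ 4 - u ^ 2 + 1 by
      linear_combination (-u ^ 2) * hsum + hprod] at h1
    rw [thetaQuot_eq hp0 hp, show (u ^ 2) ^ 3 = u ^ 6 by ring, hDdef]
    have h2 : u * (1 - u ^ 2) * H (u ^ 2) * (1 + u ^ 6) =
        u * (1 - u ^ 4) * (thetaFactor p (u ^ 2) - C1 p) := by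
      rw [← h1]; ring
    have h3 : u * (1 - u ^ 2) * H (u ^ 2) =
        u * (1 - u ^ 4) * (thetaFactor p (u ^ 2) - C1 p) / (1 + u ^ 6) := by
      rw [eq_div_iff hu, h2]
    simp only []
    rw [h3]
    field_simp
    ring
  have hDd : DifferentiableOn ℂ D (annulus ‖p‖) := by
    intro u hu
    have hu0 := ne_zero_of_mem_annulus hpos.le hu
    have hm := pow_mem_annulus hpos.le hu two_ne_zero
    have d1 : DifferentiableAt ℂ (fun u : ℂ => H (u ^ 2)) u :=
      DifferentiableAt.comp u (hH.differentiableAt ((isOpen_annulus _).mem_nhds hm))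
        (by fun_prop)
    have d2 := differentiableAt_lambertSeries hp (mul_norm_lt_one hpos hu)
    have d3 : DifferentiableAt ℂ (fun u : ℂ => lambertSeries p u⁻¹) u :=
      DifferentiableAt.comp u (differentiableAt_lambertSeries hp
        (mul_norm_lt_one hpos (inv_mem_annulus hpos hu))) (differentiableAt_inv hu0)
    exact (((by fun_prop : DifferentiableAt ℂ (fun u : ℂ => u * (1 - u ^ 2)) u).mul d1).add
      ((d2.sub d3).const_mul _)).differentiableWithinAt
  have hnp : ∀ u : ℂ, ‖u‖ ≠ 1 → 1 + u ^ 6 ≠ 0 := by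
    intro u hu h
    apply hu
    have : ‖u‖ ^ 6 = 1 := by
      rw [← norm_pow, show u ^ 6 = -1 by linear_combination h]; simp
    exact (pow_eq_one_iff_of_nonneg (norm_nonneg _) (by norm_num)).mp this
  -- Here |pu| < 1 < |u|, so neither point is a pole, and the shift identity applies at u and at
  -- (pu)⁻¹. The sign series it produces at pu and 1/u sum to -R(pu) and R(u), which accounts for
  -- the change of the rational term.
  have hper : ∀ u, 1 < ‖u‖ → ‖u‖ < ‖p‖⁻¹ → D (p * u) = D u := by
    intro u h1 h2
    have hu : u ∈ annulus ‖p‖ := ⟨hp.trans h1, h2⟩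
    have hu0 := ne_zero_of_mem_annulus hpos.le hu
    have hpu : ‖p * u‖ < 1 := by rw [norm_mul]; exact mul_norm_lt_one hpos hu
    have hui : ‖u⁻¹‖ < 1 := by rw [norm_inv]; exact inv_lt_one_of_one_lt₀ h1
    have n1 := hnp u h1.ne'
    have n2 := hnp (p * u) hpu.ne
    rw [hDeq _ n1, hDeq _ n2]
    have s1 := lambertSeries_shift hp (mul_norm_lt_one hpos hu)
    have s2 := lambertSeries_shift hp (u := (p * u)⁻¹) (by
      rw [mul_inv, norm_mul, norm_inv, ← mul_assoc, mul_inv_cancel₀ hpos.ne', one_mul]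
      exact hui)
    rw [show p * (p * u)⁻¹ = u⁻¹ by field_simp] at s2
    have t1 := signSeries_eq hpu
    have t2 := signSeries_eq hui
    have t1' : signSeries (p * u) = -(p * u * (1 - (p * u) ^ 4) / (1 + (p * u) ^ 6)) := by
      rw [← neg_div, eq_div_iff n2, t1]
    have t2' : signSeries u⁻¹ = u * (1 - u ^ 4) / (1 + u ^ 6) := by
      rw [eq_div_iff n1]
      field_simp at t2
      rw [one_div] at t2
      linear_combination t2
    have q := thetaQuot_shift hp0 hp (pow_ne_zero 2 hu0)
    rw [← mul_pow] at q
    rw [← t2', ← neg_eq_iff_eq_neg.mpr t1']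
    linear_combination u * q + C1 p * s1 + C1 p * s2
  have hneg : -u ∈ annulus ‖p‖ := by simpa [annulus] using hu
  -- Constancy at the two points u and -u, together with oddness, forces D u = 0.
  have hodd : D (-u) = -D u := by
    simp only [hDdef, inv_neg, lambertSeries_neg, neg_sq]; ring
  have hz := eq_of_mul_periodic hp0 hp hDd hper hneg hu
  rw [hodd] at hz
  have hz0 : D u = 0 := by linear_combination -hz / 2
  rw [hDeq u hpole] at hz0
  linear_combination hz0

set_option linter.unusedSectionVars false

/-! ### Pfaffian sums: congruence and rank two perturbation. -/

section Pfaffian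

variable {R : Type*} [CommRing R] {κ ι κ' ι' θ : Type*} [Fintype κ] [DecidableEq κ]
  [Fintype ι] [DecidableEq ι] [Fintype κ'] [DecidableEq κ'] [Fintype ι'] [DecidableEq ι']
  [Fintype θ] [DecidableEq θ]

/-- The polarized form of the sum defining the pfaffian. The indices are arranged into pairs
by an equivalence `e`. -/
def pfForm (e : κ × Bool ≃ ι) (A : κ → Matrix ι ι R) : R :=
  ∑ σ : Equiv.Perm ι, ((Equiv.Perm.sign σ : ℤ) : R) *
    ∏ j, A j (σ (e (j, false))) (σ (e (j, true)))

/-- The unnormalized pfaffian, with the indices arranged into pairs by an equivalence `e`. -/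
def pfSum (e : κ × Bool ≃ ι) (A : Matrix ι ι R) : R := pfForm e fun _ => A

/-- The same permutation acts on both copies of κ, so its sign is squared. Reordering the pairs is
therefore free. -/
lemma sign_prodCongr_bool (g : Equiv.Perm κ) :
    Equiv.Perm.sign (g.prodCongr (Equiv.refl Bool)) = 1 := by
  have : g.prodCongr (Equiv.refl Bool) = Equiv.prodCongrLeft fun _ : Bool => g := by
    ext ⟨a, b⟩ <;> rfl
  rw [this, Equiv.Perm.sign_prodCongrLeft]
  simp

lemma pfForm_comp_mul (e : κ × Bool ≃ ι) (A : κ → Matrix ι ι R) (P : Equiv.Perm ι) :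
    ∑ σ : Equiv.Perm ι, ((Equiv.Perm.sign σ : ℤ) : R) *
      ∏ j, A j (σ (P (e (j, false)))) (σ (P (e (j, true)))) =
    ((Equiv.Perm.sign P : ℤ) : R) * pfForm e A := by
  conv_rhs => rw [pfForm, ← Equiv.sum_comp (Equiv.mulRight P), Finset.mul_sum]
  refine Finset.sum_congr rfl fun σ _ => ?_
  simp only [Equiv.coe_mulRight, Equiv.Perm.sign_mul, Equiv.Perm.mul_apply, ← mul_assoc]
  congr 1
  rcases Int.units_eq_one_or (Equiv.Perm.sign P) with h | h <;> simp [h]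

lemma pfForm_comp_perm (e : κ × Bool ≃ ι) (A : κ → Matrix ι ι R) (g : Equiv.Perm κ) :
    pfForm e (A ∘ g) = pfForm e A := by
  have h := pfForm_comp_mul e A (e.permCongr ((g⁻¹).prodCongr (Equiv.refl Bool)))
  rw [Equiv.Perm.sign_permCongr, sign_prodCongr_bool, Units.val_one, Int.cast_one, one_mul] at h
  rw [← h, pfForm]
  refine Finset.sum_congr rfl fun σ _ => ?_
  congr 1
  rw [← Equiv.prod_comp g fun j => A j (σ (e.permCongr ((g⁻¹).prodCongr (Equiv.refl Bool))
    (e (j, false)))) (σ (e.permCongr ((g⁻¹).prodCongr (Equiv.refl Bool)) (e (j, true))))]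
  simp [Equiv.permCongr_apply]

/-- Transposing one factor exchanges the two members of one pair, a transposition of the indices.
The matrices need not be skew-symmetric. -/
lemma pfForm_update_transpose (e : κ × Bool ≃ ι) (A : κ → Matrix ι ι R) (j : κ) :
    pfForm e (Function.update A j (A j).transpose) = -pfForm e A := by
  have h := pfForm_comp_mul e A (Equiv.swap (e (j, false)) (e (j, true)))
  rw [Equiv.Perm.sign_swap (by simp)] at h
  simp only [Units.val_neg, Units.val_one, Int.cast_neg, Int.cast_one, neg_mul, one_mul] at h
  rw [← h, pfForm]
  refine Finset.sum_congr rfl fun σ _ => ?_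
  congr 1
  refine Finset.prod_congr rfl fun i _ => ?_
  by_cases hij : i = j
  · subst hij; simp
  · have hji := hij
    rw [Equiv.swap_apply_of_ne_of_ne (by simp [hij]) (by simp [hij]),
      Equiv.swap_apply_of_ne_of_ne (by simp [hij]) (by simp [hij]), Function.update_of_ne hij]

lemma pfForm_update_add (e : κ × Bool ≃ ι) (A : κ → Matrix ι ι R) (j : κ) (X Y : Matrix ι ι R) :
    pfForm e (Function.update A j (X + Y)) =
      pfForm e (Function.update A j X) + pfForm e (Function.update A j Y) := by
  simp only [pfForm, ← Finset.sum_add_distrib, ← mul_add]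
  refine Finset.sum_congr rfl fun σ _ => ?_
  congr 1
  simp only [Finset.prod_eq_mul_prod_sdiff_singleton_of_mem (Finset.mem_univ j),
    Function.update_self, Matrix.add_apply, add_mul]
  have : ∀ Z : Matrix ι ι R, ∏ x ∈ Finset.univ \ {j},
      Function.update A j Z x (σ (e (x, false))) (σ (e (x, true))) =
      ∏ x ∈ Finset.univ \ {j}, A x (σ (e (x, false))) (σ (e (x, true))) := fun Z =>
    Finset.prod_congr rfl fun x hx => by
      rw [Function.update_of_ne (by simpa using hx)]
  simp only [this]

lemma pfSum_submatrix (e : κ × Bool ≃ ι) (f : ι ≃ ι') (A : Matrix ι' ι' R) :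
    pfSum e (A.submatrix f f) = pfSum (e.trans f) A := by
  rw [pfSum, pfForm, pfSum, pfForm, ← Equiv.sum_comp f.permCongr]
  refine Finset.sum_congr rfl fun σ _ => ?_
  simp [Equiv.permCongr_apply]

lemma pfSum_comp_left (e : κ × Bool ≃ ι) (g : κ' ≃ κ) (A : Matrix ι ι R) :
    pfSum ((g.prodCongr (Equiv.refl Bool)).trans e) A = pfSum e A := by
  rw [pfSum, pfForm, pfSum, pfForm]
  refine Finset.sum_congr rfl fun σ _ => ?_
  congr 1
  exact Equiv.prod_comp g fun j => A (σ (e (j, false))) (σ (e (j, true)))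

lemma pfSum_change (e e' : κ × Bool ≃ ι) (A : Matrix ι ι R) :
    pfSum e' A = ((Equiv.Perm.sign (e.symm.trans e') : ℤ) : R) * pfSum e A := by
  rw [pfSum, pfSum, ← pfForm_comp_mul, pfForm]
  simp

lemma pfSum_submatrix_perm (e : κ × Bool ≃ ι) (P : Equiv.Perm ι) (A : Matrix ι ι R) :
    pfSum e (A.submatrix P P) = ((Equiv.Perm.sign P : ℤ) : R) * pfSum e A := by
  rw [pfSum_submatrix, pfSum_change e]
  congr 3
  rw [← Equiv.Perm.sign_permCongr e.symm P, ← Equiv.Perm.sign_permCongr e.symm]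
  congr 1
  ext x <;> simp [Equiv.permCongr_apply]

/-- Expanding every entry of Q A Qᵀ as a double sum lets f record the inner indices. The signed sum
over σ is then the determinant of the columns of Q selected by f. -/
lemma pfSum_congruence_expand (e : κ × Bool ≃ ι) (Q A : Matrix ι ι R) :
    pfSum e (Q * A * Q.transpose) = ∑ f : κ × Bool → ι,
      (∏ j, A (f (j, false)) (f (j, true))) * (Q.submatrix id (f ∘ e.symm)).det := by
  have h1 : ∀ σ : Equiv.Perm ι, ∏ j, (Q * A * Q.transpose) (σ (e (j, false))) (σ (e (j, true))) =
      ∑ f : κ × Bool → ι, (∏ j, A (f (j, false)) (f (j, true))) *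
        ∏ i, Q (σ i) (f (e.symm i)) := by
    intro σ
    have h2 : ∀ x y, (Q * A * Q.transpose) x y =
        ∑ c : Bool → ι, Q x (c false) * A (c false) (c true) * Q y (c true) := by
      intro x y
      rw [← Equiv.sum_comp (Equiv.boolArrowEquivProd ι).symm, Fintype.sum_prod_type_right]
      simp [Matrix.mul_apply, Finset.sum_mul, Equiv.boolArrowEquivProd]
    simp only [h2]
    rw [Fintype.prod_sum, ← Equiv.sum_comp (Equiv.curry κ Bool ι)]
    refine Finset.sum_congr rfl fun f _ => ?_
    rw [← Equiv.prod_comp e, Fintype.prod_prod_type, ← Finset.prod_mul_distrib]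
    refine Finset.prod_congr rfl fun j _ => ?_
    simp only [Fintype.prod_bool, Equiv.symm_apply_apply, Equiv.curry_apply, Function.curry]
    ring
  simp only [pfSum, pfForm, h1, Finset.mul_sum]
  rw [Finset.sum_comm]
  refine Finset.sum_congr rfl fun f _ => ?_
  rw [Matrix.det_apply', Finset.mul_sum]
  refine Finset.sum_congr rfl fun σ _ => ?_
  simp only [Matrix.submatrix_apply, id, Function.comp]
  ring

/-- The selected columns are Q times those of the identity, so det Q comes out of each term, and the
case Q = 1 of the expansion recognises what remains. Neither division nor skew-symmetry is used. -/
lemma pfSum_congruence (e : κ × Bool ≃ ι) (Q A : Matrix ι ι R) :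
    pfSum e (Q * A * Q.transpose) = Q.det * pfSum e A := by
  have h := pfSum_congruence_expand e 1 A
  rw [Matrix.transpose_one, Matrix.one_mul, Matrix.mul_one] at h
  rw [h, pfSum_congruence_expand, Finset.mul_sum]
  refine Finset.sum_congr rfl fun f _ => ?_
  have : Q.submatrix id (f ∘ e.symm) = Q * (1 : Matrix ι ι R).submatrix id (f ∘ e.symm) := by
    ext i j
    simp [Matrix.mul_apply, Matrix.one_apply]
  rw [this, Matrix.det_mul]
  ring

/-- The arrangement into pairs when a set of pairs is adjoined. -/
def pairsSum (e : κ × Bool ≃ ι) (θ : Type*) : (κ ⊕ θ) × Bool ≃ ι ⊕ θ × Bool :=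
  (Equiv.sumProdDistrib κ θ Bool).trans (e.sumCongr (Equiv.refl _))

@[simp] lemma pairsSum_inl (e : κ × Bool ≃ ι) (θ : Type*) (j : κ) (b : Bool) :
    pairsSum e θ (Sum.inl j, b) = Sum.inl (e (j, b)) := rfl

@[simp] lemma pairsSum_inr (e : κ × Bool ≃ ι) (θ : Type*) (j : θ) (b : Bool) :
    pairsSum e θ (Sum.inr j, b) = Sum.inr (j, b) := rfl

/-- The matrix with a single unit entry, at the position given by an adjoined pair. -/
def cornerMatrix (R : Type*) [CommRing R] (ι : Type*) [DecidableEq ι] :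
    Matrix (ι ⊕ Unit × Bool) (ι ⊕ Unit × Bool) R :=
  Matrix.single (Sum.inr ((), false)) (Sum.inr ((), true)) 1

/-- Only permutations fixing both adjoined indices meet the single unit entry, and these are the
permutations of ι. -/
lemma pfForm_corner (e : κ × Bool ≃ ι) (N : Matrix (ι ⊕ Unit × Bool) (ι ⊕ Unit × Bool) R) :
    pfForm (pairsSum e Unit) (Sum.elim (fun _ => N) fun _ => cornerMatrix R ι) =
      pfSum e (N.submatrix Sum.inl Sum.inl) := by
  rw [pfSum, pfForm, pfForm]
  symm
  refine Finset.sum_of_injOn (fun σ => Equiv.Perm.sumCongr σ 1) ?_ (by simp) ?_ ?_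
  · intro σ _ τ _ h
    ext x
    simpa using congrArg (fun f => f (Sum.inl x)) h
  · intro σ _ hσ
    rw [Fintype.prod_sum_type]
    simp only [Sum.elim_inr, Finset.univ_unique, Finset.prod_singleton, pairsSum_inr]
    by_cases h : σ (Sum.inr ((), false)) = Sum.inr ((), false) ∧
        σ (Sum.inr ((), true)) = Sum.inr ((), true)
    · exfalso
      apply hσ
      have hinr : Set.MapsTo σ (Set.range (Sum.inr : Unit × Bool → ι ⊕ Unit × Bool))
          (Set.range Sum.inr) := by
        rintro _ ⟨⟨⟨⟩, b⟩, rfl⟩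
        cases b
        · exact ⟨_, h.1.symm⟩
        · exact ⟨_, h.2.symm⟩
      rw [← Equiv.Perm.perm_mapsTo_inl_iff_mapsTo_inr] at hinr
      obtain ⟨⟨a, b⟩, rfl⟩ := Equiv.Perm.mem_sumCongrHom_range_of_perm_mapsTo_inl hinr
      refine ⟨a, by simp, ?_⟩
      have hb : b = 1 := by
        ext1 ⟨⟨⟩, c⟩
        cases c
        · simpa using h.1
        · simpa using h.2
      rw [hb]; rfl
    · rw [cornerMatrix, Matrix.single_apply_of_ne]
      · simp
      · rintro ⟨h1, h2⟩; exact h ⟨h1.symm, h2.symm⟩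
  · intro σ _
    simp [Fintype.prod_sum_type, cornerMatrix]

lemma prod_add_of_mul_eq_zero (f g : κ → R) (h : ∀ i j, g i ≠ 0 → g j ≠ 0 → i = j) :
    ∏ i, (f i + g i) = ∏ i, f i + ∑ j, ∏ i, if i = j then g i else f i := by
  by_cases h0 : ∀ i, g i = 0
  · rw [Finset.sum_eq_zero fun j _ => Finset.prod_eq_zero (Finset.mem_univ j) (by simp [h0])]
    simp [h0]
  · push Not at h0
    obtain ⟨j, hj⟩ := h0
    have hg : ∀ i, i ≠ j → g i = 0 := fun i hi => by
      by_contra hgi; exact hi (h i j hgi hj)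
    rw [Finset.sum_eq_single j
      (fun i _ hi => Finset.prod_eq_zero (Finset.mem_univ i) (by simp [hg i hi])) (by simp)]
    simp only [Finset.prod_eq_mul_prod_sdiff_singleton_of_mem (Finset.mem_univ j), if_true, add_mul]
    congr 2 <;> refine Finset.prod_congr rfl fun i hi => ?_
    · rw [hg i (by simpa using hi), add_zero]
    · rw [hg i (by simpa using hi), add_zero, if_neg (by simpa using hi)]

lemma pfForm_update_neg (e : κ × Bool ≃ ι) (A : κ → Matrix ι ι R) (j : κ) (X : Matrix ι ι R) :
    pfForm e (Function.update A j (-X)) = -pfForm e (Function.update A j X) := by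
  have h0 := pfForm_update_add e A j 0 0
  have h1 := pfForm_update_add e A j X (-X)
  rw [add_zero, left_eq_add] at h0
  rw [add_neg_cancel, h0] at h1
  linear_combination -h1

/-- The entry ±1 can be used by at most one pair. That pair may be any of `card κ + 1`, in either
orientation, which explains the factor. -/
lemma pfSum_add_corner (e : κ × Bool ≃ ι) (N : Matrix (ι ⊕ Unit × Bool) (ι ⊕ Unit × Bool) R) :
    pfSum (pairsSum e Unit) (N + (cornerMatrix R ι - (cornerMatrix R ι).transpose)) =
      pfSum (pairsSum e Unit) N +
        2 * (Fintype.card κ + 1) * pfSum e (N.submatrix Sum.inl Sum.inl) := by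
  set E := cornerMatrix R ι with hE
  set e' := pairsSum e Unit
  have hmem : ∀ x y, (E - E.transpose) x y ≠ 0 →
      x = Sum.inr ((), false) ∨ y = Sum.inr ((), false) := by
    intro x y h
    by_contra! hxy
    apply h
    rw [Matrix.sub_apply, Matrix.transpose_apply, hE, cornerMatrix,
      Matrix.single_apply_of_ne _ _ _ _ _ (fun h => hxy.1 h.1.symm),
      Matrix.single_apply_of_ne _ _ _ _ _ (fun h => hxy.2 h.1.symm), sub_zero]
  have hterm : ∀ j, pfForm e' (Function.update (fun _ => N) j (E - E.transpose)) =
      2 * pfSum e (N.submatrix Sum.inl Sum.inl) := by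
    intro j
    have h1 : Function.update (fun _ => N) j (E - E.transpose) =
        Function.update (fun _ => N) (Sum.inr ()) (E - E.transpose) ∘
          Equiv.swap j (Sum.inr ()) := by
      ext1 i
      by_cases hij : i = j
      · subst hij; simp
      · rw [Function.update_of_ne hij, Function.comp, Function.update_of_ne]
        rw [Ne, Equiv.swap_apply_eq_iff, Equiv.swap_apply_right]
        exact hij
    have h2 : Function.update (fun _ => N) (Sum.inr ()) E =
        Sum.elim (fun _ : κ => N) fun _ => E := by
      ext1 i
      rcases i with i | ⟨⟩
      · rw [Function.update_of_ne (by simp)]; rfl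
      · simp
    have h3 := pfForm_update_transpose e' (Function.update (fun _ => N) (Sum.inr ()) (-E))
      (Sum.inr ())
    rw [Function.update_self, Function.update_idem, Matrix.transpose_neg,
      pfForm_update_neg _ _ _ E] at h3
    rw [h1, pfForm_comp_perm, sub_eq_add_neg, pfForm_update_add, h3, h2, pfForm_corner]
    ring
  have hsum : pfSum e' (N + (E - E.transpose)) = pfSum e' N +
      ∑ j, pfForm e' (Function.update (fun _ => N) j (E - E.transpose)) := by
    simp only [pfSum, pfForm]
    rw [Finset.sum_comm, ← Finset.sum_add_distrib]
    refine Finset.sum_congr rfl fun σ _ => ?_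
    rw [← Finset.mul_sum, ← mul_add]
    congr 1
    simp only [Matrix.add_apply N]
    rw [prod_add_of_mul_eq_zero]
    · congr 1
      refine Finset.sum_congr rfl fun j _ => Finset.prod_congr rfl fun i _ => ?_
      by_cases hij : i = j
      · subst hij; simp
      · rw [if_neg hij, Function.update_of_ne hij]
    · intro i j hi hj
      -- A nonzero entry involves the index `Sum.inr ((), false)`, and σ places it in one pair only.
      have key : ∀ i, (E - E.transpose) (σ (e' (i, false))) (σ (e' (i, true))) ≠ 0 →
          ∃ b, (i, b) = e'.symm (σ.symm (Sum.inr ((), false))) := by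
        intro i hi
        rcases hmem _ _ hi with h | h
        · exact ⟨false, by rw [← h]; simp⟩
        · exact ⟨true, by rw [← h]; simp⟩
      obtain ⟨b, hb⟩ := key i hi
      obtain ⟨c, hc⟩ := key j hj
      exact congrArg Prod.fst (hb.trans hc.symm)
  rw [hsum, Finset.sum_congr rfl fun j _ => hterm j, Finset.sum_const, Finset.card_univ,
    Fintype.card_sum, Fintype.card_unit, nsmul_eq_mul]
  push_cast
  ring

/-- The bordered matrix `[[M, B], [-Bᵀ, 0]]`, where `B` has columns indexed by pairs. -/
def bordered (M : Matrix ι ι R) (c : θ × Bool → ι → R) :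
    Matrix (ι ⊕ θ × Bool) (ι ⊕ θ × Bool) R :=
  Matrix.fromBlocks M (Matrix.of fun i x => c x i) (-(Matrix.of fun i x => c x i).transpose) 0

/-- The skew-symmetric rank two matrix `a bᵀ - b aᵀ`. -/
def wedge (a b : ι → R) : Matrix ι ι R := Matrix.of fun i j => a i * b j - b i * a j

/-- Replace the zero corner of the bordered matrix by the 2×2 symplectic block J and compute the
pfaffian twice: expanding in the corner, and after the unipotent congruence that clears B and leaves
the Schur complement M - B J Bᵀ. -/
lemma pfSum_sub_wedge (e : κ × Bool ≃ ι) (M : Matrix ι ι R) (c : Unit × Bool → ι → R) :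
    2 * (Fintype.card κ + 1) * pfSum e (M - wedge (c ((), false)) (c ((), true))) =
      2 * (Fintype.card κ + 1) * pfSum e M + pfSum (pairsSum e Unit) (bordered M c) := by
  set B : Matrix ι (Unit × Bool) R := Matrix.of fun i x => c x i with hB
  set J : Matrix (Unit × Bool) (Unit × Bool) R :=
    Matrix.single ((), false) ((), true) 1 - Matrix.single ((), true) ((), false) 1 with hJ
  have hJE : ∀ (M : Matrix ι ι R) (B : Matrix ι (Unit × Bool) R) (C : Matrix (Unit × Bool) ι R),
      Matrix.fromBlocks M B C J =
      Matrix.fromBlocks M B C 0 + (cornerMatrix R ι - (cornerMatrix R ι).transpose) := by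
    intro M B C
    ext (x | x) (y | y) <;> simp [cornerMatrix, hJ, Matrix.single_apply]
  have hJ2 : J * J = -1 := by
    ext ⟨⟨⟩, b⟩ ⟨⟨⟩, c⟩
    cases b <;> cases c <;>
      simp [hJ, Matrix.mul_apply, Matrix.single_apply]
  have hJt : J.transpose = -J := by
    simp [hJ]
  have hcong : Matrix.fromBlocks 1 (B * J) 0 1 * Matrix.fromBlocks M B (-B.transpose) J *
      (Matrix.fromBlocks 1 (B * J) 0 1).transpose =
      Matrix.fromBlocks (M - B * J * B.transpose) 0 0 J := by
    rw [Matrix.fromBlocks_transpose, Matrix.fromBlocks_multiply, Matrix.fromBlocks_multiply]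
    simp only [Matrix.transpose_one, Matrix.transpose_zero, Matrix.transpose_mul, hJt,
      Matrix.one_mul, Matrix.mul_one, Matrix.zero_mul, Matrix.mul_zero, zero_add, add_zero,
      Matrix.mul_assoc, hJ2, Matrix.mul_neg, Matrix.neg_mul, add_neg_cancel, sub_eq_add_neg]
    rw [← Matrix.mul_assoc J J, hJ2]
    simp
  -- This matrix is unchanged by congruence with the projection diag(1, 0), whose determinant is 0.
  have hzero : pfSum (pairsSum e Unit) (Matrix.fromBlocks (M - B * J * B.transpose) 0 0
      (0 : Matrix (Unit × Bool) (Unit × Bool) R)) = 0 := by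
    have h := pfSum_congruence (pairsSum e Unit) (Matrix.fromBlocks 1 0 0 0)
      (Matrix.fromBlocks (M - B * J * B.transpose) 0 0 (0 : Matrix (Unit × Bool) (Unit × Bool) R))
    rw [Matrix.fromBlocks_transpose, Matrix.fromBlocks_multiply, Matrix.fromBlocks_multiply,
      Matrix.det_fromBlocks_zero₂₁, Matrix.det_zero] at h
    simpa using h
  have hw : B * J * B.transpose = wedge (c ((), false)) (c ((), true)) := by
    ext i j
    simp [hB, hJ, wedge, Matrix.mul_apply, Matrix.single_apply, Fintype.sum_prod_type]
    ring
  have h1 := pfSum_congruence (pairsSum e Unit) (Matrix.fromBlocks 1 (B * J) 0 1)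
    (Matrix.fromBlocks M B (-B.transpose) J)
  rw [hcong, hJE, hJE, pfSum_add_corner, pfSum_add_corner, hzero, Matrix.det_fromBlocks_zero₂₁,
    Matrix.det_one, Matrix.det_one, one_mul, one_mul, zero_add, hw] at h1
  rw [add_comm (2 * _ * pfSum e M)]
  exact h1

end Pfaffian

/-! ### Normalized pfaffians and their expansion in bordered pfaffians. -/

section Expansion

variable {K : Type*} [Field K] [CharZero K] {κ ι θ θ' : Type*} [Fintype κ] [DecidableEq κ]
  [Fintype ι] [DecidableEq ι] [Fintype θ] [DecidableEq θ] [Fintype θ'] [DecidableEq θ']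

/-- The pfaffian, with the indices arranged into pairs by an equivalence `e`. -/
def pfNorm (e : κ × Bool ≃ ι) (A : Matrix ι ι K) : K :=
  1 / ((2 : K) ^ Fintype.card κ * ((Fintype.card κ).factorial : K)) * pfSum e A

/-- The pfaffian of a bordered matrix. -/
def pfBordered (e : κ × Bool ≃ ι) (M : Matrix ι ι K) (c : θ × Bool → ι → K) : K :=
  pfNorm (pairsSum e θ) (bordered M c)

/-- The factor 2(`card κ` + 1) is exactly the ratio of the two normalizing constants. -/
lemma pfNorm_sub_wedge (e : κ × Bool ≃ ι) (M : Matrix ι ι K) (c : Unit × Bool → ι → K) :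
    pfNorm e (M - wedge (c ((), false)) (c ((), true))) = pfNorm e M + pfBordered e M c := by
  have h := pfSum_sub_wedge e M c
  have h1 : (Fintype.card κ + 1 : K) ≠ 0 := by
    exact_mod_cast Nat.succ_ne_zero (Fintype.card κ)
  have h2 : ((Fintype.card κ).factorial : K) ≠ 0 := by exact_mod_cast Nat.factorial_ne_zero _
  rw [pfBordered, pfNorm, pfNorm, pfNorm, Fintype.card_sum, Fintype.card_unit,
    Nat.factorial_succ, pow_succ]
  push_cast
  field_simp
  linear_combination h

lemma pfNorm_relabel {κ' ι' : Type*} [Fintype κ'] [DecidableEq κ'] [Fintype ι'] [DecidableEq ι']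
    (e : κ × Bool ≃ ι) (e' : κ' × Bool ≃ ι') (g : κ ≃ κ') (f : ι ≃ ι')
    (h : ∀ j b, f (e (j, b)) = e' (g j, b)) (A : Matrix ι' ι' K) :
    pfNorm e (A.submatrix f f) = pfNorm e' A := by
  rw [pfNorm, pfNorm, pfSum_submatrix, Fintype.card_congr g, ← pfSum_comp_left e' g]
  congr 2
  ext ⟨j, b⟩
  simp [h]

lemma pfBordered_relabel (e : κ × Bool ≃ ι) (M : Matrix ι ι K) (g : θ ≃ θ')
    (c : θ' × Bool → ι → K) :
    pfBordered e M (fun x : θ × Bool => c (g x.1, x.2)) = pfBordered e M c := by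
  rw [pfBordered, pfBordered, ← pfNorm_relabel (pairsSum e θ) (pairsSum e θ')
    ((Equiv.refl κ).sumCongr g) ((Equiv.refl ι).sumCongr (g.prodCongr (Equiv.refl Bool)))]
  · congr 1
    ext (x | ⟨x, b⟩) (y | ⟨y, b'⟩) <;> simp [bordered]
  · rintro (j | j) b <;> simp

/-- The inductive step: the rank two formula applied to a matrix that is already bordered, with the
two vectors extended by zero along the border. -/
lemma pfBordered_sub_wedge (e : κ × Bool ≃ ι) (M : Matrix ι ι K)
    (c : (θ ⊕ Unit) × Bool → ι → K) :
    pfBordered e (M - wedge (c (Sum.inr (), false)) (c (Sum.inr (), true)))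
      (fun x : θ × Bool => c (Sum.inl x.1, x.2)) =
    pfBordered e M (fun x : θ × Bool => c (Sum.inl x.1, x.2)) + pfBordered e M c := by
  have h := pfNorm_sub_wedge (pairsSum e θ) (bordered M fun x : θ × Bool => c (Sum.inl x.1, x.2))
    (fun x => Sum.elim (c (Sum.inr x.1, x.2)) 0)
  have h1 : bordered (M - wedge (c (Sum.inr (), false)) (c (Sum.inr (), true)))
      (fun x : θ × Bool => c (Sum.inl x.1, x.2)) =
      bordered M (fun x : θ × Bool => c (Sum.inl x.1, x.2)) -
      wedge (Sum.elim (c (Sum.inr (), false)) 0) (Sum.elim (c (Sum.inr (), true)) 0) := by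
    ext (x | x) (y | y) <;> simp [bordered, wedge]
  rw [pfBordered, h1, h]
  congr 1
  rw [pfBordered, pfBordered, ← pfNorm_relabel (pairsSum (pairsSum e θ) Unit)
    (pairsSum e (θ ⊕ Unit)) (Equiv.sumAssoc κ θ Unit)
    ((Equiv.sumAssoc ι (θ × Bool) (Unit × Bool)).trans
      ((Equiv.refl ι).sumCongr (Equiv.sumProdDistrib θ Unit Bool).symm))]
  · congr 1
    ext ((x | x) | x) ((y | y) | y) <;> simp [bordered]
  · rintro ((j | j) | j) b <;> simp

lemma pfBordered_of_isEmpty [IsEmpty θ] (e : κ × Bool ≃ ι) (M : Matrix ι ι K)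
    (c : θ × Bool → ι → K) : pfBordered e M c = pfNorm e M := by
  rw [pfBordered, ← pfNorm_relabel e (pairsSum e θ) (Equiv.sumEmpty κ θ).symm
    (Equiv.sumEmpty ι (θ × Bool)).symm]
  · congr 1
  · intro j b; simp

/-- The border columns belonging to a finite set of indices. -/
def borderCols (a b : ℕ → ι → K) (S : Finset ℕ) : S × Bool → ι → K :=
  fun x => cond x.2 (b x.1) (a x.1)

/-- The expansion of the pfaffian of a sum of a matrix and rank two matrices. -/
theorem pfNorm_sub_sum_wedge (e : κ × Bool ≃ ι) (a b : ℕ → ι → K) (T : Finset ℕ)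
    (M : Matrix ι ι K) :
    pfNorm e (M - ∑ k ∈ T, wedge (a k) (b k)) =
      ∑ S ∈ T.powerset, pfBordered e M (borderCols a b S) := by
  induction T using Finset.induction_on generalizing M with
  | empty => simp [pfBordered_of_isEmpty]
  | insert k T hk ih =>
    rw [Finset.sum_insert hk, ← sub_sub, ih, Finset.sum_powerset_insert hk,
      ← Finset.sum_add_distrib]
    refine Finset.sum_congr rfl fun S hS => ?_
    have hkS : k ∉ S := fun h => hk (Finset.mem_powerset.mp hS h)
    set g : S ⊕ Unit ≃ ↥(insert k S) :=
      (Equiv.optionEquivSumPUnit _).symm.trans (Finset.subtypeInsertEquivOption hkS).symm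
    have hgl : ∀ x : S, ((g (Sum.inl x) : ↥(insert k S)) : ℕ) = x := fun x => rfl
    have hgr : ((g (Sum.inr ()) : ↥(insert k S)) : ℕ) = k := rfl
    rw [← pfBordered_relabel e M g]
    have := pfBordered_sub_wedge e M
      (fun x : (S ⊕ Unit) × Bool => borderCols a b (insert k S) (g x.1, x.2))
    simp only [borderCols, hgl, hgr, cond_false, cond_true] at this
    exact this

/-- The 2|θ| border indices are distributed over |κ| + |θ| < 2|θ| pairs, so two of them share a pair
and meet the zero block. -/
lemma pfBordered_eq_zero (e : κ × Bool ≃ ι) (M : Matrix ι ι K) (c : θ × Bool → ι → K)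
    (h : Fintype.card κ < Fintype.card θ) : pfBordered e M c = 0 := by
  rw [pfBordered, pfNorm, pfSum, pfForm, Finset.sum_eq_zero, mul_zero]
  intro σ _
  obtain ⟨x, y, hxy, hj⟩ := Fintype.exists_ne_map_eq_of_card_lt
    (fun x : θ × Bool => ((pairsSum e θ).symm (σ.symm (Sum.inr x))).1) (by
      rw [Fintype.card_sum, Fintype.card_prod, Fintype.card_bool]; omega)
  set j := ((pairsSum e θ).symm (σ.symm (Sum.inr x))).1 with hjdef
  have key : ∀ z b, (pairsSum e θ).symm (σ.symm (Sum.inr z)) = (j, b) →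
      σ (pairsSum e θ (j, b)) = Sum.inr z := by
    intro z b hz; rw [← hz]; simp
  have hx := key x ((pairsSum e θ).symm (σ.symm (Sum.inr x))).2 rfl
  have hy := key y ((pairsSum e θ).symm (σ.symm (Sum.inr y))).2 (Prod.ext hj.symm rfl)
  have hb : ((pairsSum e θ).symm (σ.symm (Sum.inr x))).2 ≠
      ((pairsSum e θ).symm (σ.symm (Sum.inr y))).2 := by
    intro hb
    rw [hb, hy] at hx
    exact hxy (Sum.inr_injective hx).symm
  have hall : ∀ b, ∃ z, σ (pairsSum e θ (j, b)) = Sum.inr z := by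
    intro b
    by_cases hbx : ((pairsSum e θ).symm (σ.symm (Sum.inr x))).2 = b
    · exact ⟨x, hbx ▸ hx⟩
    · refine ⟨y, ?_⟩
      have : ((pairsSum e θ).symm (σ.symm (Sum.inr y))).2 = b := by
        revert hb hbx
        generalize ((pairsSum e θ).symm (σ.symm (Sum.inr x))).2 = s
        generalize ((pairsSum e θ).symm (σ.symm (Sum.inr y))).2 = t
        cases s <;> cases t <;> cases b <;> simp
      exact this ▸ hy
  obtain ⟨z, hz⟩ := hall false
  obtain ⟨w, hw⟩ := hall true
  rw [Finset.prod_eq_zero (Finset.mem_univ j), mul_zero]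
  rw [hz, hw]
  simp [bordered]

lemma pfNorm_scale (e : κ × Bool ≃ ι) (d : ι → K) (A : Matrix ι ι K) :
    pfNorm e (Matrix.of fun i j => d i * A i j * d j) = (∏ i, d i) * pfNorm e A := by
  have h := pfSum_congruence e (Matrix.diagonal d) A
  have h1 : Matrix.diagonal d * A * (Matrix.diagonal d).transpose =
      Matrix.of fun i j => d i * A i j * d j := by
    ext i j; simp
  rw [h1, Matrix.det_diagonal] at h
  rw [pfNorm, pfNorm, h]; ring

lemma pfBordered_scale (e : κ × Bool ≃ ι) (M : Matrix ι ι K) (c : θ × Bool → ι → K)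
    (d : θ × Bool → K) :
    pfBordered e M (fun x i => d x * c x i) = (∏ x, d x) * pfBordered e M c := by
  have h := pfNorm_scale (pairsSum e θ) (Sum.elim (fun _ => 1) d) (bordered M c)
  rw [Fintype.prod_sum_type] at h
  simp only [Sum.elim_inl, Finset.prod_const_one, one_mul, Sum.elim_inr] at h
  rw [pfBordered, pfBordered, ← h]
  congr 1
  ext (x | x) (y | y) <;> simp [bordered, mul_comm]

end Expansion

/-! ### From the order of columns in `T` to consecutive pairs. -/

/-- The standard arrangement of an even number of indices into consecutive pairs. -/
def stdPairs (s : ℕ) (hs : Even s) : Fin (s / 2) × Bool ≃ Fin s where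
  toFun x := ⟨2 * x.1 + x.2.toNat, by
    have := Bool.toNat_le x.2; have := x.1.2; obtain ⟨r, rfl⟩ := hs; omega⟩
  invFun i := (⟨i / 2, by have := i.2; obtain ⟨r, rfl⟩ := hs; omega⟩, decide (i.1 % 2 = 1))
  left_inv := by
    rintro ⟨⟨j, hj⟩, b⟩
    cases b
    · simp
    · simp; omega
  right_inv := by
    rintro ⟨i, hi⟩
    ext
    rcases Nat.mod_two_eq_zero_or_one i with h | h <;> simp [h] <;> omega

lemma pfaffian_eq_pfNorm {K : Type*} [Field K] {s : ℕ} (hs : Even s)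
    (A : Matrix (Fin s) (Fin s) K) : pfaffian A = pfNorm (stdPairs s hs) A := by
  rw [pfaffian, pfNorm, Fintype.card_fin]
  rfl

/-- The arrangement `a_m, …, a_1, b_1, …, b_m` of `m` pairs. -/
def nestedEquiv (m : ℕ) : Fin m × Bool ≃ Fin (m + m) :=
  (Equiv.prodComm _ _).trans <| (Equiv.boolProdEquivSum (Fin m)).trans <|
    (Fin.revPerm.sumCongr (Equiv.refl _)).trans finSumFinEquiv

lemma nestedEquiv_false (m : ℕ) (i : Fin m) :
    nestedEquiv m (i, false) = Fin.castAdd m (Fin.rev i) := rfl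

lemma nestedEquiv_true (m : ℕ) (i : Fin m) :
    nestedEquiv m (i, true) = Fin.natAdd m i := rfl

lemma even_add_self_add {N : ℕ} (hN : Even N) (m : ℕ) : Even (N + (m + m)) :=
  hN.add ⟨m, rfl⟩

/-- The nested arrangement of border columns is an even permutation of the paired one. -/
lemma sign_nested {N m : ℕ} (hN : Even N) (g : Fin (N / 2) ⊕ Fin m ≃ Fin ((N + (m + m)) / 2))
    (hgl : ∀ j, (g (Sum.inl j) : ℕ) = j) (hgr : ∀ j, (g (Sum.inr j) : ℕ) = N / 2 + j) :
    Equiv.Perm.sign (((g.prodCongr (Equiv.refl Bool)).trans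
      (stdPairs _ (even_add_self_add hN m))).symm.trans
      ((pairsSum (stdPairs N hN) (Fin m)).trans
        (((Equiv.refl (Fin N)).sumCongr (nestedEquiv m)).trans finSumFinEquiv))) = 1 := by
  set e₁ := (g.prodCongr (Equiv.refl Bool)).trans (stdPairs _ (even_add_self_add hN m)) with he₁
  set e₂ := (pairsSum (stdPairs N hN) (Fin m)).trans
        (((Equiv.refl (Fin N)).sumCongr (nestedEquiv m)).trans finSumFinEquiv) with he₂
  have v1l : ∀ j b, (e₁ (Sum.inl j, b) : ℕ) = 2 * j + b.toNat := fun j b => by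
    simp [he₁, stdPairs, hgl]
  have v1r : ∀ j b, (e₁ (Sum.inr j, b) : ℕ) = 2 * (N / 2 + j) + b.toNat := fun j b => by
    simp [he₁, stdPairs, hgr]
  have v2l : ∀ j b, (e₂ (Sum.inl j, b) : ℕ) = 2 * j + b.toNat := fun j b => by
    simp [he₂, stdPairs]
  have v2f : ∀ j, (e₂ (Sum.inr j, false) : ℕ) = N + (m - (j + 1)) := fun j => by
    simp [he₂, nestedEquiv_false]
  have v2t : ∀ j, (e₂ (Sum.inr j, true) : ℕ) = N + (m + j) := fun j => by
    simp [he₂, nestedEquiv_true, add_comm]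
  have h1 : Equiv.Perm.sign (e₁.symm.trans e₂) = ∏ j, ∏ j', ∏ b, ∏ b',
      if e₁ (j, b) < e₁ (j', b') then (if e₂ (j, b) < e₂ (j', b') then 1 else -1) else 1 := by
    rw [Equiv.Perm.sign_eq_prod_prod_Ioi]
    have : ∀ x, ∏ y ∈ Finset.Ioi x,
        (if (e₁.symm.trans e₂) x < (e₁.symm.trans e₂) y then (1 : ℤˣ) else -1) =
        ∏ y, if x < y then
          (if (e₁.symm.trans e₂) x < (e₁.symm.trans e₂) y then 1 else -1) else 1 := by
      intro x
      rw [← Finset.prod_filter]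
      congr 1
      ext y; simp
    simp only [this]
    rw [← Equiv.prod_comp e₁, Fintype.prod_prod_type]
    refine Finset.prod_congr rfl fun j _ => ?_
    rw [Finset.prod_comm (s := (Finset.univ : Finset (Fin (N / 2) ⊕ Fin m)))]
    refine Finset.prod_congr rfl fun b _ => ?_
    rw [← Equiv.prod_comp e₁, Fintype.prod_prod_type]
    simp
  rw [h1]
  obtain ⟨r, rfl⟩ := hN
  -- Inversions are counted for two pairs at a time. Border pairs j < j' appear as a_j', a_j, b_j,
  -- b_j', where a_j' has moved past both a_j and b_j: two inversions. All other cases have none.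
  refine Finset.prod_eq_one fun j _ => Finset.prod_eq_one fun j' _ => ?_
  simp only [Fintype.prod_bool, Fin.lt_def]
  rcases j with j | j <;> rcases j' with j' | j' <;>
    simp only [v1l, v1r, v2l, v2f, v2t, Bool.toNat_true, Bool.toNat_false] <;>
    have hj := j.2 <;> have hj' := j'.2 <;>
    split_ifs <;> first | (exfalso; omega) | decide

/-- The pfaffian of a bordered matrix with nested border columns. -/
lemma pfaffian_reindex_bordered {K : Type*} [Field K] {N m : ℕ} (hN : Even N)
    (A : Matrix (Fin N) (Fin N) K) (B : Matrix (Fin N) (Fin (m + m)) K) :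
    pfaffian (Matrix.reindex finSumFinEquiv finSumFinEquiv
      (Matrix.fromBlocks A B (-B.transpose) 0)) =
    pfBordered (stdPairs N hN) A (fun x i => B i (nestedEquiv m x)) := by
  have hc : N / 2 + m = (N + (m + m)) / 2 := by obtain ⟨r, rfl⟩ := hN; omega
  set g : Fin (N / 2) ⊕ Fin m ≃ Fin ((N + (m + m)) / 2) := finSumFinEquiv.trans (finCongr hc)
  set F : Fin N ⊕ Fin m × Bool ≃ Fin (N + (m + m)) :=
    ((Equiv.refl (Fin N)).sumCongr (nestedEquiv m)).trans finSumFinEquiv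
  set X := Matrix.reindex finSumFinEquiv finSumFinEquiv
      (Matrix.fromBlocks A B (-B.transpose) 0) with hX
  have h1 : bordered A (fun x i => B i (nestedEquiv m x)) = X.submatrix F F := by
    ext (x | x) (y | y) <;> simp [bordered, hX, F]
  rw [pfaffian_eq_pfNorm (even_add_self_add hN m), pfBordered, h1, pfNorm, pfNorm,
    pfSum_submatrix,
    pfSum_change ((g.prodCongr (Equiv.refl Bool)).trans (stdPairs _ (even_add_self_add hN m))),
    sign_nested hN g (fun j => by simp [g]) (fun j => by simp [g]), pfSum_comp_left,
    Fintype.card_congr g]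
  simp

/-! ### Values of rational functions at a point. -/

/-- `f` is regular at `y` with value `c`. -/
def HasValue {N : ℕ} (y : Fin N → ℂ) (f : RatFun N) (c : ℂ) : Prop :=
  ∃ a b : MvPolynomial (Fin N) ℂ, f * algebraMap _ (RatFun N) b = algebraMap _ (RatFun N) a ∧
    MvPolynomial.eval y b ≠ 0 ∧ c * MvPolynomial.eval y b = MvPolynomial.eval y a

section HasValue

variable {N : ℕ} {y : Fin N → ℂ} {f g : RatFun N} {c d : ℂ}

/-- The reduced denominator divides every denominator of f, hence it does not vanish at y as soon as
one of them does not. -/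
lemma HasValue.ratEval_eq (h : HasValue y f c) : ratEval f y = c := by
  obtain ⟨a, b, hab, hb, hc⟩ := h
  have h1 : algebraMap _ (RatFun N) (IsFractionRing.num (MvPolynomial (Fin N) ℂ) f) =
      f * algebraMap _ (RatFun N) (IsFractionRing.den (MvPolynomial (Fin N) ℂ) f :
        MvPolynomial (Fin N) ℂ) := by
    exact (IsLocalization.eq_mk'_iff_mul_eq.mp
      (IsFractionRing.mk'_num_den (MvPolynomial (Fin N) ℂ) f).symm).symm
  have h2 : IsFractionRing.num (MvPolynomial (Fin N) ℂ) f * b =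
      (IsFractionRing.den (MvPolynomial (Fin N) ℂ) f : MvPolynomial (Fin N) ℂ) * a := by
    apply IsFractionRing.injective (MvPolynomial (Fin N) ℂ) (RatFun N)
    rw [map_mul, map_mul, ← hab, h1]; ring
  have h3 : (IsFractionRing.den (MvPolynomial (Fin N) ℂ) f : MvPolynomial (Fin N) ℂ) ∣ b :=
    (IsFractionRing.num_den_reduced (MvPolynomial (Fin N) ℂ) f).symm.dvd_of_dvd_mul_left
      (Dvd.intro _ h2.symm)
  have h4 : MvPolynomial.eval y
      (IsFractionRing.den (MvPolynomial (Fin N) ℂ) f : MvPolynomial (Fin N) ℂ) ≠ 0 := by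
    obtain ⟨e, he⟩ := h3
    rw [he, map_mul] at hb
    exact left_ne_zero_of_mul hb
  rw [ratEval, div_eq_iff h4]
  have h5 := congrArg (MvPolynomial.eval y) h2
  rw [map_mul, map_mul, ← hc] at h5
  apply mul_right_cancel₀ hb
  rw [h5]; ring

lemma HasValue.unique (h : HasValue y f c) (h' : HasValue y f d) : c = d := by
  rw [← h.ratEval_eq, h'.ratEval_eq]

lemma hasValue_algebraMap (a : MvPolynomial (Fin N) ℂ) :
    HasValue y (algebraMap _ (RatFun N) a) (MvPolynomial.eval y a) :=
  ⟨a, 1, by simp, by simp, by simp⟩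

lemma hasValue_ratX (i : Fin N) : HasValue y (ratX i) (y i) := by
  simpa [ratX] using hasValue_algebraMap (y := y) (MvPolynomial.X i)

lemma hasValue_intCast (k : ℤ) : HasValue y (k : RatFun N) k := by
  simpa using hasValue_algebraMap (y := y) (k : MvPolynomial (Fin N) ℂ)

lemma HasValue.mul (hf : HasValue y f c) (hg : HasValue y g d) : HasValue y (f * g) (c * d) := by
  obtain ⟨a, b, h1, h2, h3⟩ := hf
  obtain ⟨a', b', h1', h2', h3'⟩ := hg
  refine ⟨a * a', b * b', ?_, ?_, ?_⟩
  · rw [map_mul, map_mul, ← h1, ← h1']; ring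
  · rw [map_mul]; exact mul_ne_zero h2 h2'
  · rw [map_mul, map_mul, ← h3, ← h3']; ring

lemma HasValue.add (hf : HasValue y f c) (hg : HasValue y g d) : HasValue y (f + g) (c + d) := by
  obtain ⟨a, b, h1, h2, h3⟩ := hf
  obtain ⟨a', b', h1', h2', h3'⟩ := hg
  refine ⟨a * b' + a' * b, b * b', ?_, ?_, ?_⟩
  · rw [map_add, map_mul, map_mul, map_mul, ← h1, ← h1']; ring
  · rw [map_mul]; exact mul_ne_zero h2 h2'
  · rw [map_add, map_mul, map_mul, map_mul, ← h3, ← h3']; ring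

lemma HasValue.neg (hf : HasValue y f c) : HasValue y (-f) (-c) := by
  simpa using (hasValue_intCast (-1)).mul hf

lemma HasValue.sub (hf : HasValue y f c) (hg : HasValue y g d) : HasValue y (f - g) (c - d) := by
  simpa [sub_eq_add_neg] using hf.add hg.neg

lemma HasValue.inv (hf : HasValue y f c) (hc : c ≠ 0) : HasValue y f⁻¹ c⁻¹ := by
  obtain ⟨a, b, h1, h2, h3⟩ := hf
  have ha : MvPolynomial.eval y a ≠ 0 := by rw [← h3]; exact mul_ne_zero hc h2
  refine ⟨b, a, ?_, ha, ?_⟩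
  · have hf0 : f ≠ 0 := by
      rintro rfl
      rw [zero_mul, eq_comm, map_eq_zero_iff _ (IsFractionRing.injective _ _)] at h1
      simp [h1] at ha
    rw [← h1, inv_mul_cancel_left₀ hf0]
  · rw [← h3, inv_mul_cancel_left₀ hc]

lemma HasValue.div (hf : HasValue y f c) (hg : HasValue y g d) (hd : d ≠ 0) :
    HasValue y (f / g) (c / d) := by
  rw [div_eq_mul_inv, div_eq_mul_inv]; exact hf.mul (hg.inv hd)

lemma HasValue.prod {α : Type*} (s : Finset α) {F : α → RatFun N} {C : α → ℂ}
    (h : ∀ x ∈ s, HasValue y (F x) (C x)) : HasValue y (∏ x ∈ s, F x) (∏ x ∈ s, C x) := by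
  classical
  induction s using Finset.induction_on with
  | empty => simpa using hasValue_intCast (y := y) 1
  | insert a s ha ih =>
    rw [Finset.prod_insert ha, Finset.prod_insert ha]
    exact (h a (by simp)).mul (ih fun x hx => h x (by simp [hx]))

lemma HasValue.sum {α : Type*} (s : Finset α) {F : α → RatFun N} {C : α → ℂ}
    (h : ∀ x ∈ s, HasValue y (F x) (C x)) : HasValue y (∑ x ∈ s, F x) (∑ x ∈ s, C x) := by
  classical
  induction s using Finset.induction_on with
  | empty => simpa using hasValue_intCast (y := y) 0
  | insert a s ha ih =>
    rw [Finset.sum_insert ha, Finset.sum_insert ha]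
    exact (h a (by simp)).add (ih fun x hx => h x (by simp [hx]))

lemma HasValue.pow (hf : HasValue y f c) (k : ℕ) : HasValue y (f ^ k) (c ^ k) := by
  simpa using HasValue.prod (Finset.range k) fun _ _ => hf

lemma HasValue.zpow (hf : HasValue y f c) (hc : c ≠ 0) (k : ℤ) : HasValue y (f ^ k) (c ^ k) := by
  rcases k with k | k
  · simpa using hf.pow k
  · rw [zpow_negSucc, zpow_negSucc]
    exact (hf.pow _).inv (pow_ne_zero _ hc)

lemma HasValue.prodPairs {M : ℕ} {F : Fin M → Fin M → RatFun N} {C : Fin M → Fin M → ℂ}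
    (h : ∀ i j, HasValue y (F i j) (C i j)) : HasValue y (prodPairs F) (prodPairs C) :=
  HasValue.prod _ fun i _ => HasValue.prod _ fun j _ => h i j

lemma HasValue.pfaffian {s : ℕ} {F : Matrix (Fin s) (Fin s) (RatFun N)}
    {C : Matrix (Fin s) (Fin s) ℂ} (h : ∀ i j, HasValue y (F i j) (C i j)) :
    HasValue y (pfaffian F) (pfaffian C) := by
  have hnat : ∀ k : ℕ, HasValue y (k : RatFun N) k := fun k => by
    simpa using hasValue_intCast (y := y) k
  refine HasValue.mul ?_ (HasValue.sum _ fun σ _ => (hasValue_intCast _).mul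
    (HasValue.prod _ fun j _ => h _ _))
  refine HasValue.div (by simpa using hnat 1) (((by simpa using hnat 2 :
    HasValue y (2 : RatFun N) 2).pow _).mul (hnat _)) ?_
  have : ((s / 2).factorial : ℂ) ≠ 0 := by exact_mod_cast Nat.factorial_ne_zero _
  exact mul_ne_zero (pow_ne_zero _ two_ne_zero) this

end HasValue

/-! ### The ring of Laurent polynomials. -/

section Laurent

variable {N : ℕ} {f g : RatFun N}

lemma ratX_ne_zero (i : Fin N) : (ratX i : RatFun N) ≠ 0 := by
  rw [ratX, Ne, map_eq_zero_iff _ (IsFractionRing.injective _ _)]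
  exact MvPolynomial.X_ne_zero i

lemma prod_ratX (N : ℕ) : ∏ i : Fin N, ratX i =
    algebraMap (MvPolynomial (Fin N) ℂ) (RatFun N) (∏ i, MvPolynomial.X i) := by
  rw [map_prod]; rfl

lemma isLaurent_algebraMap (a : MvPolynomial (Fin N) ℂ) :
    IsLaurentPolynomial (algebraMap _ (RatFun N) a) := ⟨0, a, by simp⟩

lemma IsLaurentPolynomial.mul (hf : IsLaurentPolynomial f) (hg : IsLaurentPolynomial g) :
    IsLaurentPolynomial (f * g) := by
  obtain ⟨r, a, h⟩ := hf
  obtain ⟨s, b, h'⟩ := hg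
  exact ⟨r + s, a * b, by rw [map_mul, ← h, ← h']; ring⟩

lemma IsLaurentPolynomial.add (hf : IsLaurentPolynomial f) (hg : IsLaurentPolynomial g) :
    IsLaurentPolynomial (f + g) := by
  obtain ⟨r, a, h⟩ := hf
  obtain ⟨s, b, h'⟩ := hg
  exact ⟨r + s, a * (∏ i, MvPolynomial.X i) ^ s + b * (∏ i, MvPolynomial.X i) ^ r, by
    rw [map_add, map_mul, map_mul, map_pow, map_pow, ← prod_ratX, ← h, ← h']; ring⟩

lemma IsLaurentPolynomial.neg (hf : IsLaurentPolynomial f) : IsLaurentPolynomial (-f) := by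
  simpa using (isLaurent_algebraMap (-1)).mul hf

lemma IsLaurentPolynomial.prod {α : Type*} (s : Finset α) {F : α → RatFun N}
    (h : ∀ x ∈ s, IsLaurentPolynomial (F x)) : IsLaurentPolynomial (∏ x ∈ s, F x) := by
  classical
  induction s using Finset.induction_on with
  | empty => simpa using isLaurent_algebraMap (N := N) 1
  | insert a s ha ih =>
    rw [Finset.prod_insert ha]
    exact (h a (by simp)).mul (ih fun x hx => h x (by simp [hx]))

lemma IsLaurentPolynomial.sum {α : Type*} (s : Finset α) {F : α → RatFun N}
    (h : ∀ x ∈ s, IsLaurentPolynomial (F x)) : IsLaurentPolynomial (∑ x ∈ s, F x) := by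
  classical
  induction s using Finset.induction_on with
  | empty => simpa using isLaurent_algebraMap (N := N) 0
  | insert a s ha ih =>
    rw [Finset.sum_insert ha]
    exact (h a (by simp)).add (ih fun x hx => h x (by simp [hx]))

lemma isLaurent_ratX (i : Fin N) : IsLaurentPolynomial (ratX i) := isLaurent_algebraMap _

lemma isLaurent_ratX_inv (i : Fin N) : IsLaurentPolynomial (ratX i)⁻¹ := by
  refine ⟨1, ∏ j ∈ Finset.univ.erase i, MvPolynomial.X j, ?_⟩
  rw [pow_one, ← Finset.mul_prod_erase _ _ (Finset.mem_univ i),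
    inv_mul_cancel_left₀ (ratX_ne_zero i), map_prod]
  rfl

lemma isLaurent_ratX_zpow (i : Fin N) (k : ℤ) : IsLaurentPolynomial (ratX i ^ k) := by
  rcases k with k | k
  · simpa using IsLaurentPolynomial.prod (Finset.range k) fun _ _ => isLaurent_ratX i
  · rw [zpow_negSucc, ← inv_pow]
    simpa using IsLaurentPolynomial.prod (Finset.range (k + 1)) fun _ _ => isLaurent_ratX_inv i

/-- The values of a Laurent polynomial. -/
lemma IsLaurentPolynomial.hasValue {r : ℕ} {a : MvPolynomial (Fin N) ℂ}
    (h : f * (∏ i, ratX i) ^ r = algebraMap (MvPolynomial (Fin N) ℂ) (RatFun N) a)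
    {y : Fin N → ℂ} (hy : ∀ i, y i ≠ 0) :
    HasValue y f (MvPolynomial.eval y a / (∏ i, y i) ^ r) := by
  have h0 : (∏ i, y i) ≠ 0 := Finset.prod_ne_zero_iff.mpr fun i _ => hy i
  refine ⟨a, (∏ i, MvPolynomial.X i) ^ r, ?_, ?_, ?_⟩
  · rw [map_pow, ← prod_ratX, h]
  · simpa [map_prod] using fun h => absurd h h0
  · simp only [map_pow, map_prod, MvPolynomial.eval_X]
    rw [div_mul_cancel₀ _ (pow_ne_zero _ h0)]

end Laurent

/-! ### Products over pairs, and why `T` is a Laurent polynomial. -/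

lemma prodPairs_eq_prod_filter {R : Type*} [CommMonoid R] {N : ℕ} (f : Fin N → Fin N → R) :
    prodPairs f = ∏ x : Fin N × Fin N with x.1 < x.2, f x.1 x.2 := by
  rw [prodPairs, Finset.prod_filter, Fintype.prod_prod_type]
  refine Finset.prod_congr rfl fun i _ => ?_
  rw [← Finset.prod_filter]
  congr 1
  ext j; simp

lemma prodPairs_mul {R : Type*} [CommMonoid R] {N : ℕ} (f g : Fin N → Fin N → R) :
    prodPairs (fun i j => f i j * g i j) = prodPairs f * prodPairs g := by
  simp only [prodPairs_eq_prod_filter, Finset.prod_mul_distrib]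

lemma prodPairs_congr {R : Type*} [CommMonoid R] {N : ℕ} {f g : Fin N → Fin N → R}
    (h : ∀ i j, i < j → f i j = g i j) : prodPairs f = prodPairs g := by
  simp only [prodPairs_eq_prod_filter]
  exact Finset.prod_congr rfl fun x hx => h _ _ (by simpa using hx)

lemma prodPairs_ne_zero {K : Type*} [Field K] {N : ℕ} {f : Fin N → Fin N → K}
    (h : ∀ i j, i < j → f i j ≠ 0) : prodPairs f ≠ 0 := by
  rw [prodPairs_eq_prod_filter]
  exact Finset.prod_ne_zero_iff.mpr fun x hx => h _ _ (by simpa using hx)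

/-- A product over the pairs of a partial matching divides the product over all pairs. -/
lemma prod_matching_dvd {R : Type*} [CommSemiring R] {N l t : ℕ} (q : Fin N → Fin N → R)
    (hq : ∀ i j, q i j = q j i) (ρ : Fin t × Bool → Fin N ⊕ Fin l)
    (hρ : Function.Injective ρ) :
    ∏ j, (Sum.elim (fun i => Sum.elim (q i) fun _ => 1) (fun _ _ => 1) (ρ (j, false))
      (ρ (j, true)) : R) ∣ prodPairs q := by
  classical
  -- E x j says that slot j of the matching joins the two indices of x. By injectivity of ρ, each x
  -- is joined by at most one slot.
  obtain ⟨E, hE⟩ : ∃ E : Fin N × Fin N → Fin t → Prop, ∀ x j, E x j ↔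
      (ρ (j, false) = Sum.inl x.1 ∧ ρ (j, true) = Sum.inl x.2) ∨
      (ρ (j, false) = Sum.inl x.2 ∧ ρ (j, true) = Sum.inl x.1) := ⟨_, fun _ _ => Iff.rfl⟩
  have h1 : (∏ j, ∏ x : Fin N × Fin N with x.1 < x.2, if E x j then q x.1 x.2 else 1) ∣
      prodPairs q := by
    rw [Finset.prod_comm, prodPairs_eq_prod_filter]
    refine Finset.prod_dvd_prod_of_dvd _ _ fun x _ => ?_
    by_cases h : ∃ j, E x j
    · obtain ⟨j, hj⟩ := h
      rw [Finset.prod_eq_single j _ (by simp), if_pos hj]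
      intro i _ hij
      rw [if_neg]
      intro hi
      apply hij
      have key : ∀ i, E x i → ∃ b, ρ (i, b) = Sum.inl x.1 := by
        intro i hi
        rcases (hE x i).mp hi with h | h
        · exact ⟨_, h.1⟩
        · exact ⟨_, h.2⟩
      obtain ⟨b, hb⟩ := key i hi
      obtain ⟨c, hc⟩ := key j hj
      exact congrArg Prod.fst (hρ (hb.trans hc.symm))
    · push Not at h
      rw [Finset.prod_eq_one fun j _ => if_neg (h j)]
      exact one_dvd _
  refine dvd_trans (Finset.prod_dvd_prod_of_dvd _ _ fun j _ => ?_) h1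
  have hcases : ∀ x : Fin N ⊕ Fin l, (∃ i, x = Sum.inl i) ∨ ∃ i, x = Sum.inr i := by
    rintro (i | i) <;> simp
  obtain ⟨i, h2⟩ | ⟨i, h2⟩ := hcases (ρ (j, false))
  swap; · rw [h2]; simp
  obtain ⟨i', h3⟩ | ⟨i', h3⟩ := hcases (ρ (j, true))
  swap; · rw [h2, h3]; simp
  have hne : i ≠ i' := by
    rintro rfl
    simpa using hρ (h2.trans h3.symm)
  rw [h2, h3, Sum.elim_inl, Sum.elim_inl]
  rcases lt_or_gt_of_ne hne with h | h
  · have := Finset.dvd_prod_of_mem (fun x : Fin N × Fin N => if E x j then q x.1 x.2 else 1)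
      (show (i, i') ∈ Finset.univ.filter (fun x : Fin N × Fin N => x.1 < x.2) by simpa using h)
    rwa [if_pos ((hE _ _).mpr (Or.inl ⟨h2, h3⟩))] at this
  · have := Finset.dvd_prod_of_mem (fun x : Fin N × Fin N => if E x j then q x.1 x.2 else 1)
      (show (i', i) ∈ Finset.univ.filter (fun x : Fin N × Fin N => x.1 < x.2) by simpa using h)
    rw [if_pos ((hE _ _).mpr (Or.inr ⟨h2, h3⟩))] at this
    rwa [hq]

/-- The pfaffian in the definition of `T`, over any field. -/
def tPf {K : Type*} [Field K] {N l : ℕ} (x : Fin N → K) (μ : Fin l → ℤ) : K :=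
  pfaffian (Matrix.reindex finSumFinEquiv finSumFinEquiv
      (Matrix.fromBlocks
        (Matrix.of fun i j : Fin N => (x j ^ 2 - x i ^ 2) / (x j ^ 3 + x i ^ 3))
        (Matrix.of fun (i : Fin N) (j : Fin l) => x i ^ μ j)
        (-(Matrix.of fun (i : Fin N) (j : Fin l) => x i ^ μ j).transpose)
        0))

lemma T_eq (N : ℕ) {l : ℕ} (μ : Fin l → ℤ) :
    T N μ = (prodPairs fun i j : Fin N =>
      (ratX j ^ 3 + ratX i ^ 3) / (ratX j ^ 2 - ratX i ^ 2)) * tPf ratX μ := rfl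

/-- The points with nonzero coordinates where the entries of the pfaffian are defined. -/
def Regular {N : ℕ} (y : Fin N → ℂ) : Prop :=
  (∀ i, y i ≠ 0) ∧ ∀ i j, y j ^ 3 + y i ^ 3 ≠ 0

lemma hasValue_tPf {N l : ℕ} {y : Fin N → ℂ} (hy : Regular y) (μ : Fin l → ℤ) :
    HasValue y (tPf ratX μ) (tPf y μ) := by
  refine HasValue.pfaffian fun u v => ?_
  simp only [Matrix.reindex_apply, Matrix.submatrix_apply]
  rcases finSumFinEquiv.symm u with i | i <;> rcases finSumFinEquiv.symm v with j | j
  · exact (((hasValue_ratX j).pow 2).sub ((hasValue_ratX i).pow 2)).div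
      (((hasValue_ratX j).pow 3).add ((hasValue_ratX i).pow 3)) (hy.2 i j)
  · exact (hasValue_ratX i).zpow (hy.1 i) _
  · exact ((hasValue_ratX j).zpow (hy.1 j) _).neg
  · simpa using hasValue_intCast (y := y) 0

/-- Exchanging the indices i and j leaves the matrix unchanged but reverses the sign of the
pfaffian. -/
lemma tPf_eq_zero {N l : ℕ} (h : Even (N + l)) {y : Fin N → ℂ} (μ : Fin l → ℤ) {i j : Fin N}
    (hij : i ≠ j) (hy : y i = y j) : tPf y μ = 0 := by
  set P : Equiv.Perm (Fin (N + l)) := Equiv.swap (Fin.castAdd l i) (Fin.castAdd l j) with hP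
  have hP' : ∀ u, finSumFinEquiv.symm (P u) =
      Sum.map (Equiv.swap i j) id (finSumFinEquiv.symm u) := by
    intro u
    obtain ⟨u, rfl⟩ := finSumFinEquiv.surjective u
    rw [Equiv.symm_apply_apply, Equiv.symm_apply_eq]
    rcases u with u | u
    · by_cases h1 : u = i
      · subst h1; simp [hP]
      by_cases h2 : u = j
      · subst h2; simp [hP]
      · simp only [finSumFinEquiv_apply_left, Sum.map_inl,
          Equiv.swap_apply_of_ne_of_ne h1 h2]
        exact Equiv.swap_apply_of_ne_of_ne (by simpa using h1) (by simpa using h2)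
    · simp only [finSumFinEquiv_apply_right, Sum.map_inr, id]
      exact Equiv.swap_apply_of_ne_of_ne (by simp [Fin.ext_iff]; omega)
        (by simp [Fin.ext_iff]; omega)
  have hys : ∀ u, y (Equiv.swap i j u) = y u := by
    intro u
    rcases eq_or_ne u i with rfl | h1
    · simp [hy]
    rcases eq_or_ne u j with rfl | h2
    · simp [hy]
    · rw [Equiv.swap_apply_of_ne_of_ne h1 h2]
  rw [tPf, pfaffian_eq_pfNorm h, pfNorm]
  set X := Matrix.reindex finSumFinEquiv finSumFinEquiv
      (Matrix.fromBlocks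
        (Matrix.of fun i j : Fin N => (y j ^ 2 - y i ^ 2) / (y j ^ 3 + y i ^ 3))
        (Matrix.of fun (i : Fin N) (j : Fin l) => y i ^ μ j)
        (-(Matrix.of fun (i : Fin N) (j : Fin l) => y i ^ μ j).transpose) 0) with hX
  have hXP : X.submatrix P P = X := by
    ext u v
    simp only [hX, Matrix.submatrix_apply, Matrix.reindex_apply, hP']
    rcases finSumFinEquiv.symm u with i | i <;> rcases finSumFinEquiv.symm v with j | j <;>
      simp [hys]
  have h1 := pfSum_submatrix_perm (stdPairs _ h) P X
  rw [hXP, hP, Equiv.Perm.sign_swap (by simpa using hij)] at h1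
  simp only [Units.val_neg, Units.val_one, Int.cast_neg, Int.cast_one, neg_mul, one_mul] at h1
  rw [show pfSum (stdPairs _ h) X = 0 by linear_combination h1 / 2, mul_zero]

/-- The quadratic factor `X_j² - X_i X_j + X_i²` of `X_j³ + X_i³`. -/
def quadFactor {N : ℕ} (i j : Fin N) : MvPolynomial (Fin N) ℂ :=
  MvPolynomial.X j ^ 2 - MvPolynomial.X i * MvPolynomial.X j + MvPolynomial.X i ^ 2

lemma ratX_injective {N : ℕ} : Function.Injective (ratX : Fin N → RatFun N) :=
  (IsFractionRing.injective (MvPolynomial (Fin N) ℂ) (RatFun N)).comp MvPolynomial.X_injective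

lemma eval_ne_zero_imp {N : ℕ} {a : MvPolynomial (Fin N) ℂ} (y : Fin N → ℂ)
    (h : MvPolynomial.eval y a ≠ 0) : algebraMap _ (RatFun N) a ≠ 0 := by
  rw [Ne, map_eq_zero_iff _ (IsFractionRing.injective _ _)]
  rintro rfl
  simp at h

lemma ratX_add_ne_zero {N : ℕ} (i j : Fin N) : (ratX j + ratX i : RatFun N) ≠ 0 := by
  rw [ratX, ratX, ← map_add]
  exact eval_ne_zero_imp 1 (by simp)

lemma algebraMap_quadFactor_ne_zero {N : ℕ} (i j : Fin N) :
    algebraMap _ (RatFun N) (quadFactor i j) ≠ 0 :=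
  eval_ne_zero_imp 1 (by simp [quadFactor])

lemma algebraMap_quadFactor {N : ℕ} (i j : Fin N) :
    algebraMap _ (RatFun N) (quadFactor i j) = ratX j ^ 2 - ratX i * ratX j + ratX i ^ 2 := by
  simp [quadFactor, ratX]

/-- Each term of the pfaffian runs over a perfect matching, so each quadratic factor occurs at most
once in its denominator; the linear factors X_i + X_j cancel within the entries. -/
lemma isLaurent_quad_mul_tPf {N l : ℕ} (h : Even (N + l)) (μ : Fin l → ℤ) :
    IsLaurentPolynomial (algebraMap (MvPolynomial (Fin N) ℂ) (RatFun N) (prodPairs quadFactor) *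
      tPf ratX μ) := by
  rw [tPf, pfaffian, ← mul_assoc, mul_comm (algebraMap (MvPolynomial (Fin N) ℂ) (RatFun N) (prodPairs quadFactor)),
    mul_assoc, Finset.mul_sum]
  have hc : (1 / (2 ^ ((N + l) / 2) * (((N + l) / 2).factorial : RatFun N)) : RatFun N) =
      algebraMap (MvPolynomial (Fin N) ℂ) (RatFun N)
        (MvPolynomial.C (1 / (2 ^ ((N + l) / 2) * (((N + l) / 2).factorial)))) := by
    change _ = ((algebraMap (MvPolynomial (Fin N) ℂ) (RatFun N)).comp MvPolynomial.C) _
    rw [map_div₀, map_one, map_mul, map_pow, map_ofNat, map_natCast]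
  rw [hc]
  refine (isLaurent_algebraMap _).mul (IsLaurentPolynomial.sum _ fun σ _ => ?_)
  rw [mul_left_comm]
  refine IsLaurentPolynomial.mul (by
    simpa using isLaurent_algebraMap (((Equiv.Perm.sign σ : ℤ)) : MvPolynomial (Fin N) ℂ)) ?_
  set ρ : Fin ((N + l) / 2) × Bool → Fin N ⊕ Fin l :=
    fun x => finSumFinEquiv.symm (σ (stdPairs _ h x)) with hρ
  have hinj : Function.Injective ρ :=
    finSumFinEquiv.symm.injective.comp (σ.injective.comp (stdPairs _ h).injective)
  obtain ⟨c, hc⟩ := prod_matching_dvd quadFactor (fun i j => by simp only [quadFactor]; ring)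
    ρ hinj
  rw [hc, map_mul, mul_comm (algebraMap _ _ _) (algebraMap _ _ c), mul_assoc, map_prod,
    ← Finset.prod_mul_distrib]
  refine (isLaurent_algebraMap c).mul (IsLaurentPolynomial.prod _ fun j _ => ?_)
  simp only [Matrix.reindex_apply, Matrix.submatrix_apply]
  change IsLaurentPolynomial (_ * Matrix.fromBlocks _ _ _ _ (ρ (j, false)) (ρ (j, true)))
  generalize ρ (j, false) = u
  generalize ρ (j, true) = v
  rcases u with i | i <;> rcases v with j | j
  · simp only [Sum.elim_inl, Matrix.fromBlocks_apply₁₁, Matrix.of_apply]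
    have : algebraMap _ (RatFun N) (quadFactor i j) *
        ((ratX j ^ 2 - ratX i ^ 2) / (ratX j ^ 3 + ratX i ^ 3)) = ratX j + -ratX i := by
      have h1 := algebraMap_quadFactor_ne_zero i j
      have h2 := ratX_add_ne_zero i j
      rw [algebraMap_quadFactor] at h1 ⊢
      rw [show (ratX j ^ 3 + ratX i ^ 3 : RatFun N) =
        (ratX j + ratX i) * (ratX j ^ 2 - ratX i * ratX j + ratX i ^ 2) by ring,
        mul_div_assoc', div_eq_iff (mul_ne_zero h2 h1)]
      ring
    rw [this]
    exact (isLaurent_ratX j).add (isLaurent_ratX i).neg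
  · simpa using isLaurent_ratX_zpow i (μ j)
  · simpa using (isLaurent_ratX_zpow j (μ i)).neg
  · simpa using isLaurent_algebraMap (N := N) 0

section Divisibility

variable {N : ℕ}

/-- The substitution `X_j := X_i`. -/
def subst (i j : Fin N) : MvPolynomial (Fin N) ℂ →ₐ[ℂ] MvPolynomial (Fin N) ℂ :=
  MvPolynomial.rename (Function.update id j i)

/-- The substitution is the identity modulo X_j - X_i. -/
lemma dvd_iff_subst_eq_zero (i j : Fin N) (g : MvPolynomial (Fin N) ℂ) :
    (MvPolynomial.X j - MvPolynomial.X i) ∣ g ↔ subst i j g = 0 := by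
  constructor
  · rintro ⟨c, rfl⟩
    rw [map_mul, map_sub]
    by_cases h : i = j
    · subst h; simp [subst]
    · simp [subst, Function.update_of_ne h]
  · intro h
    have h1 : (Ideal.Quotient.mk (Ideal.span {MvPolynomial.X j - MvPolynomial.X i})).comp
        (subst i j : MvPolynomial (Fin N) ℂ →+* MvPolynomial (Fin N) ℂ) =
        Ideal.Quotient.mk (Ideal.span {MvPolynomial.X j - MvPolynomial.X i}) := by
      apply MvPolynomial.ringHom_ext
      · intro r; simp [subst]
      · intro k
        by_cases hk : k = j
        · subst hk
          simp only [subst, RingHom.comp_apply, RingHom.coe_coe, MvPolynomial.rename_X,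
            Function.update_self]
          rw [eq_comm, Ideal.Quotient.mk_eq_mk_iff_sub_mem]
          exact Ideal.mem_span_singleton_self _
        · simp [subst, Function.update_of_ne hk]
    have h2 := congrArg (fun φ => φ g) h1
    simp only [RingHom.comp_apply, RingHom.coe_coe, h, map_zero] at h2
    rw [← Ideal.mem_span_singleton, ← Ideal.Quotient.eq_zero_iff_mem, ← h2]

/-- Divisibility by X_j - X_i is membership in the kernel of a homomorphism into a domain. -/
lemma prime_X_sub_X {i j : Fin N} (hij : i ≠ j) :
    Prime (MvPolynomial.X j - MvPolynomial.X i : MvPolynomial (Fin N) ℂ) := by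
  refine ⟨?_, ?_, fun a b h => ?_⟩
  · rw [sub_ne_zero]
    exact fun h => hij (MvPolynomial.X_injective h).symm
  · intro h
    have h1 := (dvd_iff_subst_eq_zero i j 1).mp (h.dvd)
    simp at h1
  · simpa only [dvd_iff_subst_eq_zero, map_mul, mul_eq_zero] using h

/-- A polynomial vanishing when any two variables coincide is divisible by the product of
differences. -/
lemma prodPairs_dvd_of_subst {g : MvPolynomial (Fin N) ℂ}
    (h : ∀ i j, i < j → subst i j g = 0) :
    (prodPairs fun i j : Fin N => (MvPolynomial.X j - MvPolynomial.X i :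
      MvPolynomial (Fin N) ℂ)) ∣ g := by
  rw [prodPairs_eq_prod_filter]
  refine Finset.prod_dvd_of_isRelPrime ?_ ?_
  · rintro ⟨i, j⟩ hx ⟨k, l⟩ hy hne
    simp only [Finset.coe_filter, Finset.mem_univ, true_and] at hx hy
    change i < j at hx
    change k < l at hy
    simp only [Function.onFun]
    rw [(prime_X_sub_X hx.ne).irreducible.isRelPrime_iff_not_dvd, dvd_iff_subst_eq_zero]
    simp only [subst, map_sub, MvPolynomial.rename_X, sub_eq_zero]
    intro heq
    have heq := MvPolynomial.X_injective heq
    apply hne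
    simp only [Function.update_apply, id] at heq
    ext <;> simp only [] <;> split_ifs at heq <;> omega
  · rintro ⟨i, j⟩ hx
    exact (dvd_iff_subst_eq_zero i j g).mpr (h i j (by simpa using hx))

end Divisibility

/-- `T` is a Laurent polynomial. -/
theorem isLaurent_T {N l : ℕ} (h : Even (N + l)) (μ : Fin l → ℤ) :
    IsLaurentPolynomial (T N μ) := by
  obtain ⟨r, g, hg⟩ := isLaurent_quad_mul_tPf h μ
  have hsub : ∀ i j, i < j → subst i j g = 0 := by
    intro i j hij
    -- Where `hd` is nonzero the entries are defined and `tPf_eq_zero` applies. So the product with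
    -- `hd` vanishes after the substitution, and `hd` can then be cancelled because it does not
    -- vanish at (1, …, 1).
    set hd : MvPolynomial (Fin N) ℂ := (∏ k, MvPolynomial.X k) *
      ∏ a, ∏ b, (MvPolynomial.X b ^ 3 + MvPolynomial.X a ^ 3)
    have h1 : subst i j (g * hd) = 0 := by
      apply MvPolynomial.funext
      intro y
      rw [map_zero, subst, MvPolynomial.eval_rename, map_mul]
      set y' := y ∘ Function.update id j i
      by_cases h0 : MvPolynomial.eval y' hd = 0
      · rw [h0, mul_zero]
      · simp only [hd, map_mul, map_prod, map_add, map_pow, MvPolynomial.eval_X] at h0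
        have hy : Regular y' := by
          refine ⟨fun a => Finset.prod_ne_zero_iff.mp (left_ne_zero_of_mul h0) a (by simp),
            fun a b => ?_⟩
          exact Finset.prod_ne_zero_iff.mp (Finset.prod_ne_zero_iff.mp
            (right_ne_zero_of_mul h0) a (by simp)) b (by simp)
        have e1 := IsLaurentPolynomial.hasValue hg hy.1
        have e2 := (hasValue_algebraMap (y := y') (prodPairs quadFactor)).mul (hasValue_tPf hy μ)
        have e3 := e1.unique e2
        rw [tPf_eq_zero h μ hij.ne (by simp [y', Function.update_of_ne hij.ne]), mul_zero,
          div_eq_zero_iff] at e3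
        rw [e3.resolve_right (pow_ne_zero _ (Finset.prod_ne_zero_iff.mpr fun a _ => hy.1 a)),
          zero_mul]
    rw [map_mul, mul_eq_zero] at h1
    refine h1.resolve_right fun h2 => ?_
    have h3 := congrArg (MvPolynomial.eval 1) h2
    rw [subst, MvPolynomial.eval_rename] at h3
    simp only [hd, map_mul, map_prod, map_add, map_pow, MvPolynomial.eval_X, map_zero,
      Function.comp, Pi.one_apply] at h3
    norm_num at h3
  obtain ⟨c, hc⟩ := prodPairs_dvd_of_subst hsub
  refine ⟨r, c, ?_⟩
  set Δ : RatFun N := prodPairs fun i j => ratX j - ratX i with hΔ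
  have hΔ0 : Δ ≠ 0 := prodPairs_ne_zero fun i j hij =>
    sub_ne_zero.mpr fun h => hij.ne (ratX_injective h).symm
  have hΔm : algebraMap _ (RatFun N) (prodPairs fun i j : Fin N => (MvPolynomial.X j -
      MvPolynomial.X i : MvPolynomial (Fin N) ℂ)) = Δ := by
    simp [hΔ, prodPairs, ratX]
  have hT : T N μ * Δ = algebraMap (MvPolynomial (Fin N) ℂ) (RatFun N) (prodPairs quadFactor) * tPf ratX μ := by
    rw [T_eq, mul_right_comm, hΔ, ← prodPairs_mul]
    congr 1
    rw [prodPairs, prodPairs, map_prod]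
    refine Finset.prod_congr rfl fun i _ => ?_
    rw [map_prod]
    refine Finset.prod_congr rfl fun j hj => ?_
    have hij : i < j := by simpa using hj
    have h1 := ratX_add_ne_zero i j
    have h2 : (ratX j - ratX i : RatFun N) ≠ 0 :=
      sub_ne_zero.mpr fun h => hij.ne (ratX_injective h).symm
    rw [algebraMap_quadFactor, show (ratX j ^ 2 - ratX i ^ 2 : RatFun N) =
      (ratX j + ratX i) * (ratX j - ratX i) by ring, div_mul_eq_mul_div,
      div_eq_iff (mul_ne_zero h1 h2)]
    ring
  apply mul_left_cancel₀ hΔ0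
  rw [← mul_assoc, mul_comm Δ, hT, hg, hc, map_mul, hΔm]

/-- The values of `T` where the entries of the pfaffian are defined. -/
lemma ratEval_T_mul {N l : ℕ} (h : Even (N + l)) {y : Fin N → ℂ} (hy : Regular y)
    (μ : Fin l → ℤ) :
    ratEval (T N μ) y * (prodPairs fun i j => (y j ^ 2 - y i ^ 2)) =
      (prodPairs fun i j => (y j ^ 3 + y i ^ 3)) * tPf y μ := by
  obtain ⟨r, g, hg⟩ := isLaurent_T h μ
  have e1 := IsLaurentPolynomial.hasValue hg hy.1
  rw [e1.ratEval_eq]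
  refine HasValue.unique (y := y) (f := T N μ * (prodPairs fun i j => (ratX j ^ 2 - ratX i ^ 2)))
    (e1.mul (HasValue.prodPairs fun i j =>
      ((hasValue_ratX j).pow 2).sub ((hasValue_ratX i).pow 2))) ?_
  have : T N μ * (prodPairs fun i j => (ratX j ^ 2 - ratX i ^ 2)) =
      (prodPairs fun i j => (ratX j ^ 3 + ratX i ^ 3)) * tPf ratX μ := by
    rw [T_eq, mul_right_comm, ← prodPairs_mul]
    congr 1
    refine prodPairs_congr fun i j hij => div_mul_cancel₀ _ ?_
    rw [show (ratX j ^ 2 - ratX i ^ 2 : RatFun N) = (ratX j + ratX i) * (ratX j - ratX i) by ring]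
    exact mul_ne_zero (ratX_add_ne_zero i j)
      (sub_ne_zero.mpr fun h => hij.ne (ratX_injective h).symm)
  rw [this]
  exact (HasValue.prodPairs fun i j =>
      ((hasValue_ratX j).pow 3).add ((hasValue_ratX i).pow 3)).mul (hasValue_tPf hy μ)

/-! ### Index tuples as finite sets. -/

section Indices

/-- The index tuple `k_i = s_i + 1`, where `s_1 < ⋯ < s_m` are the elements of a finite set. -/
def indicesOfFinset (S : Finset ℕ) {m : ℕ} (h : S.card = m) : Indices m :=
  ⟨fun i => S.orderEmbOfFin h i + 1, fun _ => Nat.le_add_left _ _,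
    fun _ _ hij => Nat.add_lt_add_right ((S.orderEmbOfFin h).strictMono hij) 1⟩

/-- The finite set of the numbers `k_i - 1`. -/
def finsetOfIndices {m : ℕ} (k : Indices m) : Finset ℕ := Finset.univ.image fun i => k.1 i - 1

lemma indices_pred_strictMono {m : ℕ} (k : Indices m) : StrictMono fun i => k.1 i - 1 :=
  fun i j hij => by
    have := k.2.2 hij
    have := k.2.1 i
    simp only []
    omega

lemma card_finsetOfIndices {m : ℕ} (k : Indices m) : (finsetOfIndices k).card = m := by
  rw [finsetOfIndices, Finset.card_image_of_injective _ (indices_pred_strictMono k).injective]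
  simp

lemma indicesOfFinset_finsetOfIndices {m : ℕ} (k : Indices m) :
    indicesOfFinset (finsetOfIndices k) (card_finsetOfIndices k) = k := by
  apply Subtype.ext
  funext i
  have := Finset.orderEmbOfFin_unique (card_finsetOfIndices k) (f := fun i => k.1 i - 1)
    (fun i => Finset.mem_image_of_mem _ (Finset.mem_univ i)) (indices_pred_strictMono k)
  simp only [indicesOfFinset]
  rw [← this]
  have := k.2.1 i
  simp only []
  omega

lemma finsetOfIndices_indicesOfFinset (S : Finset ℕ) {m : ℕ} (h : S.card = m) :
    finsetOfIndices (indicesOfFinset S h) = S := by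
  ext x
  simp only [finsetOfIndices, indicesOfFinset, Nat.add_sub_cancel, Finset.mem_image,
    Finset.mem_univ, true_and]
  rw [← Finset.mem_coe, ← Finset.range_orderEmbOfFin S h]
  rfl

lemma finsetOfIndices_injective {m : ℕ} : Function.Injective (finsetOfIndices (m := m)) := by
  intro k k' h
  rw [← indicesOfFinset_finsetOfIndices k, ← indicesOfFinset_finsetOfIndices k']
  simp only [h]

/-- Index tuples of arbitrary length correspond to finite sets. -/
def indicesEquiv : (Σ m, Indices m) ≃ Finset ℕ where
  toFun k := finsetOfIndices k.2
  invFun S := ⟨S.card, indicesOfFinset S rfl⟩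
  left_inv := by
    rintro ⟨m, k⟩
    have key : ∀ (S : Finset ℕ) (h : S.card = m),
        (⟨S.card, indicesOfFinset S rfl⟩ : Σ m, Indices m) = ⟨m, indicesOfFinset S h⟩ := by
      intro S h; subst h; rfl
    exact (key _ (card_finsetOfIndices k)).trans
      (congrArg (Sigma.mk m) (indicesOfFinset_finsetOfIndices k))
  right_inv S := finsetOfIndices_indicesOfFinset S rfl

lemma prod_finsetOfIndices {M : Type*} [CommMonoid M] {m : ℕ} (k : Indices m) (f : ℕ → M) :
    ∏ j ∈ finsetOfIndices k, f j = ∏ i, f (k.1 i - 1) := by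
  rw [finsetOfIndices, Finset.prod_image fun i _ j _ h => (indices_pred_strictMono k).injective h]

lemma coeff_eq (p : ℂ) {m : ℕ} (k : Indices m) :
    coeff p k = ∏ i, lambertCoeff p (k.1 i - 1) := by
  refine Finset.prod_congr rfl fun i _ => ?_
  have h := k.2.1 i
  obtain ⟨j, hj⟩ : ∃ j, k.1 i = j + 1 := ⟨k.1 i - 1, by omega⟩
  rw [hj, lambertCoeff, lambertSign, Nat.add_sub_cancel, show 2 * (j + 1) - 1 = 2 * j + 1 by omega]
  ring

/-- The terms are among those of the expanded product ∏_j (1 + B t^j). -/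
lemma summable_indices {B t : ℝ} (hB : 0 ≤ B) (ht0 : 0 ≤ t) (ht : t < 1) (m : ℕ) :
    Summable fun k : Indices m => ∏ i, B * t ^ (k.1 i - 1) := by
  have h := (summable_finsetProd_of_summable_nonneg (f := fun j : ℕ => B * t ^ j)
    (fun j => by positivity) ((summable_geometric_of_lt_one ht0 ht).mul_left B)).comp_injective
    (finsetOfIndices_injective (m := m))
  exact h.congr fun k => prod_finsetOfIndices k _

end Indices

/-! ### Bounds for the terms of the expansion. -/

/-- The upper left block of the matrices in the definition of `T`. -/
def tBlock {N : ℕ} (y : Fin N → ℂ) : Matrix (Fin N) (Fin N) ℂ :=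
  Matrix.of fun i j => (y j ^ 2 - y i ^ 2) / (y j ^ 3 + y i ^ 3)

/-- The border columns of the matrices in the definition of `T`. -/
def tCol {N : ℕ} (y : Fin N → ℂ) (b : Bool) (j : ℕ) (i : Fin N) : ℂ :=
  cond b (y i ^ (-((j + 1 : ℕ) : ℤ))) (y i ^ j)

/-- The nested arrangement undoes the reversal in the first half of the tuple, so that the exponents
k_i - 1 and -k_i form a pair. -/
lemma tPf_tuple {N m : ℕ} (hN : Even N) (y : Fin N → ℂ) (k : Indices m) :
    tPf y (tuple k) = pfBordered (stdPairs N hN) (tBlock y)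
      fun (x : Fin m × Bool) => tCol y x.2 (k.1 x.1 - 1) := by
  rw [tPf, pfaffian_reindex_bordered hN]
  congr 1
  funext ⟨i, b⟩ r
  have h := k.2.1 i
  obtain ⟨j, hj⟩ : ∃ j, k.1 i = j + 1 := ⟨k.1 i - 1, by omega⟩
  cases b
  · rw [nestedEquiv_false]
    simp only [Matrix.of_apply, tuple, Fin.append_left, Fin.rev_rev, tCol, cond_false, hj,
      Nat.add_sub_cancel]
    rw [← zpow_natCast]
    congr 1
    push_cast; ring
  · rw [nestedEquiv_true]
    simp only [Matrix.of_apply, tuple, Fin.append_right, tCol, cond_true, hj, Nat.add_sub_cancel]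

lemma norm_pfNorm_le {κ ι : Type*} [Fintype κ] [DecidableEq κ] [Fintype ι] [DecidableEq ι]
    (e : κ × Bool ≃ ι) (A : Matrix ι ι ℂ) {K : ℝ} (hA : ∀ i j, ‖A i j‖ ≤ K) :
    ‖pfNorm e A‖ ≤ (Fintype.card ι).factorial * K ^ Fintype.card κ := by
  have h1 : ‖pfSum e A‖ ≤ (Fintype.card ι).factorial * K ^ Fintype.card κ := by
    rw [pfSum, pfForm, ← Fintype.card_perm, ← nsmul_eq_mul, ← Finset.card_univ (α := Equiv.Perm ι)]
    refine (norm_sum_le _ _).trans (Finset.sum_le_card_nsmul _ _ _ fun σ _ => ?_)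
    have hs : ‖((Equiv.Perm.sign σ : ℤ) : ℂ)‖ = 1 := by
      rcases Int.units_eq_one_or (Equiv.Perm.sign σ) with h | h <;> simp [h]
    rw [norm_mul, hs, one_mul, norm_prod, ← Finset.card_univ, ← Finset.prod_const]
    exact Finset.prod_le_prod (fun _ _ => norm_nonneg _) fun j _ => hA _ _
  rw [pfNorm, norm_mul]
  refine (mul_le_of_le_one_left (norm_nonneg _) ?_).trans h1
  rw [norm_div, norm_one, norm_mul, norm_pow, Complex.norm_natCast, Complex.norm_ofNat]
  refine div_le_one_of_le₀ ?_ (by positivity)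
  have := Nat.factorial_pos (Fintype.card κ)
  exact one_le_mul_of_one_le_of_one_le (one_le_pow₀ one_le_two) (by exact_mod_cast this)

/-- A bound for the pfaffian in the definition of `T`. -/
lemma norm_tPf_le {N m : ℕ} (hN : Even N) {y : Fin N → ℂ} (k : Indices m) {K a b : ℝ}
    (hK : 1 ≤ K) (hA : ∀ i j, ‖tBlock y i j‖ ≤ K) (ha0 : 0 < a) (ha : ∀ i, a ≤ ‖y i‖)
    (hb : ∀ i, ‖y i‖ ≤ b) (hb0 : 0 < b) :
    ‖tPf y (tuple k)‖ ≤ (Fintype.card (Fin N ⊕ Fin m × Bool)).factorial *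
      K ^ Fintype.card (Fin (N / 2) ⊕ Fin m) * ∏ i, b ^ (k.1 i - 1) * a⁻¹ ^ (k.1 i - 1 + 1) := by
  -- Dividing the border columns by these numbers makes their entries at most 1 in norm; the whole
  -- dependence on k is then the product of the `d x`.
  set d : Fin m × Bool → ℂ :=
    fun x => cond x.2 ((a⁻¹ ^ (k.1 x.1 - 1 + 1) : ℝ) : ℂ) ((b ^ (k.1 x.1 - 1) : ℝ) : ℂ) with hd
  have hd0 : ∀ x, d x ≠ 0 := by
    rintro ⟨i, _ | _⟩
    · simp only [hd, cond_false]; exact_mod_cast (pow_pos hb0 _).ne'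
    · simp only [hd, cond_true]; exact_mod_cast (pow_pos (inv_pos.mpr ha0) _).ne'
  have h1 : (fun (x : Fin m × Bool) => tCol y x.2 (k.1 x.1 - 1)) =
      fun x i => d x * (tCol y x.2 (k.1 x.1 - 1) i / d x) := by
    funext x i
    rw [mul_div_cancel₀ _ (hd0 x)]
  have hcol : ∀ x i, ‖tCol y x.2 (k.1 x.1 - 1) i / d x‖ ≤ K := by
    rintro ⟨j, _ | _⟩ i <;> refine le_trans ?_ hK
    · simp only [hd, tCol, cond_false]
      rw [norm_div, norm_pow, Complex.norm_real, Real.norm_of_nonneg (by positivity)]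
      refine div_le_one_of_le₀ ?_ (by positivity)
      gcongr; exact hb i
    · simp only [hd, tCol, cond_true]
      rw [norm_div, norm_zpow, Complex.norm_real, Real.norm_of_nonneg (by positivity), zpow_neg,
        zpow_natCast, ← inv_pow]
      refine div_le_one_of_le₀ ?_ (by positivity)
      gcongr; exact ha i
  rw [tPf_tuple hN, h1, pfBordered_scale, norm_mul, mul_comm]
  have hp : ‖∏ x, d x‖ = ∏ i, b ^ (k.1 i - 1) * a⁻¹ ^ (k.1 i - 1 + 1) := by
    rw [norm_prod, Fintype.prod_prod_type]
    refine Finset.prod_congr rfl fun i _ => ?_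
    rw [Fintype.prod_bool, mul_comm]
    simp only [hd, cond_true, cond_false]
    rw [Complex.norm_real, Complex.norm_real, Real.norm_of_nonneg (by positivity),
      Real.norm_of_nonneg (by positivity)]
  rw [hp]
  gcongr
  rw [pfBordered]
  refine norm_pfNorm_le _ _ ?_
  have hK0 : 0 ≤ K := zero_le_one.trans hK
  rintro (i | x) (j | x')
  · exact hA i j
  · exact hcol x' i
  · simpa [bordered] using hcol x j
  · simpa [bordered] using hK0

/-- The bound in the presence of the coefficients. -/
lemma norm_coeff_mul_tPf_le {p : ℂ} (hp : ‖p‖ < 1) {N m : ℕ} (hN : Even N) {y : Fin N → ℂ}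
    (k : Indices m) {K a b : ℝ} (hK : 1 ≤ K) (hA : ∀ i j, ‖tBlock y i j‖ ≤ K) (ha0 : 0 < a)
    (ha : ∀ i, a ≤ ‖y i‖) (hb : ∀ i, ‖y i‖ ≤ b) (hb0 : 0 < b) :
    ‖coeff p k * tPf y (tuple k)‖ ≤ (Fintype.card (Fin N ⊕ Fin m × Bool)).factorial *
      K ^ Fintype.card (Fin (N / 2) ⊕ Fin m) *
      ∏ i, ((1 - ‖p‖)⁻¹ * ‖p‖ * a⁻¹) * (‖p‖ ^ 2 * b * a⁻¹) ^ (k.1 i - 1) := by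
  have h1 := norm_tPf_le hN k hK hA ha0 ha hb hb0
  have h2 : ‖coeff p k‖ ≤ ∏ i, (1 - ‖p‖)⁻¹ * ‖p‖ ^ (2 * (k.1 i - 1) + 1) := by
    rw [coeff_eq, norm_prod]
    exact Finset.prod_le_prod (fun _ _ => norm_nonneg _) fun i _ => norm_lambertCoeff_le hp _
  have h0 : 0 < 1 - ‖p‖ := by linarith
  rw [norm_mul]
  refine (mul_le_mul h2 h1 (norm_nonneg _) (Finset.prod_nonneg fun i _ => by positivity)).trans
    (le_of_eq ?_)
  rw [mul_left_comm, ← Finset.prod_mul_distrib]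
  congr 1
  refine Finset.prod_congr rfl fun i _ => ?_
  ring

/-- A generic line through `y`. -/
def line {N : ℕ} (y : Fin N → ℂ) (s : ℂ) : Fin N → ℂ := fun i => y i + s * ((i : ℕ) + 1 : ℂ)

lemma continuous_line {N : ℕ} : Continuous fun x : (Fin N → ℂ) × ℂ => line x.1 x.2 := by
  unfold line; fun_prop

/-- Small circles in a generic line avoid the exceptional points. -/
lemma exists_radius {N : ℕ} (y : Fin N → ℂ) {δ : ℝ} (hδ : 0 < δ) :
    ∃ r, 0 < r ∧ r < δ ∧ ∀ s : ℂ, ‖s‖ = r → (∀ i j, line y s j ^ 3 + line y s i ^ 3 ≠ 0) ∧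
      ∀ i j, i ≠ j → line y s j ^ 2 - line y s i ^ 2 ≠ 0 := by
  let Y : Fin N → Polynomial ℂ := fun i => .C (y i) + .X * .C ((i : ℕ) + 1 : ℂ)
  have hY : ∀ i s, (Y i).eval s = line y s i := fun i s => by simp [Y, line]
  let P : Polynomial ℂ := (∏ i, ∏ j, (Y j ^ 3 + Y i ^ 3)) *
    ∏ i, ∏ j, if i = j then 1 else Y j ^ 2 - Y i ^ 2
  -- No factor is the zero polynomial: the leading coefficients (j+1)^3 + (i+1)^3 and (j+1)^2 -
  -- (i+1)^2 are nonzero. They are read off below by third and second finite differences of the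
  -- values.
  have hP : P ≠ 0 := by
    refine mul_ne_zero (Finset.prod_ne_zero_iff.mpr fun i _ => Finset.prod_ne_zero_iff.mpr
      fun j _ h => ?_) (Finset.prod_ne_zero_iff.mpr fun i _ => Finset.prod_ne_zero_iff.mpr
      fun j _ => ?_)
    · have e : ∀ s, line y s j ^ 3 + line y s i ^ 3 = 0 := fun s => by
        rw [← hY, ← hY, ← Polynomial.eval_pow, ← Polynomial.eval_pow, ← Polynomial.eval_add, h,
          Polynomial.eval_zero]
      have h1 : ((j : ℕ) + 1 : ℂ) ^ 3 + ((i : ℕ) + 1 : ℂ) ^ 3 = 0 := by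
        have e0 := e 0; have e1 := e 1; have e2 := e 2; have e3 := e 3
        simp only [line] at e0 e1 e2 e3
        linear_combination (e3 - 3 * e2 + 3 * e1 - e0) / 6
      have h2 : ((j : ℕ) + 1) ^ 3 + ((i : ℕ) + 1) ^ 3 = 0 := by exact_mod_cast h1
      simp at h2
    · split_ifs with hij
      · exact one_ne_zero
      intro h
      have e : ∀ s, line y s j ^ 2 - line y s i ^ 2 = 0 := fun s => by
        rw [← hY, ← hY, ← Polynomial.eval_pow, ← Polynomial.eval_pow, ← Polynomial.eval_sub, h,
          Polynomial.eval_zero]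
      have h1 : ((j : ℕ) + 1 : ℂ) ^ 2 = ((i : ℕ) + 1 : ℂ) ^ 2 := by
        have e0 := e 0; have e1 := e 1; have e2 := e 2
        simp only [line] at e0 e1 e2
        linear_combination (e2 - 2 * e1 + e0) / 2
      have h2 : ((j : ℕ) + 1) ^ 2 = ((i : ℕ) + 1) ^ 2 := by exact_mod_cast h1
      have h3 := Nat.pow_left_injective two_ne_zero h2
      exact hij (Fin.ext (by omega))
  -- Only the finitely many norms of roots of P must be avoided.
  obtain ⟨r, hr, hr'⟩ := (Set.Ioo_infinite hδ).exists_notMem_finset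
    (P.roots.toFinset.image fun s => ‖s‖)
  refine ⟨r, hr.1, hr.2, fun s hs => ?_⟩
  have hroot : P.eval s ≠ 0 := by
    intro h
    apply hr'
    rw [Finset.mem_image]
    exact ⟨s, by simp [hP, h], hs⟩
  simp only [P, Polynomial.eval_mul, Polynomial.eval_prod, Polynomial.eval_add,
    Polynomial.eval_pow, hY] at hroot
  refine ⟨fun i j => Finset.prod_ne_zero_iff.mp (Finset.prod_ne_zero_iff.mp
    (left_ne_zero_of_mul hroot) i (by simp)) j (by simp), fun i j hij => ?_⟩
  have := Finset.prod_ne_zero_iff.mp (Finset.prod_ne_zero_iff.mp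
    (right_ne_zero_of_mul hroot) i (by simp)) j (by simp)
  simpa [hij, hY] using this

lemma IsLaurentPolynomial.ratEval_eq {N : ℕ} {f : RatFun N} (h : IsLaurentPolynomial f) :
    ∃ (r : ℕ) (g : MvPolynomial (Fin N) ℂ), ∀ y : Fin N → ℂ, (∀ i, y i ≠ 0) →
      ratEval f y = MvPolynomial.eval y g / (∏ i, y i) ^ r := by
  obtain ⟨r, g, hg⟩ := h
  exact ⟨r, g, fun y hy => (IsLaurentPolynomial.hasValue hg hy).ratEval_eq⟩

lemma differentiable_eval_line {N : ℕ} (g : MvPolynomial (Fin N) ℂ) (y : Fin N → ℂ) :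
    Differentiable ℂ fun s => MvPolynomial.eval (line y s) g := by
  induction g using MvPolynomial.induction_on with
  | C a => simp
  | add p q hp hq => simp only [map_add]; exact hp.add hq
  | mul_X p i hp =>
    simp only [map_mul, MvPolynomial.eval_X]
    exact hp.mul (by unfold line; fun_prop)

/-- The maximum principle for Laurent polynomials on generic lines. -/
lemma IsLaurentPolynomial.norm_ratEval_le {N : ℕ} {f : RatFun N} (h : IsLaurentPolynomial f)
    {y : Fin N → ℂ} {r C : ℝ} (hr : 0 < r) (h0 : ∀ s, ‖s‖ ≤ r → ∀ i, line y s i ≠ 0)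
    (hC : ∀ s, ‖s‖ = r → ‖ratEval f (line y s)‖ ≤ C) : ‖ratEval f y‖ ≤ C := by
  obtain ⟨k, g, hg⟩ := h.ratEval_eq
  have hcl : closure (Metric.ball (0 : ℂ) r) = Metric.closedBall 0 r := closure_ball _ hr.ne'
  have hfr : frontier (Metric.ball (0 : ℂ) r) = Metric.sphere 0 r := frontier_ball _ hr.ne'
  have hd : DifferentiableOn ℂ (fun s => ratEval f (line y s)) (Metric.closedBall 0 r) := by
    have : DifferentiableOn ℂ (fun s => MvPolynomial.eval (line y s) g / (∏ i, line y s i) ^ k)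
        (Metric.closedBall 0 r) := by
      refine (differentiable_eval_line g y).differentiableOn.div ?_ fun s hs => ?_
      · refine Differentiable.differentiableOn ?_
        refine Differentiable.pow ?_ k
        refine Differentiable.fun_finsetProd fun i _ => ?_
        unfold line; fun_prop
      · exact pow_ne_zero _ (Finset.prod_ne_zero_iff.mpr fun i _ => h0 s (by simpa using hs) i)
    exact this.congr fun s hs => hg _ (h0 s (by simpa using hs))
  have := Complex.norm_le_of_forall_mem_frontier_norm_le (U := Metric.ball (0 : ℂ) r)
    (f := fun s => ratEval f (line y s)) Metric.isBounded_ball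
    (DifferentiableOn.diffContOnCl (by rwa [hcl])) (C := C)
    (fun s hs => hC s (by rw [hfr] at hs; simpa using hs)) (z := 0)
    (by rw [hcl]; simp [hr.le])
  have h0 : line y 0 = y := by funext i; simp [line]
  rwa [h0] at this

/-- A continuous majorant of the quantities entering the bounds. -/
def majorant {N : ℕ} (y : Fin N → ℂ) : ℝ :=
  1 + ∑ i, ∑ j, ‖tBlock y i j‖ +
    ‖(prodPairs fun i j => (y j ^ 3 + y i ^ 3) : ℂ) / prodPairs fun i j => (y j ^ 2 - y i ^ 2)‖

lemma continuousAt_majorant {N : ℕ} {y : Fin N → ℂ} (h1 : ∀ i j, y j ^ 3 + y i ^ 3 ≠ 0)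
    (h2 : ∀ i j, i ≠ j → y j ^ 2 - y i ^ 2 ≠ 0) : ContinuousAt majorant y := by
  have hD : (prodPairs fun i j => (y j ^ 2 - y i ^ 2) : ℂ) ≠ 0 :=
    prodPairs_ne_zero fun i j hij => h2 i j hij.ne
  unfold majorant
  refine ContinuousAt.add (ContinuousAt.add continuousAt_const ?_) (ContinuousAt.norm ?_)
  · refine tendsto_finsetSum _ fun i _ => tendsto_finsetSum _ fun j _ => ContinuousAt.norm ?_
    simp only [tBlock, Matrix.of_apply]
    exact ContinuousAt.div (by fun_prop) (by fun_prop) (h1 i j)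
  · refine ContinuousAt.div ?_ ?_ hD <;>
    · unfold prodPairs
      fun_prop

lemma norm_tBlock_le_majorant {N : ℕ} (y : Fin N → ℂ) (i j : Fin N) :
    ‖tBlock y i j‖ ≤ majorant y := by
  have h1 : ‖tBlock y i j‖ ≤ ∑ i, ∑ j, ‖tBlock y i j‖ :=
    (Finset.single_le_sum (f := fun j => ‖tBlock y i j‖) (fun _ _ => norm_nonneg _)
      (Finset.mem_univ j)).trans
    (Finset.single_le_sum (f := fun i => ∑ j, ‖tBlock y i j‖)
      (fun _ _ => Finset.sum_nonneg fun _ _ => norm_nonneg _) (Finset.mem_univ i))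
  rw [majorant]
  linarith [norm_nonneg ((prodPairs fun i j => (y j ^ 3 + y i ^ 3) : ℂ) /
    prodPairs fun i j => (y j ^ 2 - y i ^ 2))]

/-- The slack in |p|^2 b < a makes |p|^2 b/a < 1, which becomes the ratio of the geometric majorant.
-/
lemma exists_bounds {N : ℕ} {p : ℂ} {y : Fin N → ℂ} (hy0 : ∀ i, y i ≠ 0)
    (hp : ‖p‖ < 1)
    (hy : ∀ i j, ‖p‖ ^ 2 * ‖y i‖ < ‖y j‖) :
    ∃ a b : ℝ, 0 < a ∧ 0 < b ∧ ‖p‖ ^ 2 * b < a ∧ ∀ i, a < ‖y i‖ ∧ ‖y i‖ < b := by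
  rcases isEmpty_or_nonempty (Fin N) with hN | hN
  · refine ⟨1, 1, one_pos, one_pos, ?_, fun i => isEmptyElim i⟩
    rw [mul_one]; exact pow_lt_one₀ (norm_nonneg _) hp two_ne_zero
  obtain ⟨i, hi⟩ := Finite.exists_min fun i => ‖y i‖
  obtain ⟨j, hj⟩ := Finite.exists_max fun i => ‖y i‖
  have h1 : ∀ᶠ ε in 𝓝 (0 : ℝ), ‖p‖ ^ 2 * (‖y j‖ + ε) < ‖y i‖ - ε :=
    ContinuousAt.eventually_lt (by fun_prop) (by fun_prop) (by simpa using hy j i)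
  have h2 : ∀ᶠ ε in 𝓝 (0 : ℝ), ε < ‖y i‖ :=
    ContinuousAt.eventually_lt (by fun_prop) (by fun_prop) (by simpa using hy0 i)
  obtain ⟨ε, ⟨h1, h2⟩, hε⟩ := (((h1.and h2).filter_mono nhdsWithin_le_nhds).and
    (self_mem_nhdsWithin (a := (0 : ℝ)) (s := Set.Ioi 0))).exists
  change 0 < ε at hε
  exact ⟨‖y i‖ - ε, ‖y j‖ + ε, by linarith, by positivity, h1,
    fun k => ⟨by linarith [hi k], by linarith [hj k]⟩⟩

/-- Locally uniform geometric bounds for the terms of the expansion. -/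
theorem exists_local_bound {N : ℕ} (hN : Even N) {p : ℂ} (hp : ‖p‖ < 1)
    {y : Fin N → ℂ} (hy0 : ∀ i, y i ≠ 0) (hy : ∀ i j, ‖p‖ ^ 2 * ‖y i‖ < ‖y j‖) (m : ℕ) :
    ∃ C B t : ℝ, 0 ≤ B ∧ 0 ≤ t ∧ t < 1 ∧ ∀ᶠ y' in 𝓝 y, (∀ i, y' i ≠ 0) ∧ ∀ k : Indices m,
      ‖coeff p k * ratEval (T N (tuple k)) y'‖ ≤ C * ∏ i, B * t ^ (k.1 i - 1) := by
  obtain ⟨a, b, ha, hb, hab, hyab⟩ := exists_bounds hy0 hp hy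
  have hreg : ∀ᶠ s in 𝓝 (0 : ℂ), ∀ i, a < ‖line y s i‖ ∧ ‖line y s i‖ < b := by
    rw [eventually_all]
    intro i
    have hc : ContinuousAt (fun s => ‖line y s i‖) 0 := by unfold line; fun_prop
    have h0 : ‖line y 0 i‖ = ‖y i‖ := by simp [line]
    exact (continuousAt_const.eventually_lt hc (by rw [h0]; exact (hyab i).1)).and
      (hc.eventually_lt continuousAt_const (by rw [h0]; exact (hyab i).2))
  obtain ⟨δ, hδ, hδ'⟩ := Metric.eventually_nhds_iff.mp hreg
  -- One radius, chosen for y, serves all nearby y' by compactness of the disc and the circle. On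
  -- the circle the formula for T is valid and can be estimated; the maximum principle carries the
  -- estimate to the centre y', even where that formula degenerates.
  obtain ⟨r, hr, hrδ, hcirc⟩ := exists_radius y hδ
  have hball : ∀ s, ‖s‖ ≤ r → ∀ i, a < ‖line y s i‖ ∧ ‖line y s i‖ < b := fun s hs =>
    hδ' (by simpa using hs.trans_lt hrδ)
  have hlc : ∀ s : ℂ, ContinuousAt (fun s => line y s) s := fun s => by unfold line; fun_prop
  obtain ⟨K, hK⟩ := (isCompact_sphere (0 : ℂ) r).exists_bound_of_continuousOn
    (f := fun s => majorant (line y s)) (fun s hs => by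
      obtain ⟨h1, h2⟩ := hcirc s (by simpa using hs)
      exact ((continuousAt_majorant h1 h2).comp (f := fun s => line y s)
        (hlc s)).continuousWithinAt)
  set K' := max 1 (K + 1)
  have hev1 : ∀ᶠ y' in 𝓝 y, ∀ s ∈ Metric.closedBall (0 : ℂ) r,
      ∀ i, a < ‖line y' s i‖ ∧ ‖line y' s i‖ < b := by
    refine (isCompact_closedBall (0 : ℂ) r).eventually_forall_of_forall_eventually fun s hs => ?_
    rw [eventually_all]
    intro i
    have hc : ContinuousAt (fun x : (Fin N → ℂ) × ℂ => ‖line x.1 x.2 i‖) (y, s) := by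
      unfold line; fun_prop
    have h0 := hball s (by simpa using hs) i
    exact (continuousAt_const.eventually_lt hc h0.1).and
      (hc.eventually_lt continuousAt_const h0.2)
  have hev2 : ∀ᶠ y' in 𝓝 y, ∀ s ∈ Metric.sphere (0 : ℂ) r,
      (∀ i j, line y' s j ^ 3 + line y' s i ^ 3 ≠ 0) ∧
      (∀ i j, i ≠ j → line y' s j ^ 2 - line y' s i ^ 2 ≠ 0) ∧ majorant (line y' s) < K' := by
    refine (isCompact_sphere (0 : ℂ) r).eventually_forall_of_forall_eventually fun s hs => ?_
    obtain ⟨h1, h2⟩ := hcirc s (by simpa using hs)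
    have hl : ContinuousAt (fun x : (Fin N → ℂ) × ℂ => line x.1 x.2) (y, s) :=
      continuous_line.continuousAt
    refine (eventually_all.mpr fun i => eventually_all.mpr fun j => ?_).and
      ((eventually_all.mpr fun i => eventually_all.mpr fun j => ?_).and ?_)
    · have hc : ContinuousAt (fun x : (Fin N → ℂ) × ℂ =>
          line x.1 x.2 j ^ 3 + line x.1 x.2 i ^ 3) (y, s) := by unfold line; fun_prop
      exact hc.eventually_ne (h1 i j)
    · by_cases hij : i = j
      · simp [hij]
      · have hc : ContinuousAt (fun x : (Fin N → ℂ) × ℂ =>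
          line x.1 x.2 j ^ 2 - line x.1 x.2 i ^ 2) (y, s) := by unfold line; fun_prop
        filter_upwards [hc.eventually_ne (h2 i j hij)] with x hx _ using hx
    · have hc := (continuousAt_majorant h1 h2).comp (x := (y, s))
        (f := fun x : (Fin N → ℂ) × ℂ => line x.1 x.2) hl
      refine hc.eventually_lt continuousAt_const ?_
      have h3 := hK s hs
      have h4 := (Real.le_norm_self _).trans h3
      exact (h4.trans_lt (lt_add_one K)).trans_le (le_max_right _ _)
  have hp1 : 0 < 1 - ‖p‖ := by linarith
  refine ⟨K' * ((Fintype.card (Fin N ⊕ Fin m × Bool)).factorial *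
      K' ^ Fintype.card (Fin (N / 2) ⊕ Fin m)), (1 - ‖p‖)⁻¹ * ‖p‖ * a⁻¹, ‖p‖ ^ 2 * b * a⁻¹,
    by positivity, by positivity, ?_, ?_⟩
  · rw [← div_eq_mul_inv, div_lt_one ha]; exact hab
  filter_upwards [hev1, hev2] with y' h1 h2
  refine ⟨fun i => ?_, fun k => ?_⟩
  · have := (h1 0 (by simpa using hr.le) i).1
    simp only [line, zero_mul, add_zero] at this
    exact norm_pos_iff.mp (ha.trans this)
  have hNm : Even (N + (m + m)) := even_add_self_add hN m
  have hne : ∀ s, ‖s‖ ≤ r → ∀ i, line y' s i ≠ 0 := fun s hs i =>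
    norm_pos_iff.mp (ha.trans (h1 s (by simpa using hs) i).1)
  -- The coefficient is absorbed as a constant polynomial, so that the maximum principle bounds the
  -- whole term.
  have hL : IsLaurentPolynomial (algebraMap (MvPolynomial (Fin N) ℂ) (RatFun N)
      (MvPolynomial.C (coeff p k)) * T N (tuple k)) :=
    (isLaurent_algebraMap _).mul (isLaurent_T hNm _)
  have hval : ∀ y : Fin N → ℂ, (∀ i, y i ≠ 0) →
      ratEval (algebraMap (MvPolynomial (Fin N) ℂ) (RatFun N)
      (MvPolynomial.C (coeff p k)) * T N (tuple k)) y =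
      coeff p k * ratEval (T N (tuple k)) y := by
    intro y hy
    obtain ⟨q, g, hg⟩ := isLaurent_T hNm (tuple k)
    have e1 := IsLaurentPolynomial.hasValue hg hy
    have e2 := (hasValue_algebraMap (y := y) (MvPolynomial.C (coeff p k))).mul e1
    rw [e1.ratEval_eq, e2.ratEval_eq, MvPolynomial.eval_C]
  have h0 : line y' 0 = y' := by funext i; simp [line]
  rw [← hval y' (by rw [← h0]; exact hne 0 (by simpa using hr.le))]
  refine hL.norm_ratEval_le hr hne fun s hs => ?_
  obtain ⟨g1, g2, g3⟩ := h2 s (by simpa using hs)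
  have g0 := hne s hs.le
  have gb := h1 s (by simpa using hs.le)
  rw [hval _ g0]
  have hD : (prodPairs fun i j => (line y' s j ^ 2 - line y' s i ^ 2) : ℂ) ≠ 0 :=
    prodPairs_ne_zero fun i j hij => g2 i j hij.ne
  have hT := ratEval_T_mul hNm ⟨g0, g1⟩ (tuple k)
  have hT' : coeff p k * ratEval (T N (tuple k)) (line y' s) =
      ((prodPairs fun i j => (line y' s j ^ 3 + line y' s i ^ 3) : ℂ) /
        prodPairs fun i j => (line y' s j ^ 2 - line y' s i ^ 2)) *
        (coeff p k * tPf (line y' s) (tuple k)) := by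
    field_simp
    linear_combination (coeff p k) * hT
  have hq : ‖(prodPairs fun i j => (line y' s j ^ 3 + line y' s i ^ 3) : ℂ) /
        prodPairs fun i j => (line y' s j ^ 2 - line y' s i ^ 2)‖ ≤ K' := by
    refine le_trans ?_ g3.le
    rw [majorant]
    have : 0 ≤ ∑ i, ∑ j, ‖tBlock (line y' s) i j‖ :=
      Finset.sum_nonneg fun _ _ => Finset.sum_nonneg fun _ _ => norm_nonneg _
    linarith
  rw [hT', norm_mul, mul_assoc K']
  refine mul_le_mul hq ?_ (norm_nonneg _) (by positivity)
  exact norm_coeff_mul_tPf_le hp hN k (le_max_left _ _)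
    (fun i j => (norm_tBlock_le_majorant _ i j).trans g3.le) ha (fun i => (gb i).1.le)
    (fun i => (gb i).2.le) hb

lemma nome_ne_zero (τ : UpperHalfPlane) : nome τ ≠ 0 := Complex.exp_ne_zero _

lemma norm_nome_lt_one (τ : UpperHalfPlane) : ‖nome τ‖ < 1 := by
  rw [nome, Complex.norm_exp, Real.exp_lt_one_iff]
  have h1 : (Real.pi * Complex.I * (τ : ℂ)).re = -(Real.pi * τ.im) := by simp [mul_assoc]
  rw [h1, neg_lt_zero]
  exact mul_pos Real.pi_pos τ.im_pos

lemma expVar_ne_zero {N : ℕ} (z : Fin N → ℂ) (i : Fin N) : expVar z i ≠ 0 := Complex.exp_ne_zero _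

/-! ### The pfaffian of an infinite sum of rank two matrices. -/

section Expansion

lemma continuous_pfNorm {κ ι : Type*} [Fintype κ] [DecidableEq κ] [Fintype ι] [DecidableEq ι]
    (e : κ × Bool ≃ ι) : Continuous fun A : Matrix ι ι ℂ => pfNorm e A := by
  unfold pfNorm pfSum pfForm
  refine continuous_const.mul (continuous_finsetSum _ fun σ _ => continuous_const.mul
    (continuous_finsetProd _ fun j _ => ?_))
  fun_prop

lemma pfNorm_smul {κ ι : Type*} [Fintype κ] [DecidableEq κ] [Fintype ι] [DecidableEq ι]
    (e : κ × Bool ≃ ι) (c : ℂ) (A : Matrix ι ι ℂ) :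
    pfNorm e (Matrix.of fun i j => c * A i j) = c ^ Fintype.card κ * pfNorm e A := by
  simp only [pfNorm, pfSum, pfForm, Matrix.of_apply, Finset.prod_mul_distrib, Finset.prod_const,
    Finset.card_univ, Finset.mul_sum]
  refine Finset.sum_congr rfl fun σ _ => ?_
  ring

variable {N : ℕ}

/-- The rank two summands in the expansion of the entries of the pfaffian. -/
def lambertWedge (p : ℂ) (y : Fin N → ℂ) (k : ℕ) : Matrix (Fin N) (Fin N) ℂ :=
  wedge (fun i => lambertCoeff p k * tCol y false k i) (tCol y true k)

lemma pfBordered_borderCols (hN : Even N) (p : ℂ) (y : Fin N → ℂ) {m : ℕ} (k : Indices m) :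
    pfBordered (stdPairs N hN) (tBlock y) (borderCols
      (fun k i => lambertCoeff p k * tCol y false k i) (tCol y true) (finsetOfIndices k)) =
    coeff p k * tPf y (tuple k) := by
  set g : Fin m ≃ finsetOfIndices k := Equiv.ofBijective
    (fun i => ⟨k.1 i - 1, Finset.mem_image_of_mem _ (Finset.mem_univ i)⟩) (by
      rw [Fintype.bijective_iff_injective_and_card]
      refine ⟨fun i j h => (indices_pred_strictMono k).injective (congrArg Subtype.val h), ?_⟩
      rw [Fintype.card_coe, card_finsetOfIndices, Fintype.card_fin]) with hg
  have hgv : ∀ i, (g i : ℕ) = k.1 i - 1 := fun i => rfl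
  rw [← pfBordered_relabel _ _ g, tPf_tuple hN]
  have h1 := pfBordered_scale (stdPairs N hN) (tBlock y)
    (fun (x : Fin m × Bool) => tCol y x.2 (k.1 x.1 - 1))
    (fun x => cond x.2 1 (lambertCoeff p (k.1 x.1 - 1)))
  rw [Fintype.prod_prod_type] at h1
  simp only [Fintype.prod_bool, cond_true, cond_false, one_mul] at h1
  rw [coeff_eq, ← h1]
  congr 1
  funext ⟨i, b⟩ r
  cases b <;> simp [borderCols, hgv]

/-- The expansion of the pfaffian as a series. -/
lemma hasSum_pfNorm (hN : Even N) {p : ℂ} {y : Fin N → ℂ}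
    (hw : ∀ i j, Summable fun k => lambertWedge p y k i j)
    (hs : Summable fun k : Σ m, Indices m => coeff p k.2 * tPf y (tuple k.2)) :
    HasSum (fun k : Σ m, Indices m => coeff p k.2 * tPf y (tuple k.2))
      (pfNorm (stdPairs N hN) (tBlock y - Matrix.of fun i j => ∑' k, lambertWedge p y k i j)) := by
  set G : Finset ℕ → ℂ := fun S => pfBordered (stdPairs N hN) (tBlock y) (borderCols
      (fun k i => lambertCoeff p k * tCol y false k i) (tCol y true) S) with hG
  have hGE : G ∘ indicesEquiv = fun k : Σ m, Indices m => coeff p k.2 * tPf y (tuple k.2) := by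
    funext ⟨m, k⟩
    exact pfBordered_borderCols hN p y k
  rw [← hGE] at hs ⊢
  rw [Equiv.hasSum_iff]
  have hsG : Summable G := (Equiv.summable_iff indicesEquiv).mp hs
  -- The finite expansion at level K is followed to the limit twice: as partial sums over subsets of
  -- {0, …, K-1}, and by continuity of the pfaffian in its entries.
  have h1 : Tendsto (fun K => ∑ S ∈ (Finset.range K).powerset, G S) atTop (𝓝 (∑' S, G S)) :=
    hsG.hasSum.comp (tendsto_finset_powerset_atTop_atTop.comp tendsto_finset_range)
  have h2 : Tendsto (fun K => pfNorm (stdPairs N hN)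
      (tBlock y - ∑ k ∈ Finset.range K, lambertWedge p y k)) atTop
      (𝓝 (pfNorm (stdPairs N hN)
        (tBlock y - Matrix.of fun i j => ∑' k, lambertWedge p y k i j))) := by
    refine ((continuous_pfNorm _).tendsto _).comp (tendsto_const_nhds.sub ?_)
    refine tendsto_pi_nhds.mpr fun i => tendsto_pi_nhds.mpr fun j => ?_
    have := (hw i j).hasSum.tendsto_sum_nat
    refine this.congr fun K => ?_
    rw [Matrix.sum_apply]
  have h3 : ∀ K, pfNorm (stdPairs N hN) (tBlock y - ∑ k ∈ Finset.range K, lambertWedge p y k) =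
      ∑ S ∈ (Finset.range K).powerset, G S := fun K => pfNorm_sub_sum_wedge _ _ _ _ _
  simp only [h3] at h2
  rw [tendsto_nhds_unique h2 h1]
  exact hsG.hasSum

end Expansion

/-- There are n(2n - 1) pairs, a number of the same parity as n. -/
lemma prodPairs_const_neg_one (n : ℕ) :
    (prodPairs fun _ _ : Fin (2 * n) => (-1 : ℂ)) = (-1) ^ n := by
  have h1 : ∀ i : Fin (2 * n), ∏ _j ∈ Finset.Ioi i, (-1 : ℂ) = (-1) ^ (2 * n - 1 - (i : ℕ)) :=
    fun i => by rw [Finset.prod_const, Fin.card_Ioi]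
  simp only [prodPairs, h1]
  rw [Fin.prod_univ_eq_prod_range fun i => (-1 : ℂ) ^ (2 * n - 1 - i),
    Finset.prod_range_reflect fun i => (-1 : ℂ) ^ i]
  induction n with
  | zero => simp
  | succ n ih =>
    have ih := ih (fun i => by rw [Finset.prod_const, Fin.card_Ioi])
    rw [show 2 * (n + 1) = 2 * n + 1 + 1 by ring, Finset.prod_range_succ, Finset.prod_range_succ,
      ih]
    rw [pow_succ _ (2 * n), pow_mul]
    ring

/-- Every index lies in N - 1 pairs. -/
lemma prodPairs_mul_self {N : ℕ} (h : Fin N → ℂ) :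
    (prodPairs fun i j => h i * h j) = (∏ i, h i) ^ (N - 1) := by
  rw [prodPairs_mul]
  have h1 : (prodPairs fun i _ : Fin N => h i) = ∏ i, h i ^ (N - 1 - (i : ℕ)) := by
    simp only [prodPairs, Finset.prod_const, Fin.card_Ioi]
  have h2 : (prodPairs fun _ j : Fin N => h j) = ∏ i, h i ^ (i : ℕ) := by
    rw [prodPairs, Finset.prod_comm' (t' := Finset.univ) (s' := fun j => Finset.Iio j) (by simp)]
    simp only [Finset.prod_const, Fin.card_Iio]
  rw [h1, h2, ← Finset.prod_mul_distrib, ← Finset.prod_pow]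
  refine Finset.prod_congr rfl fun i _ => ?_
  rw [← pow_add]
  congr 1
  omega

/-! ### The expansion where no denominator vanishes. -/

section Main

variable {n : ℕ} {τ : UpperHalfPlane} {z : Fin (2 * n) → ℂ}

/-- The region where the expansion holds. -/
def Admissible (n : ℕ) (τ : UpperHalfPlane) (z : Fin (2 * n) → ℂ) : Prop :=
  ∀ i j, ‖nome τ‖ < ‖expVar z i / expVar z j‖ ∧ ‖expVar z i / expVar z j‖ < ‖nome τ‖⁻¹

lemma Admissible.norm_sq_lt (hz : Admissible n τ z) (i j : Fin (2 * n)) :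
    ‖nome τ‖ ^ 2 * ‖expVar z i ^ 2‖ < ‖expVar z j ^ 2‖ := by
  have h0 : 0 < ‖expVar z i‖ := norm_pos_iff.mpr (expVar_ne_zero z i)
  have h := (hz j i).1
  rw [norm_div, lt_div_iff₀ h0] at h
  rw [norm_pow, norm_pow, ← mul_pow]
  exact pow_lt_pow_left₀ h (by positivity) two_ne_zero

lemma Admissible.summable_term (hz : Admissible n τ z) (m : ℕ) :
    Summable fun k : Indices m => ‖term (nome τ) (expVar z) k‖ := by
  obtain ⟨C, B, t, hB, ht0, ht, h⟩ := exists_local_bound (even_two_mul n) (norm_nome_lt_one τ)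
    (y := fun i => expVar z i ^ 2) (fun i => pow_ne_zero 2 (expVar_ne_zero z i))
    hz.norm_sq_lt m
  exact .of_nonneg_of_le (fun _ => norm_nonneg _) (h.self_of_nhds).2
    ((summable_indices hB ht0 ht m).mul_left C)

lemma regular_of_noPole (hp : NoPole n τ z) : Regular fun i => expVar z i ^ 2 := by
  refine ⟨fun i => pow_ne_zero 2 (expVar_ne_zero z i), fun i j h => ?_⟩
  have h6 : ‖nome τ ^ 6‖ < 1 := norm_pow_lt_one (norm_nome_lt_one τ) (by norm_num)
  apply hp i j
  rw [theta_eq_one_sub_mul h6]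
  have hj := expVar_ne_zero z j
  have : 1 - -(expVar z i ^ 6 / expVar z j ^ 6) = 0 := by
    field_simp
    linear_combination h
  rw [this, zero_mul]

/-- Shows that the Lambert terms, functions of the ratio x_i/x_j, have rank two up to a diagonal
congruence. -/
lemma lambertWedge_apply (p : ℂ) {N : ℕ} {x : Fin N → ℂ} (hx : ∀ i, x i ≠ 0) (k : ℕ)
    (i j : Fin N) :
    x i * x j * lambertWedge p (fun i => x i ^ 2) k i j =
      lambertCoeff p k * (x i / x j) ^ (2 * k + 1) -
        lambertCoeff p k * (x i / x j)⁻¹ ^ (2 * k + 1) := by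
  have hi := hx i
  have hj := hx j
  simp only [lambertWedge, wedge, tCol, Matrix.of_apply, cond_true, cond_false, zpow_neg,
    zpow_natCast, ← pow_mul, inv_div, div_pow]
  field_simp
  ring

/-- The entries of the pfaffian. -/
lemma entry_eq (hz : Admissible n τ z) (hp : NoPole n τ z) (i j : Fin (2 * n)) :
    (∀ i j, Summable fun k => lambertWedge (nome τ) (fun i => expVar z i ^ 2) k i j) ∧
    expVar z i *
          (theta (expVar z i ^ 2 / expVar z j ^ 2) (nome τ ^ 2) *
            theta (-(expVar z i ^ 2 / expVar z j ^ 2)) (nome τ ^ 2) *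
            theta (nome τ * (expVar z i ^ 2 / expVar z j ^ 2)) (nome τ ^ 2)) /
        (expVar z j * theta (-(expVar z i ^ 6 / expVar z j ^ 6)) (nome τ ^ 6)) =
    C1 (nome τ) * (expVar z i * (tBlock (fun i => expVar z i ^ 2) -
      Matrix.of fun i j => ∑' k, lambertWedge (nome τ) (fun i => expVar z i ^ 2) k i j) i j *
      expVar z j) := by
  have hp1 := norm_nome_lt_one τ
  have hp0 := nome_ne_zero τ
  have hx := expVar_ne_zero z
  have hpos : 0 < ‖nome τ‖ := norm_pos_iff.mpr hp0
  have hu : ∀ i j, expVar z i / expVar z j ∈ annulus ‖nome τ‖ := hz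
  have hs : ∀ i j, Summable fun k =>
      expVar z i * expVar z j * lambertWedge (nome τ) (fun i => expVar z i ^ 2) k i j := by
    intro i j
    simp only [lambertWedge_apply (nome τ) hx]
    exact (summable_lambert hp1 (mul_norm_lt_one hpos (hu i j))).sub
      (summable_lambert hp1 (mul_norm_lt_one hpos (inv_mem_annulus hpos (hu i j))))
  refine ⟨fun i j => (summable_mul_left_iff (mul_ne_zero (hx i) (hx j))).mp (hs i j), ?_⟩
  have hreg := (regular_of_noPole hp).2 i j
  simp only [] at hreg
  have hi := hx i
  have hj := hx j
  have hpole : 1 + (expVar z i / expVar z j) ^ 6 ≠ 0 := by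
    intro h
    apply hreg
    field_simp at h
    linear_combination h
  have key := thetaQuot_expansion hp0 hp1 (hu i j) hpole
  have hL : lambertSeries (nome τ) (expVar z i / expVar z j) -
      lambertSeries (nome τ) (expVar z i / expVar z j)⁻¹ =
      expVar z i * expVar z j * ∑' k, lambertWedge (nome τ) (fun i => expVar z i ^ 2) k i j := by
    rw [← tsum_mul_left]
    simp only [lambertWedge_apply (nome τ) hx]
    exact ((summable_lambert hp1 (mul_norm_lt_one hpos (hu i j))).tsum_sub
      (summable_lambert hp1 (mul_norm_lt_one hpos (inv_mem_annulus hpos (hu i j))))).symm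
  have hA : expVar z i / expVar z j * (1 - (expVar z i / expVar z j) ^ 4) /
      (1 + (expVar z i / expVar z j) ^ 6) = expVar z i * expVar z j *
      tBlock (fun i => expVar z i ^ 2) i j := by
    simp only [tBlock, Matrix.of_apply]
    rw [mul_div_assoc', div_eq_div_iff hpole hreg]
    field_simp
  have h2 : expVar z i ^ 2 / expVar z j ^ 2 = (expVar z i / expVar z j) ^ 2 := by rw [div_pow]
  have h6 : expVar z i ^ 6 / expVar z j ^ 6 = ((expVar z i / expVar z j) ^ 2) ^ 3 := by
    rw [← pow_mul, div_pow]
  rw [hL, hA, thetaQuot] at key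
  rw [Matrix.sub_apply, Matrix.of_apply, mul_div_mul_comm, h2, h6, key]
  ring

/-- The expansion at the points where no denominator vanishes. -/
theorem P1_eq_expansion (hn : 1 ≤ n) (hz : Admissible n τ z) (hp : NoPole n τ z) :
    P1 n τ z = expansion n (nome τ) (expVar z) := by
  have hN : Even (2 * n) := even_two_mul n
  have hx := expVar_ne_zero z
  have h6 : ‖nome τ ^ 6‖ < 1 := norm_pow_lt_one (norm_nome_lt_one τ) (by norm_num)
  have hreg := regular_of_noPole hp
  set y : Fin (2 * n) → ℂ := fun i => expVar z i ^ 2 with hy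
  set p := nome τ
  set x := expVar z
  set D2 : ℂ := prodPairs fun i j => (y j ^ 2 - y i ^ 2) with hD2
  set D3 : ℂ := prodPairs fun i j => (y j ^ 3 + y i ^ 3) with hD3
  have hD3' : D3 ≠ 0 := prodPairs_ne_zero fun i j _ => hreg.2 i j
  have hT : ∀ {m : ℕ} (k : Indices m),
      coeff p k * tPf y (tuple k) = term p x k * (D2 / D3) := by
    intro m k
    have := ratEval_T_mul (even_add_self_add hN m) hreg (tuple k)
    rw [term, mul_assoc, mul_div_assoc', this, mul_div_cancel_left₀ _ hD3']
  have hzero : ∀ m, n < m → ∀ k : Indices m, coeff p k * tPf y (tuple k) = 0 := by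
    intro m hm k
    rw [tPf_tuple hN, pfBordered_eq_zero, mul_zero]
    rw [Fintype.card_fin, Fintype.card_fin]
    omega
  have hsn : Summable fun k : Σ m, Indices m => ‖coeff p k.2 * tPf y (tuple k.2)‖ := by
    rw [summable_sigma_of_nonneg fun _ => norm_nonneg _]
    refine ⟨fun m => ?_, ?_⟩
    · simp only [hT, norm_mul _ (D2 / D3)]
      exact (hz.summable_term m).mul_right _
    · refine summable_of_ne_finset_zero (s := Finset.range (n + 1)) fun m hm => ?_
      have hm : n < m := by simpa using hm
      simp [hzero m hm]
  have hs := hsn.of_norm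
  -- The summability does not depend on the chosen entry; 0 is an index because n ≥ 1.
  have hpf := hasSum_pfNorm hN (entry_eq hz hp ⟨0, by omega⟩ ⟨0, by omega⟩).1 hs
  have hpf' : pfNorm (stdPairs (2 * n) hN)
      (tBlock y - Matrix.of fun i j => ∑' k, lambertWedge p y k i j) =
      (∑ m ∈ Finset.range (n + 1), ∑' k : Indices m, term p x k) * (D2 / D3) := by
    rw [← hpf.tsum_eq, hs.tsum_sigma, tsum_eq_sum (s := Finset.range (n + 1)), Finset.sum_mul]
    · refine Finset.sum_congr rfl fun m _ => ?_
      simp only [hT]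
      exact tsum_mul_right
    · intro m hm
      have hm : n < m := by simpa using hm
      simp [hzero m hm]
  have hmat : pfaffian (Matrix.of fun i j : Fin (2 * n) =>
      x i * (theta (x i ^ 2 / x j ^ 2) (p ^ 2) * theta (-(x i ^ 2 / x j ^ 2)) (p ^ 2) *
            theta (p * (x i ^ 2 / x j ^ 2)) (p ^ 2)) /
        (x j * theta (-(x i ^ 6 / x j ^ 6)) (p ^ 6))) =
      C1 p ^ n * ((∏ i, x i) * ((∑ m ∈ Finset.range (n + 1), ∑' k : Indices m, term p x k) *
        (D2 / D3))) := by
    rw [← hpf', ← pfNorm_scale, pfaffian_eq_pfNorm hN]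
    have h1 := pfNorm_smul (stdPairs (2 * n) hN) (C1 p) (Matrix.of fun i j => x i *
      (tBlock y - Matrix.of fun i j => ∑' k, lambertWedge p y k i j) i j * x j)
    have h2 : C1 p ^ n = C1 p ^ Fintype.card (Fin (2 * n / 2)) := by
      rw [Fintype.card_fin, Nat.mul_div_cancel_left n two_pos]
    rw [h2, ← h1]
    congr 1
    ext i j
    exact (entry_eq hz hp i j).2
  have hpre : (prodPairs fun i j => x j ^ 3 / x i ^ 3 * theta (-(x i ^ 6 / x j ^ 6)) (p ^ 6)) =
      D3 * (prodPairs fun i j => (x i ^ 3)⁻¹ * (x j ^ 3)⁻¹) *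
      prodPairs fun i j => qPoch (-(p ^ 6 * x i ^ 6 / x j ^ 6)) (p ^ 6) *
          qPoch (-(p ^ 6 * x j ^ 6 / x i ^ 6)) (p ^ 6) := by
    rw [hD3, ← prodPairs_mul, ← prodPairs_mul]
    refine prodPairs_congr fun i j _ => ?_
    have hi := hx i
    have hj := hx j
    rw [theta_eq_one_sub_mul h6,
      show p ^ 6 * -(x i ^ 6 / x j ^ 6) = -(p ^ 6 * x i ^ 6 / x j ^ 6) by ring,
      show p ^ 6 / -(x i ^ 6 / x j ^ 6) = -(p ^ 6 * x j ^ 6 / x i ^ 6) by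
        rw [div_neg, div_div_eq_mul_div], ← mul_assoc]
    congr 1
    simp only [hy]
    field_simp
    ring
  have hvan : vandermonde (fun i => x i ^ 4) = (-1) ^ n * D2 := by
    rw [← prodPairs_const_neg_one, hD2, ← prodPairs_mul, vandermonde]
    refine prodPairs_congr fun i j _ => ?_
    simp only [hy]; ring
  have hX0 : (∏ i, x i) ≠ 0 := Finset.prod_ne_zero_iff.mpr fun i _ => hx i
  -- The exponent is -3(2n - 1) from the prefactors of the pfaffian plus 1 from the diagonal
  -- congruence.
  have hXpow : (∏ i, (x i ^ 3)⁻¹) ^ (2 * n - 1) * ∏ i, x i = (∏ i, x i) ^ (4 - 6 * (n : ℤ)) := by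
    rw [Finset.prod_inv_distrib, Finset.prod_pow]
    obtain ⟨k, rfl⟩ : ∃ k, n = k + 1 := ⟨n - 1, by omega⟩
    rw [show 2 * (k + 1) - 1 = 2 * k + 1 by omega,
      show (4 - 6 * ((k + 1 : ℕ) : ℤ)) = -((3 * (2 * k + 1) : ℕ) : ℤ) + 1 by push_cast; ring,
      zpow_add₀ hX0, zpow_one, zpow_neg, zpow_natCast, pow_mul, inv_pow]
  have hsign : ((-1 : ℂ) ^ n) * (-1) ^ n = 1 := by rw [← mul_pow]; simp
  rw [P1, expansion, hmat, hpre, prodPairs_mul_self, hvan, ← hXpow]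
  have hD : D3 * (D2 / D3) = D2 := mul_div_cancel₀ _ hD3'
  generalize D2 / D3 = d at hD ⊢
  rw [← hD]
  generalize (∏ i, (x i ^ 3)⁻¹) ^ (2 * n - 1) = a
  generalize (prodPairs fun i j => qPoch (-(p ^ 6 * x i ^ 6 / x j ^ 6)) (p ^ 6) *
    qPoch (-(p ^ 6 * x j ^ 6 / x i ^ 6)) (p ^ 6)) = b
  generalize (∑ m ∈ Finset.range (n + 1), ∑' k : Indices m, term p x k) = c
  linear_combination (-(C1 p ^ n * (a * ∏ i, x i) * D3 * d * b * c)) * hsign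

/-! ### Extension by continuity. -/

lemma continuous_expVar {N : ℕ} : Continuous fun z : Fin N → ℂ => expVar z := by
  unfold expVar; fun_prop

lemma continuousAt_expVar {N : ℕ} (z : Fin N → ℂ) (i : Fin N) :
    ContinuousAt (fun w : Fin N → ℂ => expVar w i) z :=
  ((continuous_apply i).comp continuous_expVar).continuousAt

/-- The Weierstrass test with the locally uniform majorant; each term is continuous because it is a
Laurent polynomial in the squares of the nonzero variables. -/
lemma continuousAt_tsum_term (hz : Admissible n τ z) (m : ℕ) :
    ContinuousAt (fun w : Fin (2 * n) → ℂ => ∑' k : Indices m, term (nome τ) (expVar w) k) z := by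
  obtain ⟨C, B, t, hB, ht0, ht, h⟩ := exists_local_bound (even_two_mul n) (norm_nome_lt_one τ)
    (y := fun i => expVar z i ^ 2) (fun i => pow_ne_zero 2 (expVar_ne_zero z i))
    hz.norm_sq_lt m
  obtain ⟨U, hU, hUo, hyU⟩ := eventually_nhds_iff.mp h
  have hc : ContinuousOn (fun y : Fin (2 * n) → ℂ =>
      ∑' k : Indices m, coeff (nome τ) k * ratEval (T (2 * n) (tuple k)) y) U := by
    refine continuousOn_tsum (fun k => ?_) ((summable_indices hB ht0 ht m).mul_left C)
      fun k y hy => (hU y hy).2 k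
    obtain ⟨r, g, hg⟩ := (isLaurent_T (even_add_self_add (even_two_mul n) m) (tuple k)).ratEval_eq
    refine continuousOn_const.mul (ContinuousOn.congr (f := fun y =>
      MvPolynomial.eval y g / (∏ i, y i) ^ r) ?_ fun y hy => hg y (hU y hy).1)
    refine (MvPolynomial.continuous_eval g).continuousOn.div (by fun_prop) fun y hy => ?_
    exact pow_ne_zero _ (Finset.prod_ne_zero_iff.mpr fun i _ => (hU y hy).1 i)
  have h2 : ContinuousAt (fun w : Fin (2 * n) → ℂ => fun i => expVar w i ^ 2) z :=
    continuousAt_pi.mpr fun i => (continuousAt_expVar z i).pow 2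
  exact ContinuousAt.comp (f := fun w : Fin (2 * n) → ℂ => fun i => expVar w i ^ 2)
    (hc.continuousAt (hUo.mem_nhds hyU)) h2

lemma continuousAt_expansion (hz : Admissible n τ z) :
    ContinuousAt (fun w => expansion n (nome τ) (expVar w)) z := by
  have h6 : ‖nome τ ^ 6‖ < 1 := norm_pow_lt_one (norm_nome_lt_one τ) (by norm_num)
  have hx : ∀ i, ContinuousAt (fun w : Fin (2 * n) → ℂ => expVar w i) z :=
    continuousAt_expVar z
  have hq : ∀ i j, ContinuousAt (fun w : Fin (2 * n) → ℂ =>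
      qPoch (-(nome τ ^ 6 * expVar w i ^ 6 / expVar w j ^ 6)) (nome τ ^ 6)) z := by
    intro i j
    refine ContinuousAt.comp (g := fun a => qPoch a (nome τ ^ 6))
      (differentiable_qPoch h6).continuous.continuousAt ?_
    exact ((continuousAt_const.mul ((hx i).pow 6)).div ((hx j).pow 6)
      (pow_ne_zero 6 (expVar_ne_zero z j))).neg
  unfold expansion
  refine ContinuousAt.mul (ContinuousAt.mul (ContinuousAt.mul (ContinuousAt.mul
    continuousAt_const ?_) ?_) ?_) ?_
  · refine ContinuousAt.zpow₀ ?_ _ (Or.inl (Finset.prod_ne_zero_iff.mpr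
      fun i _ => expVar_ne_zero z i))
    exact tendsto_finsetProd _ fun i _ => hx i
  · unfold vandermonde prodPairs
    exact tendsto_finsetProd _ fun i _ => tendsto_finsetProd _ fun j _ =>
      ((hx i).pow 4).sub ((hx j).pow 4)
  · unfold prodPairs
    exact tendsto_finsetProd _ fun i _ => tendsto_finsetProd _ fun j _ => (hq i j).mul (hq j i)
  · exact tendsto_finsetSum _ fun m _ => continuousAt_tsum_term hz m

lemma Admissible.eventually (hz : Admissible n τ z) : ∀ᶠ w in 𝓝 z, Admissible n τ w := by
  refine eventually_all.mpr fun i => eventually_all.mpr fun j => ?_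
  have hc : ContinuousAt (fun w : Fin (2 * n) → ℂ => ‖expVar w i / expVar w j‖) z :=
    ContinuousAt.norm (ContinuousAt.div (continuousAt_expVar z i) (continuousAt_expVar z j)
      (expVar_ne_zero z j))
  exact (continuousAt_const.eventually_lt hc (hz i j).1).and
    (hc.eventually_lt continuousAt_const (hz i j).2)

/-- In the annulus the remaining factors of the theta function have no zeros. -/
lemma noPole_of_ne (hz : Admissible n τ z)
    (h : ∀ i j, 1 + expVar z i ^ 6 / expVar z j ^ 6 ≠ 0) : NoPole n τ z := by
  intro i j
  have hp1 := norm_nome_lt_one τ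
  have hpos : 0 < ‖nome τ‖ := norm_pos_iff.mpr (nome_ne_zero τ)
  have h6 : ‖nome τ ^ 6‖ < 1 := norm_pow_lt_one hp1 (by norm_num)
  have hu : ∀ i j, (expVar z i / expVar z j) ^ 6 ∈ annulus (‖nome τ‖ ^ 6) := fun i j =>
    pow_mem_annulus hpos.le (hz i j) (by norm_num)
  have e1 := mul_norm_lt_one (pow_pos hpos 6) (hu i j)
  have e2 := mul_norm_lt_one (pow_pos hpos 6) (hu j i)
  rw [theta_eq_one_sub_mul h6, sub_neg_eq_add]
  refine mul_ne_zero (h i j) (mul_ne_zero (qPoch_ne_zero_of_norm_lt h6 ?_)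
    (qPoch_ne_zero_of_norm_lt h6 ?_))
  · simpa [div_pow] using e1
  · rw [div_neg, div_div_eq_mul_div, norm_neg, norm_div, norm_mul, norm_pow, norm_pow, norm_pow]
    rw [norm_pow, norm_div, div_pow, mul_div_assoc'] at e2
    exact e2

/-- Along the real line z_i + t·i a denominator with i ≠ j can vanish only when c·exp(tω) = -1,
where ω ≠ 0. The derivative at t = 0 is nonzero, so this fails for all small t ≠ 0. -/
lemma neBot_noPole (hz : Admissible n τ z) : (𝓝[{w | NoPole n τ w}] z).NeBot := by
  set γ : ℝ → Fin (2 * n) → ℂ := fun t i => z i + t * ((i : ℕ) : ℂ) with hγ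
  have hγc : Continuous γ := by unfold γ; fun_prop
  have hγ0 : γ 0 = z := by funext i; simp [hγ]
  have hγt : Tendsto γ (𝓝[≠] 0) (𝓝 z) := by
    have := hγc.tendsto 0
    rw [hγ0] at this
    exact this.mono_left nhdsWithin_le_nhds
  have hev : ∀ᶠ t in 𝓝[≠] (0 : ℝ), ∀ i j,
      1 + expVar (γ t) i ^ 6 / expVar (γ t) j ^ 6 ≠ 0 := by
    refine eventually_all.mpr fun i => eventually_all.mpr fun j => ?_
    set ω : ℂ := 6 * (Real.pi * Complex.I) * (((i : ℕ) : ℂ) - ((j : ℕ) : ℂ)) with hω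
    have hform : ∀ t : ℝ, expVar (γ t) i ^ 6 / expVar (γ t) j ^ 6 =
        Complex.exp (6 * (Real.pi * Complex.I) * (z i - z j)) * Complex.exp (t * ω) := by
      intro t
      rw [expVar, expVar, ← Complex.exp_nat_mul, ← Complex.exp_nat_mul, ← Complex.exp_sub,
        ← Complex.exp_add]
      congr 1
      simp only [hγ, hω]
      push_cast; ring
    by_cases hij : i = j
    · subst hij
      refine Eventually.of_forall fun t => ?_
      rw [div_self (pow_ne_zero 6 (expVar_ne_zero _ _))]
      norm_num
    · have hω0 : ω ≠ 0 := by
        refine mul_ne_zero (mul_ne_zero (by norm_num) (mul_ne_zero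
          (by exact_mod_cast Real.pi_ne_zero) Complex.I_ne_zero)) (sub_ne_zero.mpr ?_)
        exact_mod_cast fun h => hij (Fin.ext h)
      set c := Complex.exp (6 * (Real.pi * Complex.I) * (z i - z j)) with hc
      have hd : HasDerivAt (fun t : ℝ => c * Complex.exp (t * ω)) (c * (Complex.exp ((0 : ℝ) * ω) *
          ω)) 0 := by
        refine HasDerivAt.const_mul c (HasDerivAt.cexp ?_)
        simpa using (Complex.ofRealCLM.hasDerivAt (x := (0 : ℝ))).mul_const ω
      have := hd.eventually_ne (c := -1) (mul_ne_zero (Complex.exp_ne_zero _)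
        (mul_ne_zero (Complex.exp_ne_zero _) hω0))
      filter_upwards [this] with t ht h
      rw [hform] at h
      exact ht (by linear_combination h)
  have hmem : ∀ᶠ t in 𝓝[≠] (0 : ℝ), γ t ∈ {w | NoPole n τ w} := by
    filter_upwards [hev, hγt.eventually hz.eventually] with t h1 h2 using noPole_of_ne h2 h1
  exact (tendsto_nhdsWithin_iff.mpr ⟨hγt, hmem⟩).neBot

end Main

end EllipticPfaffian

end

theorem mainTheorem9 (n : ℕ) (hn : 1 ≤ n) (τ : UpperHalfPlane) (z : Fin (2 * n) → ℂ)
    (hz : ∀ i j : Fin (2 * n),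
      ‖EllipticPfaffian.nome τ‖ <
          ‖EllipticPfaffian.expVar z i / EllipticPfaffian.expVar z j‖ ∧
        ‖EllipticPfaffian.expVar z i / EllipticPfaffian.expVar z j‖ <
          ‖EllipticPfaffian.nome τ‖⁻¹) :
    -- the functions `T` that occur are Laurent polynomials
    (∀ m ≤ n, ∀ k : EllipticPfaffian.Indices m,
      EllipticPfaffian.IsLaurentPolynomial
        (EllipticPfaffian.T (2 * n) (EllipticPfaffian.tuple k))) ∧
    -- the sums on the right-hand side converge absolutely
    (∀ m ≤ n, Summable fun k : EllipticPfaffian.Indices m =>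
      ‖EllipticPfaffian.term (EllipticPfaffian.nome τ) (EllipticPfaffian.expVar z) k‖) ∧
    -- the expansion, where the formula for the pfaffian has no vanishing denominator
    (EllipticPfaffian.NoPole n τ z →
      EllipticPfaffian.P1 n τ z =
        EllipticPfaffian.expansion n (EllipticPfaffian.nome τ) (EllipticPfaffian.expVar z)) ∧
    -- the expansion in general, where the pfaffian is extended by continuity
    (𝓝[{w | EllipticPfaffian.NoPole n τ w}] z).NeBot ∧
    Tendsto (EllipticPfaffian.P1 n τ) (𝓝[{w | EllipticPfaffian.NoPole n τ w}] z)
      (𝓝 (EllipticPfaffian.expansion n (EllipticPfaffian.nome τ)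
        (EllipticPfaffian.expVar z))) := by
  have hz' : EllipticPfaffian.Admissible n τ z := hz
  refine ⟨fun m _ k => EllipticPfaffian.isLaurent_T
      (EllipticPfaffian.even_add_self_add (even_two_mul n) m) _,
    fun m _ => hz'.summable_term m, EllipticPfaffian.P1_eq_expansion hn hz',
    EllipticPfaffian.neBot_noPole hz', ?_⟩
  refine ((EllipticPfaffian.continuousAt_expansion hz').tendsto.mono_left
    nhdsWithin_le_nhds).congr' ?_
  filter_upwards [self_mem_nhdsWithin, nhdsWithin_le_nhds hz'.eventually] with w h1 h2
  exact (EllipticPfaffian.P1_eq_expansion hn h2 h1).symm
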